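/- Let $d\ge 2$ and let $\mathbb{H}^d=\mathbb{R}^{d-1}\times(0,\infty)$ be hyperbolic space in the half-space model, with $\partial\mathbb{H}^d=(\mathbb{R}^{d-1}\times\{0\})\cup\{\infty\}$ its points at infinity. Let $G$ be a connected simple graph embedded in $\mathbb{H}^d$ such that its edges are geodesic segments, every compact subset of $\mathbb{H}^d$ meets only finitely many vertices and edges of $G$, and some group of isometries of $\mathbb{H}^d$ acts on $G$ by graph automorphisms, transitively on the vertex set $V(G)$; assume that $o=(0,\dots,0,1)$ is a vertex of $G$. Let $\omega$ be the random set of open edges in $p$-Bernoulli bond percolation on $G$, with law $\mathrm{P}_p$. For $\Phi\in\mathrm{Isom}(\mathbb{H}^d)$ let $G^\Phi=\Phi[G]$, with percolation process $\Phi[\omega]$. Put $L=\mathbb{R}^{d-1}\times(0,1]$; for a vertex $v\in V(G^\Phi)\cap L$ let $C_L^\Phi(v)\subseteq L$ be its cluster in the process $\Phi[\omega]\cap L$ on $G^\Phi\cap L$, i.e. the set of points reachable from $v$ along (pieces of) open edges inside $L$. Let $d_\partial(x,y)$ be the $\ell^\infty$-distance of the orthogonal projections of $x,y\in\mathbb{H}^d$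 to $\mathbb{R}^{d-1}$, and let $B_r=\{y\in\mathbb{H}^d: d_\partial(o,y)\le r\}$, $S_r=\mathrm{bd}\,B_r$, $B^1_r=B_r\cap L$. The size of $C\subseteq\mathbb{H}^d$ is $r(C)=\sup_{x\in C}d_\partial(o,x)\in[0,\infty]$ (with $r(\emptyset)=0$). For $h\in(0,1]$ and $R\in O(d)$ let $\Phi^{(h,R)}$ be the isometry of $\mathbb{H}^d$ with $\Phi^{(h,R)}(o)=(0,\dots,0,h)$ and $D\Phi^{(h,R)}(o)=hR$ (ordinary derivative in $\mathbb{R}^d$), and for $r>0$ let $$g_p(r)=\sup_{(h,R)\in(0,1]\times O(d)}\mathrm{P}_p\bigl(C_L^{\Phi^{(h,R)}}(\Phi^{(h,R)}(o))\cap S_r\ne\emptyset\bigr).$$ Let $C(o)$ be the cluster of $o$ in $\omega$ (as a subset of $\mathbb{H}^d$), $\partial C(o)$ the set of points at infinity in its closure in $\mathbb{H}^d\cup\partial\mathbb{H}^d$, and $$p_0=\sup\{p\in[0,1]:\ \mathrm{P}_p(x\in\partial C(o))=0\ \text{ for all } x\in\partial\mathbb{H}^d\}.$$ Let $p\in[0,1]$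 be such that there is $\psi>0$ with $g_p(r)\le e^{-\psi r}$ for all $r>0$, or such that $p<p_0$. Then for every $r_0>0$ there exist $\alpha,\phi>0$ such that for every $r\ge 0$ $$\sup_{\Phi\in\mathrm{Isom}(\mathbb{H}^d)}\mathrm{P}_p\Bigl(r\Bigl(\bigcup_{v\in B^1_{r_0}\cap V(G^\Phi)}C_L^\Phi(v)\Bigr)\ge r\Bigr)\le\alpha e^{-\phi r}.$$ -/

import Mathlib

open MeasureTheory Set
open scoped ENNReal unitInterval

noncomputable section

namespace HypPerc

/-! ### Hyperbolic space in the half-space model -/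

/-- The ambient Euclidean space `ℝ^d`, where `d = n + 1`. -/
abbrev Amb (n : ℕ) : Type := EuclideanSpace ℝ (Fin (n + 1))

/-- The half-space model `ℝ^{d-1} × (0, ∞)` of hyperbolic space `ℍ^d`, `d = n + 1`.  Its topology is
the Euclidean one, which is also the topology of the hyperbolic metric. -/
abbrev HSpace (n : ℕ) : Type := {x : Amb n // 0 < x (Fin.last n)}

variable {n : ℕ}

/-- The last coordinate. -/
def height (x : HSpace n) : ℝ := x.1 (Fin.last n)

/-- The hyperbolic distance of the half-space model. -/
def hdist (x y : HSpace n) : ℝ :=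
  2 * Real.arsinh (dist x.1 y.1 / (2 * √(height x * height y)))

/-- The isometry group of `ℍ^d`. -/
def isomGroup (n : ℕ) : Subgroup (Equiv.Perm (HSpace n)) where
  carrier := {Φ | ∀ x y, hdist (Φ x) (Φ y) = hdist x y}
  one_mem' := fun _ _ => rfl
  mul_mem' := by
    intro Φ Ψ hΦ hΨ x y
    rw [Equiv.Perm.mul_apply, Equiv.Perm.mul_apply, hΦ, hΨ]
  inv_mem' := by
    intro Φ hΦ x y
    have h := hΦ (Φ⁻¹ x) (Φ⁻¹ y)
    simpa using h.symm

/-- The hyperbolic geodesic segment with endpoints `x` and `y`. -/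
def geodSeg (x y : HSpace n) : Set (HSpace n) :=
  {z | hdist x z + hdist z y = hdist x y}

/-- The point `(0, …, 0, h)`. -/
def axisPoint (n : ℕ) (h : ℝ) (hh : 0 < h) : HSpace n :=
  ⟨EuclideanSpace.single (Fin.last n) h, by simpa using hh⟩

/-- The origin `o = (0, …, 0, 1)`. -/
def origin (n : ℕ) : HSpace n := axisPoint n 1 one_pos

/-- A self-map of the half-space as a function on `ℝ^d` (zero off the open half-space). -/
def ambMap (Φ : HSpace n → HSpace n) (x : Amb n) : Amb n :=
  open Classical in if hx : 0 < x (Fin.last n) then (Φ ⟨x, hx⟩).1 else 0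

/-- `Φ` is the isometry `Φ^{(h,R)}`, determined by `Φ(o) = (0, …, 0, h)` and `DΦ(o) = h R`, where
`R ∈ O(d)` and the derivative is the ordinary one in `ℝ^d`. -/
def IsPhi (h : ℝ) (hh : 0 < h) (R : Amb n ≃ₗᵢ[ℝ] Amb n) (Φ : isomGroup n) : Prop :=
  Φ.1 (origin n) = axisPoint n h hh ∧
    HasFDerivAt (ambMap Φ.1) (h • (R.toContinuousLinearEquiv : Amb n →L[ℝ] Amb n)) (origin n).1

/-- `d_∂(x, y)`: the maximum-norm distance of the projections of `x` and `y` to `ℝ^{d-1}`. -/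
def projDist (x y : HSpace n) : ℝ :=
  ‖(fun i : Fin n => x.1 i.castSucc - y.1 i.castSucc)‖

/-- `L^h = ℝ^{d-1} × (0, h]`. -/
def slab (n : ℕ) (h : ℝ) : Set (HSpace n) := {x | height x ≤ h}

/-- `B_r(x)`. -/
def projBall (r : ℝ) (x : HSpace n) : Set (HSpace n) := {y | projDist x y ≤ r}

/-- `S_r(x)`, the topological boundary of `B_r(x)` in `ℍ^d`. -/
def projSphere (r : ℝ) (x : HSpace n) : Set (HSpace n) := frontier (projBall r x)

/-- `B_r^h(x) = B_r(x) ∩ L^h`. -/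
def projBallSlab (r h : ℝ) (x : HSpace n) : Set (HSpace n) := projBall r x ∩ slab n h

/-- The size `r(C) = sup_{x ∈ C} d_∂(o, x)`, with values in `[0, ∞]`. -/
def size (C : Set (HSpace n)) : ℝ≥0∞ := ⨆ x ∈ C, ENNReal.ofReal (projDist (origin n) x)

/-! ### The compactification by points at infinity -/

/-- `ℍ^d` with its points at infinity: the one-point compactification of the closed half-space
`ℝ^{d-1} × [0, ∞)`. -/
abbrev HHat (n : ℕ) : Type := OnePoint {x : Amb n // 0 ≤ x (Fin.last n)}

/-- The inclusion of `ℍ^d` in its compactification. -/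
def toHat (x : HSpace n) : HHat n :=
  ((⟨x.1, x.2.le⟩ : {x : Amb n // 0 ≤ x (Fin.last n)}) : HHat n)

/-- The set `∂ℍ^d` of points at infinity. -/
def idealBoundary (n : ℕ) : Set (HHat n) := (range (toHat (n := n)))ᶜ

/-- `∂C`: the closure of `C` in the compactification, minus `ℍ^d`. -/
def bdAtInfinity (C : Set (HSpace n)) : Set (HHat n) := closure (toHat '' C) \ range toHat

/-! ### Embedded graphs -/

/-- The geodesic segment between the two members of an unordered pair. -/
def segOf {V : Set (HSpace n)} (e : Sym2 V) : Set (HSpace n) :=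
  {z | ∃ v w : V, e = s(v, w) ∧ z ∈ geodSeg v.1 w.1}

/-- A simple graph embedded in `ℍ^d` whose edges are geodesic segments: an edge meets the vertex set
only in its endpoints, and two different edges meet only in vertices. -/
structure EmbGraph (n : ℕ) where
  verts : Set (HSpace n)
  graph : SimpleGraph verts
  vert_mem_edge : ∀ e ∈ graph.edgeSet, ∀ u : verts, u.1 ∈ segOf e → u ∈ e
  edge_inter_edge : ∀ e ∈ graph.edgeSet, ∀ f ∈ graph.edgeSet, e ≠ f →
    segOf e ∩ segOf f ⊆ verts

namespace EmbGraph

/-- Every compact set meets only finitely many vertices and edges. -/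
def LocFinite (G : EmbGraph n) : Prop :=
  ∀ K : Set (HSpace n), IsCompact K →
    (G.verts ∩ K).Finite ∧ {e ∈ G.graph.edgeSet | (segOf e ∩ K).Nonempty}.Finite

/-- Some group of isometries of `ℍ^d` acts on the graph by graph automorphisms, transitively on the
vertices. -/
def TransUnderIsom (G : EmbGraph n) : Prop :=
  ∃ Γ : Subgroup (Equiv.Perm (HSpace n)), Γ ≤ isomGroup n ∧
    (∀ γ ∈ Γ, ∃ a : G.graph ≃g G.graph, ∀ v : G.verts, (a v).1 = γ v.1) ∧
    ∀ v w : G.verts, ∃ γ ∈ Γ, γ v.1 = w.1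

/-- Percolation configurations: sets of (open) edges. -/
abbrev Config (G : EmbGraph n) : Type := Set G.graph.edgeSet

/-- The law of `p`-Bernoulli bond percolation: edges are open independently with probability `p`. -/
def perc (G : EmbGraph n) (p : I) : Measure G.Config :=
  ProbabilityTheory.setBernoulli Set.univ p

/-- `x` and `y` lie on the image under `Φ` of one and the same open edge, and in the same component
of the intersection of that image with `A`, i.e. the piece of that edge from `x` to `y` lies
in `A`. -/
def OpenStep (G : EmbGraph n) (Φ : isomGroup n) (A : Set (HSpace n)) (ω : G.Config)
    (x y : HSpace n) : Prop :=
  ∃ e ∈ ω, x ∈ Φ.1 '' segOf e.1 ∧ y ∈ Φ.1 '' segOf e.1 ∧ geodSeg x y ⊆ A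

/-- The cluster `C_A^Φ(v)` of `v ∈ V(G^Φ) ∩ A` in the percolation process `Φ[ω] ∩ A` on `G^Φ ∩ A`,
as a subset of `ℍ^d`: all points that can be reached from `v` along open edges (or pieces of open
edges) inside `A`. -/
def cluster (G : EmbGraph n) (Φ : isomGroup n) (A : Set (HSpace n)) (ω : G.Config)
    (v : HSpace n) : Set (HSpace n) :=
  {y | Relation.ReflTransGen (G.OpenStep Φ A ω) v y}

/-- The set `𝒩(G)` of those `p` for which no point at infinity lies in `∂C(o)` with positive
probability. -/
def nullSet (G : EmbGraph n) : Set I :=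
  {p | ∀ x ∈ idealBoundary n,
    G.perc p {ω | x ∈ bdAtInfinity (G.cluster 1 Set.univ ω (origin n))} = 0}

/-- The threshold `p₀(G) = sup 𝒩(G)`. -/
def p0 (G : EmbGraph n) : ℝ := sSup ((fun p : I => (p : ℝ)) '' G.nullSet)

/-- `g_p(r)`: the supremum over `h ∈ (0, 1]` and `R ∈ O(d)` of the probability that `Φ^{(h,R)}(o)` is
joined to `S_r` in `G^{(h,R)} ∩ L`. -/
def g (G : EmbGraph n) (p : I) (r : ℝ) : ℝ≥0∞ :=
  ⨆ (h : ℝ) (hh : 0 < h) (_ : h ≤ 1) (R : Amb n ≃ₗᵢ[ℝ] Amb n) (Φ : isomGroup n)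
    (_ : IsPhi h hh R Φ),
    G.perc p {ω | (G.cluster Φ (slab n 1) ω (Φ.1 (origin n)) ∩
      projSphere r (origin n)).Nonempty}

/-- Exponential decay of `g_p`: there is `ψ > 0` with `g_p(r) ≤ e^{-ψ r}` for all `r > 0`. -/
def ExpDecay (G : EmbGraph n) (p : I) : Prop :=
  ∃ ψ : ℝ, 0 < ψ ∧ ∀ r : ℝ, 0 < r → G.g p r ≤ ENNReal.ofReal (Real.exp (-ψ * r))

/-- The set `B^1_{r₀} ∩ V(G^Φ)`. -/
def thickOrigin (G : EmbGraph n) (r₀ : ℝ) (Φ : isomGroup n) : Set (HSpace n) :=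
  projBallSlab r₀ 1 (origin n) ∩ Φ.1 '' G.verts

end EmbGraph

end HypPerc

end

/-! Both hypotheses lead to one estimate, `UnifDecay`: the cluster in $L$ of a single vertex
$\Phi(x)\in L$ reaches horizontal distance $\rho$ from $\Phi(x)$ with probability at most
$Ae^{-\psi\rho}$, uniformly in $\Phi$ and $x$.

If $g_p$ decays (`unifDecay_of_expDecay`), an automorphism takes $o$ to $x$ and a horizontal
translation puts $\Phi(x)$ on the vertical axis. The derivative of a hyperbolic isometry is
conformal (`norm_fderiv_ambMap`), so the composite is some $\Phi^{(h,R)}$ and $g_p$ bounds its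
cluster.

If $p<p_0$ (`unifDecay_of_nullSet`), take $p'>p$ such that no point at infinity lies in $\partial
C(o)$ with positive $\mathrm{P}_{p'}$-probability. In the Klein model, a region that is horizontally
far after an isometry fixing $o$ is close to a single point of the sphere. Compactness therefore
makes such regions uniformly unlikely to be reached from $o$ at $p'$ (`exists_far_small`). A
sharpness argument of Duminil-Copin and Tassion type follows. If every finite set $S\ni x$ avoiding
the far region had at least $1/2$ expected boundary edges reached from $x$ at $p$, Russo's formula
would make the far region likely at $p'$ (`joined_real_ge`). So some $S$ has fewer, and iterating
across its boundary (`joined_real_le`) halves the probability with every distance $D$.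

To pass to all the vertices of $B^1_{r_0}$, of which there may be infinitely many at small heights,
a connection from $v$ to a distant $y$ is classified by the least dyadic slab of height $s=2^{-k}$
containing one. It visits a vertex $w$ of height comparable to $s$ (`exists_high_vertex`), and one
of $v,y$ is far from $w$, at a distance growing with both $r$ and $d_\partial(o,w)$. Rescaling by
$1/s$ turns `UnifDecay` into decay at rate $\psi/s$. A box of side $s$ contains boundedly many such
$w$, and the sums over boxes and over $k$ converge (`exists_size_decay`). -/

noncomputable section

namespace HypPerc

/-! ### Bernoulli random sets: invariance and independence. -/

section Bernoulli

open ProbabilityTheory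

variable {E : Type*}

/-- The marginal law of one coordinate of a Bernoulli random set. -/
abbrev bernMarg (q : I) : Measure Prop :=
  unitInterval.toNNReal q • Measure.dirac True +
    unitInterval.toNNReal (unitInterval.symm q) • Measure.dirac False

instance bernMarg_isProbabilityMeasure (q : I) : IsProbabilityMeasure (bernMarg q) := by
  constructor
  simp

/-- The law of a Bernoulli random subset of `E`. -/
abbrev bern (E : Type*) (q : I) : Measure (Set E) := setBernoulli Set.univ q

theorem bern_eq_map (q : I) :
    bern E q = Measure.map (fun f : E → Prop => {e | f e})
      (Measure.infinitePi fun _ : E => bernMarg q) := by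
  rw [bern, setBernoulli_eq_map]
  simp

theorem measurable_mem_coord (e : E) : Measurable fun ω : Set E => e ∈ ω := by fun_prop

theorem measurable_ofPred : Measurable fun f : E → Prop => {e | f e} :=
  MeasurableEquiv.setOfPred.measurable

theorem map_mem_bern (q : I) :
    Measure.map (fun (ω : Set E) e => e ∈ ω) (bern E q) =
      Measure.infinitePi fun _ : E => bernMarg q := by
  rw [bern_eq_map, Measure.map_map (by fun_prop) measurable_ofPred]
  exact Measure.map_id

theorem map_mem_coord_bern (q : I) (e : E) :
    Measure.map (fun ω : Set E => e ∈ ω) (bern E q) = bernMarg q := by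
  rw [← Measure.infinitePi_map_eval (fun _ : E => bernMarg q) e, ← map_mem_bern,
    Measure.map_map (by fun_prop) (by fun_prop)]
  rfl

theorem iIndepFun_bern (q : I) : iIndepFun (fun (e : E) (ω : Set E) => e ∈ ω) (bern E q) := by
  rw [iIndepFun_iff_map_fun_eq_infinitePi_map (fun e => measurable_mem_coord e), map_mem_bern]
  simp_rw [map_mem_coord_bern]

/-- Bernoulli percolation is invariant under permutations of the index set. -/
theorem bern_preimage_equiv (q : I) (s : E ≃ E) (A : Set (Set E)) :
    bern E q {ω | s ⁻¹' ω ∈ A} = bern E q A := by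
  have hmap : ∀ τ : E ≃ E, Measure.map (fun ω : Set E => τ ⁻¹' ω) (bern E q) = bern E q := by
    intro τ
    have h := Measure.map_infinitePi_infinitePi_of_inj (P := fun _ : E => bernMarg q) τ.injective
    have hm : Measurable fun ω : Set E => τ ⁻¹' ω := by
      refine (measurable_ofPred (E := E)).comp (g := fun f : E → Prop => {e | f e})
        (f := fun (ω : Set E) e => τ e ∈ ω) ?_
      fun_prop
    calc Measure.map (fun ω : Set E => τ ⁻¹' ω) (bern E q)
        = Measure.map (fun f : E → Prop => {e | f e})
            (Measure.map (fun (ω : E → Prop) i => ω (τ i))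
              (Measure.infinitePi fun _ : E => bernMarg q)) := by
          rw [bern_eq_map, Measure.map_map hm measurable_ofPred,
            Measure.map_map measurable_ofPred (by fun_prop)]
          rfl
      _ = _ := by rw [h, ← bern_eq_map]
  -- The outer measure of a preimage is bounded for every set, measurable or not; using it for `s`
  -- and for `s.symm` gives equality for arbitrary events.
  have hle : ∀ (τ : E ≃ E) (A : Set (Set E)), bern E q {ω | τ ⁻¹' ω ∈ A} ≤ bern E q A := by
    intro τ A
    have hm : Measurable fun ω : Set E => τ ⁻¹' ω := by
      refine (measurable_ofPred (E := E)).comp (g := fun f : E → Prop => {e | f e})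
        (f := fun (ω : Set E) e => τ e ∈ ω) ?_
      fun_prop
    conv_rhs => rw [← hmap τ]
    exact Measure.le_map_apply hm.aemeasurable A
  refine le_antisymm (hle s A) ?_
  have := hle s.symm {ω | s ⁻¹' ω ∈ A}
  refine le_trans (le_of_eq ?_) this
  congr 1
  ext ω
  simp only [mem_ofPred_eq, ← preimage_comp]
  simp

/-- The event `A` is determined by the states of the indices in `J`. -/
def DetBy (J : Set E) (A : Set (Set E)) : Prop :=
  ∀ ω ω' : Set E, ω ∩ J = ω' ∩ J → ω ∈ A → ω' ∈ A

theorem DetBy.mem_iff {J : Set E} {A : Set (Set E)} (h : DetBy J A) {ω ω' : Set E}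
    (hω : ω ∩ J = ω' ∩ J) : ω ∈ A ↔ ω' ∈ A :=
  ⟨h _ _ hω, h _ _ hω.symm⟩

theorem DetBy.mono {J K : Set E} {A : Set (Set E)} (h : DetBy J A) (hJK : J ⊆ K) : DetBy K A := by
  intro ω ω' hω
  refine h ω ω' ?_
  rw [← inter_eq_self_of_subset_right hJK, ← inter_assoc, hω, inter_assoc]

theorem DetBy.inter {J : Set E} {A B : Set (Set E)} (hA : DetBy J A) (hB : DetBy J B) :
    DetBy J (A ∩ B) := fun _ _ h h' => ⟨hA _ _ h h'.1, hB _ _ h h'.2⟩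

/-- Such an event is pulled back from a finite product of copies of `Prop`, where every set is
measurable. Measurability and independence follow from this. -/
theorem DetBy.eq_preimage {J : Finset E} {A : Set (Set E)} (h : DetBy (J : Set E) A) :
    A = (fun (ω : Set E) (e : J) => (e : E) ∈ ω) ⁻¹'
      ((fun (ω : Set E) (e : J) => (e : E) ∈ ω) '' A) := by
  refine subset_antisymm (subset_preimage_image _ _) ?_
  rintro ω ⟨ω', hω', h'⟩
  refine h ω' ω ?_ hω'
  ext e
  simp only [mem_inter_iff, and_congr_left_iff]
  intro he
  have := congrFun h' ⟨e, he⟩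
  simpa using this

theorem DetBy.measurableSet {J : Finset E} {A : Set (Set E)} (h : DetBy (J : Set E) A) :
    MeasurableSet A := by
  rw [h.eq_preimage]
  exact measurableSet_preimage (by fun_prop) (Set.Finite.measurableSet (Set.toFinite _))

/-- Events determined by disjoint sets of indices are independent. -/
theorem bern_inter_eq_mul (q : I) {J K : Finset E} (hJK : Disjoint J K) {A B : Set (Set E)}
    (hA : DetBy (J : Set E) A) (hB : DetBy (K : Set E) B) :
    bern E q (A ∩ B) = bern E q A * bern E q B := by
  have h := (iIndepFun_bern (E := E) q).indepFun_finset J K hJK fun e => measurable_mem_coord e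
  rw [hA.eq_preimage, hB.eq_preimage]
  exact h.measure_inter_preimage_eq_mul _ _ (Set.Finite.measurableSet (Set.toFinite _))
    (Set.Finite.measurableSet (Set.toFinite _))

end Bernoulli

end HypPerc

namespace HypPerc

/-! ### Russo's formula and the resulting differential inequality. -/

section Russo

open ProbabilityTheory Finset
open scoped Classical

variable {E : Type*}

/-- The Bernoulli weight of the configuration `η` on the finite index set `J`. -/
def bernWeight (q : ℝ) (J η : Finset E) : ℝ := ∏ e ∈ J, if e ∈ η then q else 1 - q

theorem bernWeight_nonneg {q : ℝ} (h0 : 0 ≤ q) (h1 : q ≤ 1) (J η : Finset E) :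
    0 ≤ bernWeight q J η :=
  Finset.prod_nonneg fun e _ => by split_ifs <;> linarith

theorem bernMarg_real_singleton (q : I) (P : Prop) :
    (bernMarg q).real {P} = if P then (q : ℝ) else 1 - q := by
  by_cases h : P <;> simp [measureReal_def, h]

theorem bern_real_cylinder (q : I) (J η : Finset E) (hη : η ⊆ J) :
    (bern E q).real {ω | ω ∩ J = η} = bernWeight q J η := by
  have h := (iIndepFun_bern (E := E) q).measure_inter_preimage_eq_mul (S := J)
    (sets := fun e => {e ∈ η}) fun e _ => Set.Finite.measurableSet (Set.toFinite _)
  have h1 : {ω : Set E | ω ∩ J = η} = ⋂ e ∈ J, (fun ω : Set E => e ∈ ω) ⁻¹' {e ∈ η} := by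
    ext ω
    simp only [Set.mem_ofPred_eq, Set.mem_iInter, Set.mem_preimage, Set.mem_singleton_iff,
      Set.ext_iff, Set.mem_inter_iff, Finset.mem_coe, eq_iff_iff]
    constructor
    · intro h e he
      have := h e
      tauto
    · intro h e
      have h2 := h e
      have h3 := @hη e
      tauto
  rw [h1, measureReal_def, h, ENNReal.toReal_prod, bernWeight]
  refine Finset.prod_congr rfl fun e _ => ?_
  rw [← Measure.map_apply (measurable_mem_coord e) (Set.Finite.measurableSet (Set.toFinite _)),
    map_mem_coord_bern]
  have := bernMarg_real_singleton q (e ∈ η)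
  rw [measureReal_def] at this
  rw [this]
  congr

theorem bern_real_eq_sum (q : I) {J : Finset E} {A : Set (Set E)} (hA : DetBy (J : Set E) A) :
    (bern E q).real A = ∑ η ∈ J.powerset, if (η : Set E) ∈ A then bernWeight q J η else 0 := by
  have h1 : A = ⋃ η ∈ J.powerset.filter (fun η : Finset E => (η : Set E) ∈ A),
      {ω : Set E | ω ∩ J = η} := by
    ext ω
    simp only [Finset.mem_filter, Finset.mem_powerset, Set.mem_iUnion, Set.mem_ofPred_eq,
      exists_prop]
    constructor
    · intro h
      have h2 : (((J.filter (· ∈ ω) : Finset E)) : Set E) = ω ∩ J := by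
        ext e; simp [and_comm]
      refine ⟨J.filter (· ∈ ω), ⟨Finset.filter_subset _ _, ?_⟩, h2.symm⟩
      rw [h2]
      exact hA ω _ (by rw [Set.inter_assoc, Set.inter_self]) h
    · rintro ⟨η, ⟨h2, h3⟩, h4⟩
      refine hA η ω ?_ h3
      rw [h4, Set.inter_eq_left]
      exact_mod_cast h2
  conv_lhs => rw [h1]
  rw [measureReal_biUnion_finset]
  · rw [Finset.sum_filter]
    refine Finset.sum_congr rfl fun η hη => ?_
    split_ifs
    · exact bern_real_cylinder q J η (Finset.mem_powerset.1 hη)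
    · rfl
  · intro η _ η' _ hne
    rw [Function.onFun, Set.disjoint_left]
    intro ω h h'
    exact hne (by simpa using h.symm.trans h')
  · intro η _
    refine DetBy.measurableSet (J := J) ?_
    intro ω ω' h h'
    exact h.symm.trans h'

theorem hasDerivAt_bernWeight (q : ℝ) (J η : Finset E) :
    HasDerivAt (fun q => bernWeight q J η)
      (∑ e ∈ J, bernWeight q (J.erase e) η * if e ∈ η then 1 else -1) q := by
  have h : ∀ e ∈ J, HasDerivAt (fun q : ℝ => if e ∈ η then q else 1 - q)
      (if e ∈ η then 1 else -1) q := by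
    intro e _
    split_ifs
    · exact hasDerivAt_id q
    · simpa using (hasDerivAt_id q).const_sub 1
  have := HasDerivAt.fun_finsetProd h
  simpa [bernWeight] using this

theorem bernWeight_insert (q : ℝ) {J η : Finset E} {e : E} (he : e ∉ J) :
    bernWeight q J (insert e η) = bernWeight q J η := by
  refine Finset.prod_congr rfl fun e' he' => ?_
  have : e' ≠ e := fun h => he (h ▸ he')
  simp [this]

/-- The polynomial `q ↦ P_q(A)` of an event `A` determined by `J`. -/
def bernPoly (J : Finset E) (A : Set (Set E)) (q : ℝ) : ℝ :=
  ∑ η ∈ J.powerset, if (η : Set E) ∈ A then bernWeight q J η else 0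

theorem sum_powerset_erase {J : Finset E} {e : E} (he : e ∈ J) (f : Finset E → ℝ) :
    ∑ η ∈ J.powerset, f η =
      ∑ η ∈ (J.erase e).powerset, (f η + f (insert e η)) := by
  conv_lhs => rw [← Finset.insert_erase he]
  rw [Finset.sum_powerset_insert (Finset.notMem_erase e J), Finset.sum_add_distrib]

/-- **Russo's formula**. -/
theorem hasDerivAt_bernPoly (J : Finset E) {A : Set (Set E)}
    (hmono : ∀ ω ω' : Set E, ω ⊆ ω' → ω ∈ A → ω' ∈ A) (q : ℝ) :
    ∃ f', HasDerivAt (bernPoly J A) f' q ∧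
      (1 - q) * f' = ∑ e ∈ J, bernPoly J {ω | e ∉ ω ∧ ω ∉ A ∧ insert e ω ∈ A} q := by
  have hd : HasDerivAt (bernPoly J A) (∑ η ∈ J.powerset, if (η : Set E) ∈ A then
      (∑ e ∈ J, bernWeight q (J.erase e) η * if e ∈ η then 1 else -1) else 0) q := by
    refine HasDerivAt.fun_sum fun η _ => ?_
    split_ifs
    · exact hasDerivAt_bernWeight q J η
    · exact hasDerivAt_const q 0
  refine ⟨_, hd, ?_⟩
  have h1 : ∀ η ∈ J.powerset, (if (η : Set E) ∈ A then
      (∑ e ∈ J, bernWeight q (J.erase e) η * if e ∈ η then (1 : ℝ) else -1) else 0) =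
      ∑ e ∈ J, if (η : Set E) ∈ A then
        bernWeight q (J.erase e) η * (if e ∈ η then (1 : ℝ) else -1) else 0 := by
    intro η _
    split_ifs <;> simp
  rw [Finset.sum_congr rfl h1, Finset.sum_comm, Finset.mul_sum]
  refine Finset.sum_congr rfl fun e he => ?_
  -- Pair `η` with `insert e η`. Their terms cancel unless `e` is pivotal, and the factor $1-q$ is
  -- the weight of `e` being closed.
  rw [bernPoly, sum_powerset_erase he, sum_powerset_erase he, Finset.mul_sum]
  refine Finset.sum_congr rfl fun η hη => ?_
  have heη : e ∉ η := fun h => Finset.notMem_erase e J (Finset.mem_powerset.1 hη h)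
  have hw : bernWeight q J η = (1 - q) * bernWeight q (J.erase e) η := by
    rw [bernWeight, ← Finset.mul_prod_erase J _ he, if_neg heη, bernWeight]
  have hmono' := hmono η (insert e η : Finset E) (by simp)
  rw [bernWeight_insert q (Finset.notMem_erase e J)]
  by_cases h2 : (η : Set E) ∈ A
  · have h3 := hmono' h2
    have h3' : insert e (η : Set E) ∈ A := by simpa using h3
    simp [h2, h3', heη]
  · by_cases h3 : insert e (η : Set E) ∈ A
    · simp [h2, h3, heη, hw]
    · simp [h2, h3, heη]

theorem bern_real_eq_bernPoly (q : I) {J : Finset E} {A : Set (Set E)}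
    (hA : DetBy (J : Set E) A) : (bern E q).real A = bernPoly J A q :=
  bern_real_eq_sum q hA

theorem bernPoly_nonneg {q : ℝ} (h0 : 0 ≤ q) (h1 : q ≤ 1) (J : Finset E) (A : Set (Set E)) :
    0 ≤ bernPoly J A q :=
  Finset.sum_nonneg fun η _ => by split_ifs <;> [exact bernWeight_nonneg h0 h1 J η; rfl]

theorem continuous_bernPoly (J : Finset E) {A : Set (Set E)}
    (hmono : ∀ ω ω' : Set E, ω ⊆ ω' → ω ∈ A → ω' ∈ A) : Continuous (bernPoly J A) :=
  continuous_iff_continuousAt.2 fun q =>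
    (hasDerivAt_bernPoly J hmono q).choose_spec.1.continuousAt

/-- The probability of an increasing event is a monotone function of the parameter. -/
theorem bern_real_mono {J : Finset E} {A : Set (Set E)} (hA : DetBy (J : Set E) A)
    (hmono : ∀ ω ω' : Set E, ω ⊆ ω' → ω ∈ A → ω' ∈ A) {p q : I} (hpq : p ≤ q) :
    (bern E p).real A ≤ (bern E q).real A := by
  rw [bern_real_eq_bernPoly p hA, bern_real_eq_bernPoly q hA]
  have : MonotoneOn (bernPoly J A) (Icc 0 1) := by
    refine monotoneOn_of_deriv_nonneg (convex_Icc 0 1) (continuous_bernPoly J hmono).continuousOn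
      (fun x _ => (hasDerivAt_bernPoly J hmono x).choose_spec.1.differentiableAt.differentiableWithinAt)
      fun x hx => ?_
    rw [interior_Icc] at hx
    obtain ⟨f', hf, hf'⟩ := hasDerivAt_bernPoly J hmono x
    rw [hf.deriv]
    have h1 : 0 ≤ (1 - x) * f' := by
      rw [hf']
      exact Finset.sum_nonneg fun e _ => bernPoly_nonneg hx.1.le hx.2.le _ _
    exact nonneg_of_mul_nonneg_right h1 (by linarith [hx.2])
  exact this p.2 q.2 hpq

/-- If the number of closed pivotal indices of `A` has expectation at least `κ P_q(Aᶜ)` for all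
`q` in `(p, p')`, then `P_{p'}(A) ≥ 1 - exp(-κ (p' - p))`. -/
theorem bern_real_ge_of_pivotal {J : Finset E} {A : Set (Set E)} (hA : DetBy (J : Set E) A)
    (hmono : ∀ ω ω' : Set E, ω ⊆ ω' → ω ∈ A → ω' ∈ A) {p p' : I} (hpp : p ≤ p') {κ : ℝ}
    (h : ∀ q : I, p ≤ q → κ * (1 - (bern E q).real A) ≤
      ∑ e ∈ J, (bern E q).real {ω | e ∉ ω ∧ ω ∉ A ∧ insert e ω ∈ A}) :
    1 - Real.exp (-κ * (p' - p)) ≤ (bern E p').real A := by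
  have hpiv : ∀ e ∈ J, DetBy (J : Set E) {ω : Set E | e ∉ ω ∧ ω ∉ A ∧ insert e ω ∈ A} := by
    rintro e he ω ω' hω ⟨h1, h2, h3⟩
    have heJ : e ∈ (J : Set E) := he
    refine ⟨fun h4 => h1 ?_, fun h4 => h2 ((hA.mem_iff hω).2 h4), (hA.mem_iff ?_).1 h3⟩
    · have : e ∈ ω' ∩ J := ⟨h4, heJ⟩
      exact (hω ▸ this).1
    · rw [Set.insert_inter_of_mem heJ, Set.insert_inter_of_mem heJ, hω]
  -- With $f(q)=\mathrm{P}_q(A)$, Russo's formula and the hypothesis give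
  -- $f'\ge(1-q)f'\ge\kappa(1-f)$, so $(1-f)e^{\kappa q}$ does not increase.
  have hanti : AntitoneOn (fun q => (1 - bernPoly J A q) * Real.exp (κ * q)) (Icc (p : ℝ) p') := by
    have hder : ∀ x : ℝ, ∀ f', HasDerivAt (bernPoly J A) f' x →
        HasDerivAt (fun q => (1 - bernPoly J A q) * Real.exp (κ * q))
          (-f' * Real.exp (κ * x) + (1 - bernPoly J A x) * (Real.exp (κ * x) * κ)) x := by
      intro x f' hf
      have h1 : HasDerivAt (fun q : ℝ => Real.exp (κ * q)) (Real.exp (κ * x) * κ) x := by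
        have := ((hasDerivAt_id x).const_mul κ).exp
        simpa using this
      exact (hf.const_sub 1).mul h1
    refine antitoneOn_of_deriv_nonpos (convex_Icc _ _) ?_ ?_ ?_
    · exact ((continuous_const.sub (continuous_bernPoly J hmono)).mul (by fun_prop)).continuousOn
    · intro x _
      obtain ⟨f', hf, -⟩ := hasDerivAt_bernPoly J hmono x
      exact (hder x f' hf).differentiableAt.differentiableWithinAt
    · intro x hx
      rw [interior_Icc] at hx
      obtain ⟨f', hf, hf'⟩ := hasDerivAt_bernPoly J hmono x
      rw [(hder x f' hf).deriv]
      have hx0 : 0 ≤ x := p.2.1.trans hx.1.le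
      have hx1 : x < 1 := hx.2.trans_le p'.2.2
      set q : I := ⟨x, hx0, hx1.le⟩
      have h1 := h q hx.1.le
      rw [bern_real_eq_bernPoly q hA, Finset.sum_congr rfl fun e he =>
        bern_real_eq_bernPoly q (hpiv e he), ← hf'] at h1
      have h2 : 0 ≤ (1 - x) * f' := by
        rw [hf']
        exact Finset.sum_nonneg fun e _ => bernPoly_nonneg hx0 hx1.le _ _
      have h3 : 0 ≤ f' := nonneg_of_mul_nonneg_right h2 (by linarith)
      have h4 : κ * (1 - bernPoly J A x) ≤ f' := h1.trans (by nlinarith)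
      have := Real.exp_pos (κ * x)
      nlinarith
  have h1 := hanti (left_mem_Icc.2 hpp) (right_mem_Icc.2 hpp) hpp
  rw [bern_real_eq_bernPoly p' hA]
  simp only at h1
  have h0 : 0 ≤ bernPoly J A p := bernPoly_nonneg p.2.1 p.2.2 J A
  have h2 : (1 - bernPoly J A p') * Real.exp (κ * p') ≤ Real.exp (κ * p) :=
    h1.trans (by nlinarith [Real.exp_pos (κ * p)])
  have h3 : -κ * (p' - p) = κ * p - κ * p' := by ring
  rw [h3, Real.exp_sub]
  have h4 := (le_div_iff₀ (Real.exp_pos (κ * p'))).2 h2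
  linarith

end Russo

end HypPerc

namespace HypPerc

/-! ### Sharpness inequalities for percolation on finite vertex sets. -/

section FinitePercolation

open scoped Classical

variable {V : Type*} {H : SimpleGraph V}

/-- `a` and `b` are vertices in `S` joined by an open edge. -/
def OpenAdj (ω : Set H.edgeSet) (S : Set V) (a b : V) : Prop :=
  a ∈ S ∧ b ∈ S ∧ ∃ e ∈ ω, (e : Sym2 V) = s(a, b)

/-- `a` is joined to `b` by open edges inside `S`. -/
abbrev Conn (ω : Set H.edgeSet) (S : Set V) : V → V → Prop := Relation.ReflTransGen (OpenAdj ω S)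

/-- `a` is joined to the set `T` by open edges inside `S`. -/
def Joined (ω : Set H.edgeSet) (S T : Set V) (a : V) : Prop := ∃ t ∈ T, Conn ω S a t

/-- The edges with both endpoints in `S`. -/
def innerEdges (H : SimpleGraph V) (S : Set V) : Set H.edgeSet := {e | ∀ v ∈ (e : Sym2 V), v ∈ S}

/-- The event that `x` is joined inside `S` to the endpoint in `S` of the boundary edge `e`. -/
def exitEvent (S : Set V) (x : V) (e : H.edgeSet) : Set (Set H.edgeSet) :=
  {ω | ∃ y z, (e : Sym2 V) = s(y, z) ∧ y ∈ S ∧ z ∉ S ∧ Conn ω S x y}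

theorem OpenAdj.mono {ω ω' : Set H.edgeSet} {S S' : Set V} (hω : ω ⊆ ω') (hS : S ⊆ S') {a b : V}
    (h : OpenAdj ω S a b) : OpenAdj ω' S' a b := by
  obtain ⟨ha, hb, e, he, h⟩ := h
  exact ⟨hS ha, hS hb, e, hω he, h⟩

theorem OpenAdj.congr {ω ω' : Set H.edgeSet} {S : Set V} {K : Set H.edgeSet} (hω : ω ∩ K = ω' ∩ K)
    {a b : V} (h : OpenAdj ω S a b)
    (hK : ∀ e : H.edgeSet, (e : Sym2 V) = s(a, b) → e ∈ K) : OpenAdj ω' S a b := by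
  obtain ⟨ha, hb, e, he, h⟩ := h
  have h1 : e ∈ ω ∩ K := ⟨he, hK e h⟩
  exact ⟨ha, hb, e, (hω ▸ h1).1, h⟩

theorem Conn.mono {ω ω' : Set H.edgeSet} {S S' : Set V} (hω : ω ⊆ ω') (hS : S ⊆ S') {a b : V}
    (h : Conn ω S a b) : Conn ω' S' a b :=
  Relation.ReflTransGen.mono (fun _ _ => OpenAdj.mono hω hS) _ _ h

theorem Conn.mem {ω : Set H.edgeSet} {S : Set V} {a b : V} (ha : a ∈ S) (h : Conn ω S a b) :
    b ∈ S := by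
  induction h with
  | refl => exact ha
  | tail _ h _ => exact h.2.1

theorem mem_innerEdges_of_eq {S : Set V} {a b : V} (ha : a ∈ S) (hb : b ∈ S) {e : H.edgeSet}
    (he : (e : Sym2 V) = s(a, b)) : e ∈ innerEdges H S := by
  intro v hv
  rw [he, Sym2.mem_iff] at hv
  rcases hv with rfl | rfl <;> assumption

theorem innerEdges_mono {S S' : Set V} (h : S ⊆ S') : innerEdges H S ⊆ innerEdges H S' :=
  fun _ he v hv => h (he v hv)

theorem innerEdges_finite (S : Finset V) : (innerEdges H (S : Set V)).Finite := by
  refine Set.Finite.of_finite_image (f := ((↑) : H.edgeSet → Sym2 V)) ?_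
    Subtype.val_injective.injOn
  refine Set.Finite.subset (s := ((S.sym2 : Finset (Sym2 V)) : Set (Sym2 V)))
    (Finset.finite_toSet _) ?_
  rintro _ ⟨e, he, rfl⟩
  rw [Finset.mem_coe, Finset.mem_sym2_iff]
  exact he

/-- The finite set of edges with both endpoints in the finite set `S`. -/
def innerFinset (H : SimpleGraph V) (S : Finset V) : Finset H.edgeSet :=
  (innerEdges_finite (H := H) S).toFinset

theorem coe_innerFinset (S : Finset V) :
    (innerFinset H S : Set H.edgeSet) = innerEdges H (S : Set V) :=
  Set.Finite.coe_toFinset _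

theorem conn_congr {ω ω' : Set H.edgeSet} {S : Set V}
    (hω : ω ∩ innerEdges H S = ω' ∩ innerEdges H S) {a b : V} (h : Conn ω S a b) :
    Conn ω' S a b :=
  Relation.ReflTransGen.mono
    (fun _ _ h => OpenAdj.congr hω h fun _ he => mem_innerEdges_of_eq h.1 h.2.1 he) _ _ h

theorem detBy_conn (S : Set V) (a b : V) : DetBy (innerEdges H S) {ω | Conn ω S a b} :=
  fun _ _ hω h => conn_congr hω h

theorem detBy_joined (S T : Set V) (a : V) : DetBy (innerEdges H S) {ω | Joined ω S T a} :=
  fun _ _ hω ⟨t, ht, h⟩ => ⟨t, ht, conn_congr hω h⟩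

theorem detBy_exitEvent (S : Set V) (x : V) (e : H.edgeSet) :
    DetBy (innerEdges H S) (exitEvent S x e) :=
  fun _ _ hω ⟨y, z, h1, h2, h3, h4⟩ => ⟨y, z, h1, h2, h3, conn_congr hω h4⟩

theorem Joined.mono {ω ω' : Set H.edgeSet} {S S' T : Set V} (hω : ω ⊆ ω') (hS : S ⊆ S') {a : V}
    (h : Joined ω S T a) : Joined ω' S' T a := by
  obtain ⟨t, ht, h⟩ := h
  exact ⟨t, ht, h.mono hω hS⟩

theorem Joined.head {ω : Set H.edgeSet} {S T : Set V} {a b : V} (h : OpenAdj ω S a b)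
    (hb : Joined ω S T b) : Joined ω S T a := by
  obtain ⟨t, ht, hb⟩ := hb
  exact ⟨t, ht, hb.head h⟩

theorem exitEvent_mono {S : Set V} {x : V} {e : H.edgeSet} {ω ω' : Set H.edgeSet} (h : ω ⊆ ω')
    (hω : ω ∈ exitEvent S x e) : ω' ∈ exitEvent S x e := by
  obtain ⟨y, z, h1, h2, h3, h4⟩ := hω
  exact ⟨y, z, h1, h2, h3, h4.mono h subset_rfl⟩

/-- The vertices of `F` not joined to `T` inside `F`. -/
def unjoined (F : Finset V) (T : Set V) (ω : Set H.edgeSet) : Finset V :=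
  F.filter fun v => ¬ Joined ω (F : Set V) T v

/-- Exploring from `T` only inspects edges with an endpoint joined to `T`, so edges inside `S` stay
unrevealed. This makes the value of `unjoined` independent of the exit events of `S`. -/
theorem detBy_unjoined (F : Finset V) (T : Set V) (S : Finset V) :
    DetBy (innerEdges H (F : Set V) \ innerEdges H (S : Set V))
      {ω : Set H.edgeSet | unjoined F T ω = S} := by
  intro ω ω' hω hS
  rw [Set.mem_ofPred_eq] at hS ⊢
  have hmem : ∀ v, v ∈ S ↔ v ∈ F ∧ ¬ Joined ω (F : Set V) T v := by
    intro v
    rw [← hS, unjoined, Finset.mem_filter]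
  have key1 : ∀ v, Joined ω (F : Set V) T v → Joined ω' (F : Set V) T v := by
    rintro v ⟨t, ht, h⟩
    induction h using Relation.ReflTransGen.head_induction_on with
    | refl => exact ⟨t, ht, .refl⟩
    | @head a c hac hc ih =>
      refine ih.head (hac.congr hω fun e he => ⟨mem_innerEdges_of_eq hac.1 hac.2.1 he, ?_⟩)
      intro hin
      have : a ∈ S := hin a (by simp [he])
      exact ((hmem a).1 this).2 ⟨t, ht, hc.head hac⟩
  have key2 : ∀ v, Joined ω' (F : Set V) T v → Joined ω (F : Set V) T v := by
    rintro v ⟨t, ht, h⟩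
    induction h using Relation.ReflTransGen.head_induction_on with
    | refl => exact ⟨t, ht, .refl⟩
    | @head a c hac hc ih =>
      refine ih.head (hac.congr hω.symm fun e he => ⟨mem_innerEdges_of_eq hac.1 hac.2.1 he, ?_⟩)
      intro hin
      have : c ∈ S := hin c (by simp [he])
      exact ((hmem c).1 this).2 ih
  rw [← hS]
  ext v
  simp only [unjoined, Finset.mem_filter]
  exact and_congr_right fun _ => not_congr ⟨key2 v, key1 v⟩

theorem sum_real_fiber_le {Ω ι : Type*} [MeasurableSpace Ω] (μ : Measure Ω)
    [IsProbabilityMeasure μ] (c : Ω → ι) (s : Finset ι) (Q : Set Ω)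
    (hm : ∀ i ∈ s, MeasurableSet ({ω | c ω = i} ∩ Q)) :
    ∑ i ∈ s, μ.real ({ω | c ω = i} ∩ Q) ≤ μ.real Q := by
  rw [← measureReal_biUnion_finset]
  · exact measureReal_mono (Set.iUnion₂_subset fun i _ => Set.inter_subset_right)
  · intro i _ j _ hij
    rw [Function.onFun, Set.disjoint_left]
    rintro ω ⟨h, -⟩ ⟨h', -⟩
    exact hij (h.symm.trans h')
  · exact hm

/-- With `sum_real_fiber_le`, this replaces conditioning on a random finite set by a sum over its
values. -/
theorem real_le_sum_fiber {Ω ι : Type*} [MeasurableSpace Ω] (μ : Measure Ω)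
    [IsProbabilityMeasure μ] (c : Ω → ι) (s : Finset ι) (Q : Set Ω)
    (hs : ∀ ω ∈ Q, c ω ∈ s) :
    μ.real Q ≤ ∑ i ∈ s, μ.real ({ω | c ω = i} ∩ Q) := by
  refine (measureReal_mono (s₂ := ⋃ i ∈ s, ({ω | c ω = i} ∩ Q)) ?_ (measure_ne_top _ _)).trans
    (measureReal_biUnion_finset_le s _)
  intro ω hω
  simp only [Set.mem_iUnion]
  exact ⟨c ω, hs ω hω, rfl, hω⟩

theorem detBy_disjoint_mul (q : I) {F : Finset V} {K L : Set H.edgeSet}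
    (hK : K ⊆ innerEdges H (F : Set V)) (hL : L ⊆ innerEdges H (F : Set V)) (hKL : Disjoint K L)
    {A B : Set (Set H.edgeSet)} (hA : DetBy K A) (hB : DetBy L B) :
    (bern H.edgeSet q).real (A ∩ B) = (bern H.edgeSet q).real A * (bern H.edgeSet q).real B := by
  have hKf := (innerEdges_finite (H := H) F).subset hK
  have hLf := (innerEdges_finite (H := H) F).subset hL
  rw [measureReal_def, bern_inter_eq_mul q (J := hKf.toFinset) (K := hLf.toFinset),
    ENNReal.toReal_mul]
  · rfl
  · rwa [Set.Finite.disjoint_toFinset]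
  · simpa using hA
  · simpa using hB

theorem DetBy.measurableSet_inner {F : Finset V} {A : Set (Set H.edgeSet)}
    (h : DetBy (innerEdges H (F : Set V)) A) : MeasurableSet A := by
  rw [← coe_innerFinset] at h
  exact h.measurableSet

/-- If in every set `S ∋ x` avoiding the target the expected number of boundary edges of `S` that
are reached from `x` is at least `κ` for the parameter `p`, then `x` is joined to the target with
probability at least `1 - exp(-κ (p' - p))` for the parameter `p'`. -/
theorem joined_real_ge (F : Finset V) (T : Set V) {x : V} (hx : x ∈ F) {p p' : I} (hpp : p ≤ p')
    {κ : ℝ}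
    (h : ∀ S ⊆ F, x ∈ S → Disjoint (S : Set V) T →
      κ ≤ ∑ e ∈ innerFinset H F, (bern H.edgeSet p).real (exitEvent (S : Set V) x e)) :
    1 - Real.exp (-κ * (p' - p)) ≤ (bern H.edgeSet p').real {ω | Joined ω (F : Set V) T x} := by
  have hdet := detBy_joined (H := H) (F : Set V) T x
  rw [← coe_innerFinset] at hdet
  refine bern_real_ge_of_pivotal hdet (fun ω ω' hω h => h.mono hω subset_rfl) hpp fun q hq => ?_
  set P := (bern H.edgeSet q).real
  have hD : ∀ S ⊆ F, DetBy (innerEdges H (F : Set V)) {ω : Set H.edgeSet | unjoined F T ω = S} :=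
    fun S _ => (detBy_unjoined F T S).mono Set.sdiff_subset
  have hprod : ∀ S ⊆ F, ∀ e, P ({ω | unjoined F T ω = S} ∩ exitEvent (S : Set V) x e) =
      P {ω | unjoined F T ω = S} * P (exitEvent (S : Set V) x e) := by
    intro S hS e
    exact detBy_disjoint_mul q Set.sdiff_subset (innerEdges_mono (by exact_mod_cast hS))
      Set.disjoint_sdiff_left (detBy_unjoined F T S) (detBy_exitEvent _ x e)
  have h1 : 1 - P {ω | Joined ω (F : Set V) T x} =
      P {ω : Set H.edgeSet | x ∈ unjoined F T ω} := by
    rw [← probReal_compl_eq_one_sub hdet.measurableSet]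
    congr 1
    ext ω
    simp [unjoined, hx]
  have h2 : P {ω : Set H.edgeSet | x ∈ unjoined F T ω} ≤
      ∑ S ∈ F.powerset, P ({ω | unjoined F T ω = S} ∩ {ω | x ∈ unjoined F T ω}) :=
    real_le_sum_fiber _ _ _ _ fun ω _ => Finset.mem_powerset.2 (Finset.filter_subset _ _)
  have hP0 : ∀ A, 0 ≤ P A := fun A => measureReal_nonneg
  have h3 : ∀ S ∈ F.powerset,
      κ * P ({ω | unjoined F T ω = S} ∩ {ω | x ∈ unjoined F T ω}) ≤
      ∑ e ∈ innerFinset H F, P ({ω | unjoined F T ω = S} ∩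
        {ω | e ∉ ω ∧ ω ∉ {ω | Joined ω (F : Set V) T x} ∧
          insert e ω ∈ {ω | Joined ω (F : Set V) T x}}) := by
    intro S hS
    rw [Finset.mem_powerset] at hS
    by_cases hne : ({ω : Set H.edgeSet | unjoined F T ω = S} ∩ {ω | x ∈ unjoined F T ω}).Nonempty
    · obtain ⟨ω₀, rfl : unjoined F T ω₀ = S, hxS : x ∈ unjoined F T ω₀⟩ := hne
      set S := unjoined F T ω₀ with hSdef
      have hST : Disjoint (S : Set V) T := by
        rw [Set.disjoint_left]
        intro v hv hvT
        rw [Finset.mem_coe, hSdef, unjoined, Finset.mem_filter] at hv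
        exact hv.2 ⟨v, hvT, .refl⟩
      have h4 := h S hS hxS hST
      -- The hypothesis concerns `p`; exit events are increasing, so it persists at `q`.
      have h5 : κ ≤ ∑ e ∈ innerFinset H F, P (exitEvent (S : Set V) x e) := by
        refine h4.trans (Finset.sum_le_sum fun e _ => ?_)
        have hd := (detBy_exitEvent (H := H) (S : Set V) x e)
        rw [← coe_innerFinset] at hd
        exact bern_real_mono hd (fun _ _ h => exitEvent_mono h) hq
      calc κ * P ({ω | unjoined F T ω = S} ∩ {ω | x ∈ unjoined F T ω})
          ≤ κ * P {ω | unjoined F T ω = S} := by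
            refine le_of_eq ?_
            congr 2
            rw [Set.inter_eq_left]
            rintro ω (hω : unjoined F T ω = S)
            show x ∈ unjoined F T ω
            rwa [hω]
        _ ≤ (∑ e ∈ innerFinset H F, P (exitEvent (S : Set V) x e)) *
            P {ω | unjoined F T ω = S} := by gcongr
        _ = ∑ e ∈ innerFinset H F,
            P ({ω | unjoined F T ω = S} ∩ exitEvent (S : Set V) x e) := by
            rw [Finset.sum_mul]
            exact Finset.sum_congr rfl fun e _ => by rw [hprod S hS e, mul_comm]
        _ ≤ _ := by
            -- Here `e` is closed and pivotal: `z ∉ S` means that `z` is joined to `T`, so an open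
            -- `e` would also join `y ∈ S`, while opening it joins `x` through `y`.
            refine Finset.sum_le_sum fun e he => measureReal_mono ?_
            rintro ω ⟨hω : unjoined F T ω = S, y, z, hyz, hy, hz, hxy⟩
            have heF : e ∈ innerEdges H (F : Set V) := by rwa [← coe_innerFinset]
            have hyF : y ∈ (F : Set V) := heF y (by simp [hyz])
            have hzF : z ∈ (F : Set V) := heF z (by simp [hyz])
            have hmem : ∀ v, v ∈ S ↔ v ∈ F ∧ ¬ Joined ω (F : Set V) T v := by
              intro v
              rw [← hω, unjoined, Finset.mem_filter]
            have hzJ : Joined ω (F : Set V) T z := by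
              by_contra hcon
              exact hz ((hmem z).2 ⟨hzF, hcon⟩)
            refine ⟨hω, fun heω => ?_, ((hmem x).1 hxS).2, ?_⟩
            · exact ((hmem y).1 hy).2 (hzJ.head ⟨hyF, hzF, e, heω, hyz⟩)
            · have hsub : ω ⊆ insert e ω := Set.subset_insert _ _
              obtain ⟨t, ht, hzt⟩ := hzJ.mono hsub subset_rfl
              refine ⟨t, ht, (hxy.mono hsub (by exact_mod_cast hS)).trans (hzt.head ?_)⟩
              exact ⟨hyF, hzF, e, Set.mem_insert _ _, hyz⟩
    · rw [Set.not_nonempty_iff_eq_empty] at hne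
      rw [hne]
      simp only [P, measureReal_empty, mul_zero]
      exact Finset.sum_nonneg fun e _ => hP0 _
  have hκ0 : 0 ≤ κ ∨ κ < 0 := le_or_gt 0 κ
  rcases hκ0 with hκ0 | hκ0
  · rw [h1]
    calc _ ≤ κ * ∑ S ∈ F.powerset, P ({ω | unjoined F T ω = S} ∩ {ω | x ∈ unjoined F T ω}) := by
          gcongr
      _ ≤ ∑ S ∈ F.powerset, ∑ e ∈ innerFinset H F, P ({ω | unjoined F T ω = S} ∩
            {ω | e ∉ ω ∧ ω ∉ {ω | Joined ω (F : Set V) T x} ∧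
              insert e ω ∈ {ω | Joined ω (F : Set V) T x}}) := by
          rw [Finset.mul_sum]
          exact Finset.sum_le_sum h3
      _ ≤ _ := by
          rw [Finset.sum_comm]
          refine Finset.sum_le_sum fun e he => ?_
          refine sum_real_fiber_le _ _ _ _ fun S hS => ?_
          refine DetBy.measurableSet_inner (F := F) ((hD S (Finset.mem_powerset.1 hS)).inter ?_)
          rw [← coe_innerFinset]
          rintro ω ω' hω ⟨h1, h2, h3⟩
          have heJ : e ∈ (innerFinset H F : Set H.edgeSet) := he
          refine ⟨fun h4 => h1 ?_, fun h4 => h2 ((hdet.mem_iff hω).2 h4), (hdet.mem_iff ?_).1 h3⟩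
          · have : e ∈ ω' ∩ innerFinset H F := ⟨h4, heJ⟩
            exact (hω ▸ this).1
          · rw [Set.insert_inter_of_mem heJ, Set.insert_inter_of_mem heJ, hω]
  · refine le_trans (mul_nonpos_of_nonpos_of_nonneg hκ0.le ?_)
      (Finset.sum_nonneg fun e _ => hP0 _)
    rw [h1]
    exact hP0 _

/-- The open cluster of `x` inside the finite set `S`. -/
def innerCluster (S : Finset V) (x : V) (ω : Set H.edgeSet) : Finset V :=
  S.filter fun v => Conn ω (S : Set V) x v

/-- Exploring the cluster of `x` only inspects edges touching it. Given its value `C`, the edges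
avoiding `C` are independent of the exploration. -/
theorem detBy_innerCluster {S : Finset V} {x : V} (C : Finset V) :
    DetBy (innerEdges H (S : Set V) ∩ {e | ∃ v ∈ (e : Sym2 V), v ∈ C})
      {ω : Set H.edgeSet | innerCluster S x ω = C} := by
  intro ω ω' hω hC
  rw [Set.mem_ofPred_eq] at hC ⊢
  have hmem : ∀ v, v ∈ C ↔ v ∈ S ∧ Conn ω (S : Set V) x v := by
    intro v
    rw [← hC, innerCluster, Finset.mem_filter]
  have key1 : ∀ v, Conn ω (S : Set V) x v → Conn ω' (S : Set V) x v := by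
    intro v h
    induction h with
    | refl => exact .refl
    | @tail a c ha hac ih =>
      refine ih.tail (hac.congr hω fun e he => ⟨mem_innerEdges_of_eq hac.1 hac.2.1 he, a, ?_, ?_⟩)
      · simp [he]
      · exact (hmem a).2 ⟨hac.1, ha⟩
  have key2 : ∀ v, Conn ω' (S : Set V) x v → Conn ω (S : Set V) x v := by
    intro v h
    induction h with
    | refl => exact .refl
    | @tail a c ha hac ih =>
      refine ih.tail
        (hac.congr hω.symm fun e he => ⟨mem_innerEdges_of_eq hac.1 hac.2.1 he, a, ?_, ?_⟩)
      · simp [he]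
      · exact (hmem a).2 ⟨hac.1, ih⟩
  rw [← hC]
  ext v
  simp only [innerCluster, Finset.mem_filter]
  exact and_congr_right fun _ => ⟨key2 v, key1 v⟩

/-- If the endpoints outside `S` of the boundary edges of `S` are joined to `T` with probability at
most `M`, then `x` is joined to `T` with probability at most `M` times the expected number of
boundary edges of `S` that are reached from `x` inside `S`. -/
theorem joined_real_le (F : Finset V) (T : Set V) {S : Finset V} (hS : S ⊆ F) {x : V} (hx : x ∈ S)
    (hST : Disjoint (S : Set V) T) (q : I) {M : ℝ}
    (hM : ∀ y ∈ S, ∀ z ∈ F, H.Adj y z →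
      (bern H.edgeSet q).real {ω | Joined ω (F : Set V) T z} ≤ M) :
    (bern H.edgeSet q).real {ω | Joined ω (F : Set V) T x} ≤
      (∑ e ∈ innerFinset H F, (bern H.edgeSet q).real (exitEvent (S : Set V) x e)) * M := by
  set P := (bern H.edgeSet q).real
  have hP0 : ∀ A, 0 ≤ P A := fun A => measureReal_nonneg
  have hSF : (S : Set V) ⊆ F := by exact_mod_cast hS
  -- Cut the path from `x` to `T` at its last visit to the cluster of `x` in `S`. The next vertex
  -- `z` lies outside `S`, as otherwise it would belong to that cluster, and the rest of the path
  -- avoids the cluster.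
  let R : H.edgeSet → Set (Set H.edgeSet) := fun e =>
    {ω | ∃ y z, (e : Sym2 V) = s(y, z) ∧ y ∈ innerCluster S x ω ∧ z ∈ F ∧ z ∉ S ∧
      Joined ω ((F : Set V) \ innerCluster S x ω) T z}
  have h1 : {ω | Joined ω (F : Set V) T x} ⊆ ⋃ e ∈ innerFinset H F, R e := by
    rintro ω ⟨t, ht, h⟩
    have hmem : ∀ v, v ∈ innerCluster S x ω ↔ v ∈ S ∧ Conn ω (S : Set V) x v := by
      intro v
      rw [innerCluster, Finset.mem_filter]
    have key : ∀ v, Conn ω (F : Set V) v t →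
        (v ∉ innerCluster S x ω ∧ Joined ω ((F : Set V) \ innerCluster S x ω) T v) ∨
        ω ∈ ⋃ e ∈ innerFinset H F, R e := by
      intro v hv
      induction hv using Relation.ReflTransGen.head_induction_on with
      | refl =>
        refine Or.inl ⟨fun h => ?_, t, ht, .refl⟩
        exact Set.disjoint_left.1 hST (Finset.mem_coe.2 ((hmem t).1 h).1) ht
      | @head a c hac hc ih =>
        rcases ih with ⟨hcC, hcJ⟩ | h
        · by_cases ha : a ∈ innerCluster S x ω
          · right
            obtain ⟨haF, hcF, e, he, hea⟩ := hac
            simp only [Set.mem_iUnion]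
            refine ⟨e, ?_, a, c, hea, ha, hcF, fun hcS => hcC ?_, hcJ⟩
            · rw [← Finset.mem_coe, coe_innerFinset]
              exact mem_innerEdges_of_eq haF hcF hea
            · refine (hmem c).2 ⟨hcS, ((hmem a).1 ha).2.tail ⟨((hmem a).1 ha).1, hcS, e, he, hea⟩⟩
          · left
            refine ⟨ha, hcJ.head ?_⟩
            obtain ⟨haF, hcF, e, he, hea⟩ := hac
            exact ⟨⟨haF, by simpa using ha⟩, ⟨hcF, by simpa using hcC⟩, e, he, hea⟩
        · exact Or.inr h
    rcases key x h with ⟨h1, -⟩ | h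
    · exact absurd ((hmem x).2 ⟨hx, .refl⟩) h1
    · exact h
  have h2 : ∀ e ∈ innerFinset H F, P (R e) ≤ P (exitEvent (S : Set V) x e) * M := by
    intro e he
    have heF : e ∈ innerEdges H (F : Set V) := by rwa [← coe_innerFinset]
    by_cases hM0 : ∃ y z, (e : Sym2 V) = s(y, z) ∧ y ∈ S ∧ z ∉ S
    swap
    · have : R e = ∅ := by
        rw [Set.eq_empty_iff_forall_notMem]
        rintro ω ⟨y, z, h, hy, -, hz, -⟩
        exact hM0 ⟨y, z, h, (Finset.mem_filter.1 hy).1, hz⟩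
      have h' : exitEvent (S : Set V) x e = ∅ := by
        rw [Set.eq_empty_iff_forall_notMem]
        rintro ω ⟨y, z, h, hy, hz, -⟩
        exact hM0 ⟨y, z, h, hy, hz⟩
      rw [this, h']
      simp [P]
    obtain ⟨y, z, hyz, hy, hz⟩ := hM0
    have hzF : z ∈ F := heF z (by simp [hyz])
    have hadj : H.Adj y z := by
      have := e.2
      rwa [hyz] at this
    have hMz := hM y hy z hzF hadj
    have huniq : ∀ y' z', (e : Sym2 V) = s(y', z') → y' ∈ S → y' = y ∧ z' = z := by
      intro y' z' h hy'
      rw [hyz, Sym2.eq_iff] at h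
      rcases h with ⟨rfl, rfl⟩ | ⟨rfl, rfl⟩
      · exact ⟨rfl, rfl⟩
      · exact absurd hy' hz
    calc P (R e) ≤ ∑ C ∈ S.powerset, P ({ω | innerCluster S x ω = C} ∩ R e) :=
          real_le_sum_fiber _ _ _ _ fun ω _ => Finset.mem_powerset.2 (Finset.filter_subset _ _)
      _ ≤ ∑ C ∈ S.powerset, P ({ω | innerCluster S x ω = C} ∩ exitEvent (S : Set V) x e) * M := by
          refine Finset.sum_le_sum fun C hC => ?_
          rw [Finset.mem_powerset] at hC
          by_cases hyC : y ∈ C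
          · have e1 : {ω | innerCluster S x ω = C} ∩ R e ⊆
                {ω | innerCluster S x ω = C} ∩ {ω | Joined ω ((F : Set V) \ C) T z} := by
              rintro ω ⟨hω : innerCluster S x ω = C, y', z', h, hy', hz', hz'S, hJ⟩
              obtain ⟨rfl, rfl⟩ := huniq y' z' h (Finset.mem_filter.1 hy').1
              refine ⟨hω, ?_⟩
              rw [hω] at hJ
              exact hJ
            have e2 : {ω | innerCluster S x ω = C} ∩ exitEvent (S : Set V) x e =
                {ω | innerCluster S x ω = C} := by
              rw [Set.inter_eq_left]
              rintro ω (hω : innerCluster S x ω = C)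
              rw [← hω] at hyC
              exact ⟨y, z, hyz, hy, hz, (Finset.mem_filter.1 hyC).2⟩
            rw [e2]
            refine (measureReal_mono e1).trans ?_
            -- Edges touching `C` and edges inside `F \ C` are disjoint families, so the two events
            -- are independent.
            have := detBy_disjoint_mul (H := H) q (F := F)
              (K := innerEdges H (S : Set V) ∩ {e | ∃ v ∈ (e : Sym2 V), v ∈ C})
              (L := innerEdges H ((F : Set V) \ C))
              (Set.inter_subset_left.trans (innerEdges_mono hSF)) (innerEdges_mono Set.sdiff_subset)
              (by
                rw [Set.disjoint_left]
                rintro e ⟨-, v, hv, hvC⟩ h'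
                exact (h' v hv).2 hvC)
              (detBy_innerCluster (x := x) C) (detBy_joined ((F : Set V) \ C) T z)
            rw [this]
            refine mul_le_mul_of_nonneg_left (le_trans (measureReal_mono ?_) hMz) (hP0 _)
            intro ω hω
            exact Joined.mono subset_rfl Set.sdiff_subset hω
          · have : {ω | innerCluster S x ω = C} ∩ R e = ∅ := by
              rw [Set.eq_empty_iff_forall_notMem]
              rintro ω ⟨hω : innerCluster S x ω = C, y', z', h, hy', -⟩
              obtain ⟨rfl, rfl⟩ := huniq y' z' h (Finset.mem_filter.1 hy').1
              exact hyC (hω ▸ hy')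
            rw [this]
            have : 0 ≤ M := (hP0 _).trans hMz
            simp only [P, measureReal_empty]
            exact mul_nonneg (hP0 _) this
      _ = (∑ C ∈ S.powerset, P ({ω | innerCluster S x ω = C} ∩ exitEvent (S : Set V) x e)) * M :=
          (Finset.sum_mul _ _ _).symm
      _ ≤ _ := by
          refine mul_le_mul_of_nonneg_right ?_ ((hP0 _).trans hMz)
          refine sum_real_fiber_le _ _ _ _ fun C _ => DetBy.measurableSet_inner (F := S) ?_
          exact ((detBy_innerCluster C).mono Set.inter_subset_left).inter (detBy_exitEvent _ x e)
  calc P {ω | Joined ω (F : Set V) T x} ≤ P (⋃ e ∈ innerFinset H F, R e) :=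
      measureReal_mono h1 (measure_ne_top _ _)
    _ ≤ ∑ e ∈ innerFinset H F, P (R e) := measureReal_biUnion_finset_le _ _
    _ ≤ _ := by
      rw [Finset.sum_mul]
      exact Finset.sum_le_sum h2

end FinitePercolation

end HypPerc

namespace HypPerc

/-! ### Geodesic segments through the hyperboloid model. -/

section Geometry

variable {n : ℕ}

/-- The coordinates parallel to the boundary. -/
def lat (x : HSpace n) (i : Fin n) : ℝ := x.1 i.castSucc

/-- The square of the Euclidean norm. -/
def nsq (x : HSpace n) : ℝ := ∑ i, lat x i ^ 2 + height x ^ 2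

theorem height_pos (x : HSpace n) : 0 < height x := x.2

theorem HSpace.ext' {x y : HSpace n} (h : ∀ i, lat x i = lat y i) (h' : height x = height y) :
    x = y := by
  apply Subtype.ext
  ext i
  induction i using Fin.lastCases with
  | last => exact h'
  | cast i => exact h i

/-- The point with given coordinates. -/
def mkPoint (u : Fin n → ℝ) (h : ℝ) (hh : 0 < h) : HSpace n :=
  ⟨WithLp.toLp 2 (Fin.snoc u h : Fin (n + 1) → ℝ), by simpa using hh⟩

@[simp] theorem lat_mkPoint (u : Fin n → ℝ) (h : ℝ) (hh : 0 < h) (i : Fin n) :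
    lat (mkPoint u h hh) i = u i := by
  simp [lat, mkPoint]

@[simp] theorem height_mkPoint (u : Fin n → ℝ) (h : ℝ) (hh : 0 < h) :
    height (mkPoint u h hh) = h := by
  simp [height, mkPoint]

@[simp] theorem lat_axisPoint (h : ℝ) (hh : 0 < h) (i : Fin n) : lat (axisPoint n h hh) i = 0 := by
  simp [lat, axisPoint]

@[simp] theorem height_axisPoint (h : ℝ) (hh : 0 < h) : height (axisPoint n h hh) = h := by
  simp [height, axisPoint]

@[simp] theorem lat_origin (i : Fin n) : lat (origin n) i = 0 := lat_axisPoint _ _ _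

@[simp] theorem height_origin : height (origin n) = 1 := height_axisPoint _ _

theorem dist_sq (x y : HSpace n) :
    dist x.1 y.1 ^ 2 = ∑ i, (lat x i - lat y i) ^ 2 + (height x - height y) ^ 2 := by
  rw [EuclideanSpace.dist_sq_eq, Fin.sum_univ_castSucc]
  simp [Real.dist_eq, sq_abs, lat, height]

theorem hdist_nonneg (x y : HSpace n) : 0 ≤ hdist x y := by
  unfold hdist
  have : 0 ≤ dist x.1 y.1 / (2 * √(height x * height y)) := by positivity
  have := Real.arsinh_nonneg_iff.2 this
  linarith

theorem hdist_comm (x y : HSpace n) : hdist x y = hdist y x := by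
  unfold hdist
  rw [dist_comm, mul_comm (height x)]

theorem cosh_hdist (x y : HSpace n) :
    Real.cosh (hdist x y) = 1 + dist x.1 y.1 ^ 2 / (2 * height x * height y) := by
  have h := mul_pos (height_pos x) (height_pos y)
  rw [hdist, Real.cosh_two_mul, Real.cosh_sq, Real.sinh_arsinh, div_pow, mul_pow,
    Real.sq_sqrt h.le]
  field_simp
  ring

/-- The bilinear form of the hyperboloid model in light-cone coordinates. -/
def lform (U W : ℝ × (Fin n → ℝ) × ℝ) : ℝ :=
  (U.1 * W.2.2 + U.2.2 * W.1) / 2 - ∑ i, U.2.1 i * W.2.1 i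

/-- The hyperboloid model in light-cone coordinates. -/
def hyp (x : HSpace n) : ℝ × (Fin n → ℝ) × ℝ :=
  (nsq x / height x, fun i => lat x i / height x, 1 / height x)

theorem lform_comm (U W : ℝ × (Fin n → ℝ) × ℝ) : lform U W = lform W U := by
  unfold lform
  congr 1
  · ring
  · exact Finset.sum_congr rfl fun i _ => mul_comm _ _

theorem lform_comb (a b : ℝ) (U V W : ℝ × (Fin n → ℝ) × ℝ) :
    lform (a • U + b • V) W = a * lform U W + b * lform V W := by
  simp only [lform, Prod.fst_add, Prod.smul_fst, Prod.snd_add, Prod.smul_snd, smul_eq_mul,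
    Pi.add_apply, Pi.smul_apply, mul_sub, Finset.mul_sum]
  rw [← add_sub_add_comm, ← Finset.sum_add_distrib]
  congr 1
  · ring
  · exact Finset.sum_congr rfl fun i _ => by ring

/-- Distances become values of a bilinear form, so statements about geodesics reduce to linear
algebra. -/
theorem lform_hyp (x y : HSpace n) : lform (hyp x) (hyp y) = Real.cosh (hdist x y) := by
  have hx := height_pos x
  have hy := height_pos y
  rw [cosh_hdist, dist_sq]
  have h1 : ∑ i, (lat x i - lat y i) ^ 2 =
      ∑ i, lat x i ^ 2 + ∑ i, lat y i ^ 2 - 2 * ∑ i, lat x i * lat y i := by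
    rw [Finset.mul_sum, ← Finset.sum_add_distrib, ← Finset.sum_sub_distrib]
    exact Finset.sum_congr rfl fun i _ => by ring
  have h2 : ∑ i, lat x i / height x * (lat y i / height y) =
      (∑ i, lat x i * lat y i) / (height x * height y) := by
    rw [Finset.sum_div]
    exact Finset.sum_congr rfl fun i _ => by field_simp
  simp only [lform, hyp, nsq, h1, h2]
  field_simp
  ring

theorem hdist_self (x : HSpace n) : hdist x x = 0 := by simp [hdist]

theorem lform_hyp_self (x : HSpace n) : lform (hyp x) (hyp x) = 1 := by
  rw [lform_hyp, hdist_self, Real.cosh_zero]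

theorem hyp_injective : Function.Injective (hyp (n := n)) := by
  intro x y h
  simp only [hyp, Prod.mk.injEq] at h
  obtain ⟨-, h1, h2⟩ := h
  have h3 : height x = height y := by simpa using h2
  refine HSpace.ext' (fun i => ?_) h3
  have := congrFun h1 i
  rw [h3] at this
  have hy := (height_pos y).ne'
  field_simp at this
  exact this

/-- The form is Lorentzian and `hyp x` is timelike, so the form is definite on the orthogonal
complement of `hyp x`. The sum of squares in `h5` exhibits this. -/
theorem eq_zero_of_lform_eq_zero {U : ℝ × (Fin n → ℝ) × ℝ} (x : HSpace n)
    (h1 : lform U U = 0) (h2 : lform U (hyp x) = 0) : U = 0 := by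
  obtain ⟨u0, u, u1⟩ := U
  have hx := height_pos x
  simp only [lform, hyp, nsq] at h1 h2
  have h3 : ∑ i, u i * (lat x i / height x) = (∑ i, u i * lat x i) / height x := by
    rw [Finset.sum_div]
    exact Finset.sum_congr rfl fun i _ => by field_simp
  rw [h3] at h2
  field_simp at h2
  have h4 : ∑ i, (u i - u1 * lat x i) ^ 2 =
      ∑ i, u i * u i - 2 * u1 * ∑ i, u i * lat x i + u1 ^ 2 * ∑ i, lat x i ^ 2 := by
    rw [Finset.mul_sum, Finset.mul_sum, ← Finset.sum_sub_distrib, ← Finset.sum_add_distrib]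
    exact Finset.sum_congr rfl fun i _ => by ring
  have h5 : ∑ i, (u i - u1 * lat x i) ^ 2 + u1 ^ 2 * height x ^ 2 = 0 := by
    rw [h4]; linear_combination (-1) * h1 + u1 * h2
  have h6 : 0 ≤ ∑ i, (u i - u1 * lat x i) ^ 2 := Finset.sum_nonneg fun i _ => sq_nonneg _
  have h7 : 0 ≤ u1 ^ 2 * height x ^ 2 := by positivity
  have h8 : u1 ^ 2 * height x ^ 2 = 0 := by linarith
  have h9 : u1 = 0 := by simpa [hx.ne'] using h8
  subst h9
  have h10 : ∀ i, u i = 0 := by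
    have : ∑ i, (u i - 0 * lat x i) ^ 2 = 0 := by linarith
    rw [Finset.sum_eq_zero_iff_of_nonneg fun i _ => sq_nonneg _] at this
    intro i
    simpa using this i (Finset.mem_univ i)
  have h11 : u0 = 0 := by
    simp only [h10] at h2
    simpa using h2
  ext <;> simp [h11, h10]

theorem sinh_hdist_sq (x y : HSpace n) :
    Real.sinh (hdist x y) ^ 2 = lform (hyp x) (hyp y) ^ 2 - 1 := by
  rw [lform_hyp, Real.sinh_sq]

theorem eq_of_cosh_eq {a b : ℝ} (ha : 0 ≤ a) (hb : 0 ≤ b) (h : Real.cosh a = Real.cosh b) :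
    a = b := by
  have := Real.cosh_le_cosh.1 h.le
  have := Real.cosh_le_cosh.1 h.ge
  rw [abs_of_nonneg ha, abs_of_nonneg hb] at *
  linarith

theorem eq_of_hdist_eq_zero {x y : HSpace n} (h : hdist x y = 0) : x = y := by
  have h1 := cosh_hdist x y
  have hx := height_pos x
  have hy := height_pos y
  rw [h, Real.cosh_zero] at h1
  have h2 : dist x.1 y.1 ^ 2 / (2 * height x * height y) = 0 := by linarith
  have h3 : dist x.1 y.1 = 0 := by
    rw [div_eq_zero_iff] at h2
    rcases h2 with h2 | h2
    · simpa using h2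
    · exact absurd h2 (by positivity)
  exact Subtype.ext (dist_eq_zero.1 h3)

/-- Geodesic segments in the hyperboloid model. -/
theorem mem_geodSeg_iff {x y z : HSpace n} :
    z ∈ geodSeg x y ↔ ∃ a b : ℝ, 0 ≤ a ∧ 0 ≤ b ∧ hyp z = a • hyp x + b • hyp y := by
  constructor
  · intro h
    change hdist x z + hdist z y = hdist x y at h
    have ha := hdist_nonneg x z
    have hb := hdist_nonneg z y
    set a := hdist x z
    set b := hdist z y
    rcases (hdist_nonneg x y).eq_or_lt with h0 | h0
    · have : a = 0 := by linarith
      refine ⟨1, 0, zero_le_one, le_rfl, ?_⟩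
      rw [eq_of_hdist_eq_zero this]
      simp
    · rw [← h] at h0
      have hs := Real.sinh_pos_iff.2 h0
      set s := Real.sinh (a + b)
      have hxz : lform (hyp x) (hyp z) = Real.cosh a := lform_hyp x z
      have hzy : lform (hyp z) (hyp y) = Real.cosh b := lform_hyp z y
      have hxy : lform (hyp x) (hyp y) = Real.cosh (a + b) := by rw [h]; exact lform_hyp x y
      -- The expected relation is $\sinh(a+b)\,z=\sinh b\,x+\sinh a\,y$. The defect `U` is
      -- orthogonal to all three points, hence null and orthogonal to `hyp z`, hence zero.
      set U := (1 : ℝ) • (s • hyp z + (-Real.sinh b) • hyp x) + (-Real.sinh a) • hyp y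
      have hU : ∀ W, lform U W = s * lform (hyp z) W - Real.sinh b * lform (hyp x) W -
          Real.sinh a * lform (hyp y) W := by
        intro W
        rw [lform_comb, lform_comb]
        ring
      have e1 : lform U (hyp z) = 0 := by
        rw [hU, lform_hyp_self, hxz, lform_comm (hyp y), hzy]
        simp only [s, Real.sinh_add]
        ring
      have e2 : lform U (hyp x) = 0 := by
        rw [hU, lform_hyp_self, lform_comm (hyp z), hxz, lform_comm (hyp y), hxy]
        simp only [s, Real.sinh_add, Real.cosh_add]
        linear_combination Real.sinh b * Real.cosh_sq a
      have e3 : lform U (hyp y) = 0 := by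
        rw [hU, lform_hyp_self, hzy, hxy]
        simp only [s, Real.sinh_add, Real.cosh_add]
        linear_combination Real.sinh a * Real.cosh_sq b
      have e4 : lform U U = 0 := by
        rw [hU, lform_comm _ U, lform_comm _ U, lform_comm _ U, e1, e2, e3]
        ring
      have e5 := eq_zero_of_lform_eq_zero z e4 e1
      refine ⟨Real.sinh b / s, Real.sinh a / s, div_nonneg (Real.sinh_nonneg_iff.2 hb) hs.le,
        div_nonneg (Real.sinh_nonneg_iff.2 ha) hs.le, ?_⟩
      have e6 : s • hyp z = Real.sinh b • hyp x + Real.sinh a • hyp y := by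
        have : U = s • hyp z - (Real.sinh b • hyp x + Real.sinh a • hyp y) := by
          simp only [U]
          module
        rw [this, sub_eq_zero] at e5
        exact e5
      rw [div_eq_inv_mul, div_eq_inv_mul, mul_smul, mul_smul, ← smul_add, ← e6,
        inv_smul_smul₀ hs.ne']
  · rintro ⟨a, b, ha, hb, h⟩
    set c := lform (hyp x) (hyp y) with hc
    -- Normalisation of `hyp z`. It makes the hyperbolic sines of the two partial distances equal to
    -- $b$ and $a$ times that of the whole, and the addition formula for $\cosh$ concludes.
    have hq : a ^ 2 + b ^ 2 + 2 * a * b * c = 1 := by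
      have h1 := lform_hyp_self z
      rw [h, lform_comb, lform_comm _ (_ + _), lform_comm _ (_ + _), lform_comb, lform_comb,
        lform_hyp_self, lform_hyp_self, lform_comm (hyp y)] at h1
      linear_combination h1
    have hxz : Real.cosh (hdist x z) = a + b * c := by
      rw [← lform_hyp, h, lform_comm, lform_comb, lform_hyp_self, lform_comm (hyp y)]
      ring
    have hzy : Real.cosh (hdist z y) = a * c + b := by
      rw [← lform_hyp, h, lform_comb, lform_hyp_self]
      ring
    have hs : Real.sinh (hdist x y) ^ 2 = c ^ 2 - 1 := sinh_hdist_sq x y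
    have hs0 := Real.sinh_nonneg_iff.2 (hdist_nonneg x y)
    have h1 : Real.sinh (hdist x z) = b * Real.sinh (hdist x y) := by
      rw [← sq_eq_sq₀ (Real.sinh_nonneg_iff.2 (hdist_nonneg x z)) (by positivity), mul_pow, hs,
        Real.sinh_sq, hxz]
      linear_combination hq
    have h2 : Real.sinh (hdist z y) = a * Real.sinh (hdist x y) := by
      rw [← sq_eq_sq₀ (Real.sinh_nonneg_iff.2 (hdist_nonneg z y)) (by positivity), mul_pow, hs,
        Real.sinh_sq, hzy]
      linear_combination hq
    refine eq_of_cosh_eq (add_nonneg (hdist_nonneg _ _) (hdist_nonneg _ _)) (hdist_nonneg _ _) ?_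
    rw [Real.cosh_add, hxz, hzy, h1, h2, ← lform_hyp, ← hc]
    linear_combination c * hq + a * b * hs

theorem left_mem_geodSeg (x y : HSpace n) : x ∈ geodSeg x y := by
  change hdist x x + hdist x y = hdist x y
  rw [hdist_self, zero_add]

theorem right_mem_geodSeg (x y : HSpace n) : y ∈ geodSeg x y := by
  change hdist x y + hdist y y = hdist x y
  rw [hdist_self, add_zero]

theorem geodSeg_comm (x y : HSpace n) : geodSeg x y = geodSeg y x := by
  ext z
  change hdist x z + hdist z y = hdist x y ↔ hdist y z + hdist z x = hdist y x
  rw [hdist_comm y z, hdist_comm z x, hdist_comm y x, add_comm]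

/-- Geodesic segments are convex. -/
theorem geodSeg_subset {x y v w : HSpace n} (hx : x ∈ geodSeg v w) (hy : y ∈ geodSeg v w) :
    geodSeg x y ⊆ geodSeg v w := by
  intro z hz
  rw [mem_geodSeg_iff] at hx hy hz ⊢
  obtain ⟨a, b, ha, hb, h⟩ := hz
  obtain ⟨a₁, b₁, ha₁, hb₁, h₁⟩ := hx
  obtain ⟨a₂, b₂, ha₂, hb₂, h₂⟩ := hy
  refine ⟨a * a₁ + b * a₂, a * b₁ + b * b₂, by positivity, by positivity, ?_⟩
  rw [h, h₁, h₂]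
  module

/-- The coordinates of the point of the half-space on a given ray of the light cone. -/
def rayPoint (V : ℝ × (Fin n → ℝ) × ℝ) : Amb n :=
  WithLp.toLp 2 (Fin.snoc (fun i => V.2.1 i / V.2.2) (√(lform V V) / V.2.2) : Fin (n + 1) → ℝ)

theorem rayPoint_last_pos {V : ℝ × (Fin n → ℝ) × ℝ} (h1 : 0 < V.2.2) (h2 : 0 < lform V V) :
    0 < rayPoint V (Fin.last n) := by
  have : rayPoint V (Fin.last n) = √(lform V V) / V.2.2 := by simp [rayPoint]
  rw [this]
  positivity

theorem hyp_rayPoint {V : ℝ × (Fin n → ℝ) × ℝ} (h1 : 0 < V.2.2) (h2 : 0 < lform V V) :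
    hyp (⟨rayPoint V, rayPoint_last_pos h1 h2⟩ : HSpace n) = (√(lform V V))⁻¹ • V := by
  set x : HSpace n := ⟨rayPoint V, rayPoint_last_pos h1 h2⟩
  have hl : ∀ i, lat x i = V.2.1 i / V.2.2 := by
    intro i
    simp [lat, x, rayPoint]
  have hh : height x = √(lform V V) / V.2.2 := by
    simp [height, x, rayPoint]
  have hs : 0 < √(lform V V) := by positivity
  have hN : nsq x = V.1 / V.2.2 := by
    simp only [nsq, hl, hh, div_pow, Real.sq_sqrt h2.le]
    rw [← Finset.sum_div, lform]
    have : ∑ i, V.2.1 i ^ 2 = ∑ i, V.2.1 i * V.2.1 i :=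
      Finset.sum_congr rfl fun i _ => sq _
    rw [this]
    field_simp
    ring
  simp only [hyp, hl, hh, hN]
  ext i
  · simp only [Prod.smul_fst, smul_eq_mul]
    field_simp
  · simp only [Prod.smul_snd, Prod.smul_fst, Pi.smul_apply, smul_eq_mul]
    field_simp
  · simp only [Prod.smul_snd, smul_eq_mul]
    field_simp

theorem one_le_lform_hyp (x y : HSpace n) : 1 ≤ lform (hyp x) (hyp y) := by
  rw [lform_hyp]
  exact Real.one_le_cosh _

theorem lform_comb_self (a b : ℝ) (x y : HSpace n) :
    lform (a • hyp x + b • hyp y) (a • hyp x + b • hyp y) =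
      a ^ 2 + b ^ 2 + 2 * a * b * lform (hyp x) (hyp y) := by
  rw [lform_comb, lform_comm _ (_ + _), lform_comm _ (_ + _), lform_comb, lform_comb,
    lform_hyp_self, lform_hyp_self, lform_comm (hyp y)]
  ring

/-- The segment is the radial projection to the hyperboloid of the straight segment between `hyp x`
and `hyp y`. Connectedness is what forces a cluster to cross $S_r$. -/
theorem isPreconnected_geodSeg (x y : HSpace n) : IsPreconnected (geodSeg x y) := by
  let V : ℝ → ℝ × (Fin n → ℝ) × ℝ := fun t => (1 - t) • hyp x + t • hyp y
  have hx := height_pos x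
  have hy := height_pos y
  have hV1 : ∀ t ∈ Icc (0 : ℝ) 1, 0 < (V t).2.2 := by
    intro t ht
    have e : (V t).2.2 = (1 - t) * (1 / height x) + t * (1 / height y) := by simp [V, hyp]
    rw [e]
    have h1 : 0 < 1 / height x := by positivity
    have h2 : 0 < 1 / height y := by positivity
    rcases ht.1.eq_or_lt with h | h
    · subst h; simpa using hx
    · have := mul_pos h h2
      have := mul_nonneg (sub_nonneg.2 ht.2) h1.le
      linarith
  have hV2 : ∀ t ∈ Icc (0 : ℝ) 1, 0 < lform (V t) (V t) := by
    intro t ht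
    rw [lform_comb_self]
    have h1 := one_le_lform_hyp x y
    have h2 : 0 ≤ 2 * (1 - t) * t := mul_nonneg (mul_nonneg zero_le_two (sub_nonneg.2 ht.2)) ht.1
    nlinarith
  let f : Icc (0 : ℝ) 1 → HSpace n := fun t =>
    ⟨rayPoint (V t), rayPoint_last_pos (hV1 t t.2) (hV2 t t.2)⟩
  have hf : Continuous f := by
    refine Continuous.subtype_mk ?_ _
    refine (PiLp.continuous_toLp 2 _).comp (continuous_pi fun i => ?_)
    have hVc : Continuous fun t : Icc (0 : ℝ) 1 => V t := by fun_prop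
    have hl : Continuous fun t : Icc (0 : ℝ) 1 => lform (V t) (V t) := by
      unfold lform
      fun_prop
    induction i using Fin.lastCases with
    | last =>
      simp only [Fin.snoc_last]
      exact hl.sqrt.div (by fun_prop) fun t => (hV1 t t.2).ne'
    | cast i =>
      simp only [Fin.snoc_castSucc]
      exact Continuous.div (by fun_prop) (by fun_prop) fun t => (hV1 t t.2).ne'
  have himg : geodSeg x y = range f := by
    ext z
    constructor
    · intro hz
      obtain ⟨a, b, ha, hb, h⟩ := mem_geodSeg_iff.1 hz
      have hab : 0 < a + b := by
        by_contra hcon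
        have ha0 : a = 0 := by linarith
        have hb0 : b = 0 := by linarith
        have := lform_hyp_self z
        rw [h, ha0, hb0] at this
        simp [lform] at this
      have ht : b / (a + b) ∈ Icc (0 : ℝ) 1 :=
        ⟨by positivity, by rw [div_le_one hab]; linarith⟩
      refine ⟨⟨b / (a + b), ht⟩, hyp_injective ?_⟩
      have e1 : V (b / (a + b)) = (a + b)⁻¹ • hyp z := by
        rw [h]
        have : 1 - b / (a + b) = (a + b)⁻¹ * a := by field_simp; ring
        simp only [V]
        rw [this, div_eq_inv_mul, mul_smul, mul_smul, smul_add]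
      have e2 : lform (V (b / (a + b))) (V (b / (a + b))) = (a + b)⁻¹ ^ 2 := by
        have := lform_comb_self (a + b)⁻¹ 0 z z
        rw [zero_smul, add_zero, ← e1] at this
        rw [this]
        ring
      have e3 : hyp (f ⟨b / (a + b), ht⟩) = _ := hyp_rayPoint (hV1 _ ht) (hV2 _ ht)
      rw [e3]
      simp only [e2]
      rw [Real.sqrt_sq (by positivity), inv_inv, e1, smul_inv_smul₀ hab.ne']
    · rintro ⟨t, rfl⟩
      rw [mem_geodSeg_iff]
      have e3 : hyp (f t) = _ := hyp_rayPoint (hV1 _ t.2) (hV2 _ t.2)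
      refine ⟨(√(lform (V t) (V t)))⁻¹ * (1 - t), (√(lform (V t) (V t)))⁻¹ * t,
        mul_nonneg (by positivity) (sub_nonneg.2 t.2.2), mul_nonneg (by positivity) t.2.1, ?_⟩
      rw [e3, mul_smul, mul_smul, ← smul_add]
  rw [himg]
  exact isPreconnected_range hf

end Geometry

end HypPerc

namespace HypPerc

/-! ### Horizontal distances, similarities and derivatives of isometries. -/

section Isometries

open Filter Topology

variable {n : ℕ}

theorem isom_hdist (Φ : isomGroup n) (x y : HSpace n) : hdist (Φ.1 x) (Φ.1 y) = hdist x y :=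
  Φ.2 x y

theorem image_geodSeg (Φ : isomGroup n) (x y : HSpace n) :
    Φ.1 '' geodSeg x y = geodSeg (Φ.1 x) (Φ.1 y) := by
  ext z
  constructor
  · rintro ⟨w, hw, rfl⟩
    change hdist _ _ + hdist _ _ = hdist _ _
    rw [isom_hdist, isom_hdist, isom_hdist]
    exact hw
  · intro hz
    refine ⟨Φ.1.symm z, ?_, Φ.1.apply_symm_apply z⟩
    change hdist _ _ + hdist _ _ = hdist _ _ at hz
    rw [← Φ.1.apply_symm_apply z, isom_hdist, isom_hdist, isom_hdist] at hz
    exact hz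

theorem projDist_eq (x y : HSpace n) : projDist x y = ‖fun i => lat x i - lat y i‖ := rfl

theorem projDist_comm (x y : HSpace n) : projDist x y = projDist y x := by
  rw [projDist_eq, projDist_eq, ← norm_neg]
  congr 1
  ext i
  simp

theorem projDist_nonneg (x y : HSpace n) : 0 ≤ projDist x y := norm_nonneg _

theorem projDist_self (x : HSpace n) : projDist x x = 0 := by
  rw [projDist_eq]
  simp only [sub_self]
  exact norm_zero

theorem projDist_triangle (x y z : HSpace n) : projDist x z ≤ projDist x y + projDist y z := by
  rw [projDist_eq, projDist_eq, projDist_eq]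
  refine le_trans (le_of_eq ?_) (norm_add_le _ _)
  congr 1
  ext i
  simp

theorem abs_lat_sub_le (x y : HSpace n) (i : Fin n) : |lat x i - lat y i| ≤ projDist x y :=
  norm_le_pi_norm (fun i => lat x i - lat y i) i

theorem projDist_sq_le (x y : HSpace n) : projDist x y ^ 2 ≤ ∑ i, (lat x i - lat y i) ^ 2 := by
  have h : projDist x y ≤ √(∑ i, (lat x i - lat y i) ^ 2) := by
    rw [projDist_eq, pi_norm_le_iff_of_nonneg (Real.sqrt_nonneg _)]
    intro i
    rw [Real.norm_eq_abs, ← Real.sqrt_sq_eq_abs]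
    exact Real.sqrt_le_sqrt (Finset.single_le_sum (f := fun i => (lat x i - lat y i) ^ 2)
      (fun i _ => sq_nonneg _) (Finset.mem_univ i))
  calc projDist x y ^ 2 ≤ √(∑ i, (lat x i - lat y i) ^ 2) ^ 2 :=
        pow_le_pow_left₀ (projDist_nonneg x y) h 2
    _ = _ := Real.sq_sqrt (Finset.sum_nonneg fun i _ => sq_nonneg _)

theorem height_le_mul (x y : HSpace n) : height y ≤ 2 * Real.cosh (hdist x y) * height x := by
  have hx := height_pos x
  have hy := height_pos y
  have hs : 0 ≤ ∑ i, (lat x i - lat y i) ^ 2 := Finset.sum_nonneg fun i _ => sq_nonneg _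
  rw [cosh_hdist, dist_sq]
  have : 2 * (1 + (∑ i, (lat x i - lat y i) ^ 2 + (height x - height y) ^ 2) /
      (2 * height x * height y)) * height x = (∑ i, (lat x i - lat y i) ^ 2 + height x ^ 2 +
        height y ^ 2) / height y := by
    field_simp
    ring
  rw [this, le_div_iff₀ hy]
  nlinarith

/-- Horizontal displacement is at most proportional to height for a bounded hyperbolic step. Hence
in the slab $L$ all edges have bounded horizontal extent. -/
theorem projDist_le_mul (x y : HSpace n) : projDist x y ≤ 2 * Real.cosh (hdist x y) * height x := by
  have hx := height_pos x
  have hy := height_pos y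
  have hc := Real.one_le_cosh (hdist x y)
  have h1 := height_le_mul x y
  have h2 : dist x.1 y.1 ^ 2 = 2 * height x * height y * (Real.cosh (hdist x y) - 1) := by
    rw [cosh_hdist]
    field_simp
    ring
  have h3 : projDist x y ^ 2 ≤ dist x.1 y.1 ^ 2 := by
    rw [dist_sq]
    have := projDist_sq_le x y
    nlinarith [sq_nonneg (height x - height y)]
  refine abs_le_of_sq_le_sq' (h3.trans ?_) (by positivity) |>.2
  rw [h2]
  set c := Real.cosh (hdist x y)
  calc 2 * height x * height y * (c - 1) ≤ 2 * height x * (2 * c * height x) * c := by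
        have : 0 ≤ c - 1 := by linarith
        gcongr
        linarith
    _ = _ := by ring

/-- The similarity `x ↦ s x + b`. -/
def similPerm (s : ℝ) (hs : 0 < s) (b : Fin n → ℝ) : Equiv.Perm (HSpace n) where
  toFun x := mkPoint (fun i => s * lat x i + b i) (s * height x) (mul_pos hs (height_pos x))
  invFun x := mkPoint (fun i => s⁻¹ * (lat x i - b i)) (s⁻¹ * height x)
    (mul_pos (inv_pos.2 hs) (height_pos x))
  left_inv x := by
    refine HSpace.ext' (fun i => ?_) ?_ <;> simp [hs.ne']
  right_inv x := by
    refine HSpace.ext' (fun i => ?_) ?_ <;> simp [hs.ne']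

/-- Similarities are isometries of the half-space model. -/
def simil (s : ℝ) (hs : 0 < s) (b : Fin n → ℝ) : isomGroup n :=
  ⟨similPerm s hs b, by
    intro x y
    refine eq_of_cosh_eq (hdist_nonneg _ _) (hdist_nonneg _ _) ?_
    have hx := height_pos x
    have hy := height_pos y
    rw [cosh_hdist, cosh_hdist, dist_sq, dist_sq]
    simp only [similPerm, Equiv.coe_fn_mk, lat_mkPoint, height_mkPoint]
    have : ∀ i, (s * lat x i + b i - (s * lat y i + b i)) ^ 2 =
        s ^ 2 * (lat x i - lat y i) ^ 2 := fun i => by ring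
    simp only [this, ← Finset.mul_sum]
    field_simp⟩

@[simp] theorem lat_simil (s : ℝ) (hs : 0 < s) (b : Fin n → ℝ) (x : HSpace n) (i : Fin n) :
    lat ((simil s hs b).1 x) i = s * lat x i + b i := by
  simp [simil, similPerm]

@[simp] theorem height_simil (s : ℝ) (hs : 0 < s) (b : Fin n → ℝ) (x : HSpace n) :
    height ((simil s hs b).1 x) = s * height x := by
  simp [simil, similPerm]

theorem projDist_simil (s : ℝ) (hs : 0 < s) (b : Fin n → ℝ) (x y : HSpace n) :
    projDist ((simil s hs b).1 x) ((simil s hs b).1 y) = s * projDist x y := by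
  rw [projDist_eq, projDist_eq]
  have : (fun i => lat ((simil s hs b).1 x) i - lat ((simil s hs b).1 y) i) =
      s • fun i => lat x i - lat y i := by
    ext i
    simp
    ring
  rw [this, norm_smul, Real.norm_of_nonneg hs.le]

/-- The hyperbolic cosine of the distance to `u` as a function on the ambient space. -/
def ambCosh (u : HSpace n) (x : Amb n) : ℝ :=
  1 + ‖x - u.1‖ ^ 2 / (2 * x (Fin.last n) * height u)

theorem ambCosh_coe (u x : HSpace n) : ambCosh u x.1 = Real.cosh (hdist x u) := by
  rw [cosh_hdist, ambCosh, dist_eq_norm]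
  rfl

theorem differentiableAt_ambCosh (u x : HSpace n) : DifferentiableAt ℝ (ambCosh u) x.1 := by
  unfold ambCosh
  have h1 : DifferentiableAt ℝ (fun x : Amb n => x (Fin.last n)) x.1 :=
    differentiableAt_euclidean.1 differentiableAt_id _
  simp only [div_eq_mul_inv]
  refine (differentiableAt_const _).fun_add (DifferentiableAt.fun_mul ?_ (DifferentiableAt.fun_inv ?_ ?_))
  · exact (differentiableAt_id.sub_const _).norm_sq ℝ
  · exact (h1.const_mul 2).mul_const _
  · have := height_pos x
    have := height_pos u
    change 2 * height x * height u ≠ 0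
    positivity

theorem lform_axisPoint (z : HSpace n) (s : ℝ) (hs : 0 < s) :
    Real.cosh (hdist z (axisPoint n s hs)) =
      (nsq z / height z / s + s * (1 / height z)) / 2 := by
  rw [← lform_hyp]
  simp only [lform, hyp, nsq, lat_axisPoint, height_axisPoint]
  simp
  field_simp

theorem lform_unit (z : HSpace n) (i : Fin n) :
    Real.cosh (hdist z (mkPoint (Pi.single i 1) 1 one_pos)) =
      (nsq z / height z + 2 * (1 / height z)) / 2 - lat z i / height z := by
  rw [← lform_hyp]
  have h1 : nsq (mkPoint (Pi.single i 1) 1 one_pos : HSpace n) = 2 := by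
    simp [nsq, Pi.single_apply]
    norm_num
  simp only [lform, hyp, h1, lat_mkPoint, height_mkPoint]
  simp [Pi.single_apply]
  ring

/-- The coordinates of $\Phi(x)$ are rational functions of $\cosh$ of its distances to finitely many
fixed points. These equal the distances from $x$ to the preimages of those points, which depend
differentiably on $x$. -/
theorem differentiableAt_ambMap (Φ : isomGroup n) (x : HSpace n) :
    DifferentiableAt ℝ (ambMap Φ.1) x.1 := by
  let Ψ := Φ⁻¹
  have hΨ : ∀ z u, hdist (Φ.1 z) u = hdist z (Ψ.1 u) := by
    intro z u
    have := isom_hdist Φ z (Ψ.1 u)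
    rwa [show Φ.1 (Ψ.1 u) = u from Φ.1.apply_symm_apply u] at this
  let A := ambCosh (Ψ.1 (axisPoint n 1 one_pos))
  let B := ambCosh (Ψ.1 (axisPoint n 2 two_pos))
  let C := fun i : Fin n => ambCosh (Ψ.1 (mkPoint (Pi.single i 1) 1 one_pos))
  -- With $N$ the squared norm and $h$ the height of the image, $A=(N/h+1/h)/2$ and
  -- $B=(N/(2h)+2/h)/2$. This combination eliminates $N$ and leaves $1/h$.
  let ι : Amb n → ℝ := fun y => (4 * B y - 2 * A y) / 3
  have hι : ∀ z : HSpace n, ι z.1 = 1 / height (Φ.1 z) := by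
    intro z
    simp only [ι, A, B, ambCosh_coe, ← hΨ, lform_axisPoint]
    ring
  have hC : ∀ (z : HSpace n) i, A z.1 + ι z.1 / 2 - C i z.1 =
      lat (Φ.1 z) i / height (Φ.1 z) := by
    intro z i
    rw [hι]
    simp only [A, C, ambCosh_coe, ← hΨ, lform_axisPoint, lform_unit]
    ring
  have hev : ambMap Φ.1 =ᶠ[𝓝 x.1] fun y => WithLp.toLp 2
      (Fin.snoc (fun i => (A y + ι y / 2 - C i y) / ι y) (1 / ι y) : Fin (n + 1) → ℝ) := by
    have hopen : IsOpen {y : Amb n | 0 < y (Fin.last n)} :=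
      isOpen_lt continuous_const (by fun_prop)
    filter_upwards [hopen.mem_nhds x.2] with y hy
    have hz := height_pos (Φ.1 ⟨y, hy⟩)
    have h1 := hι ⟨y, hy⟩
    have h2 := hC ⟨y, hy⟩
    simp only at h1 h2
    rw [ambMap, dif_pos hy]
    ext i
    induction i using Fin.lastCases with
    | last =>
      simp only [Fin.snoc_last, h1, one_div_one_div]
      rfl
    | cast i =>
      simp only [Fin.snoc_castSucc]
      have : (Φ.1 ⟨y, hy⟩).1 i.castSucc = lat (Φ.1 ⟨y, hy⟩) i := rfl
      rw [h2, h1, this]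
      field_simp
  refine DifferentiableAt.congr_of_eventuallyEq ?_ hev
  have hA : DifferentiableAt ℝ A x.1 := differentiableAt_ambCosh _ x
  have hB : DifferentiableAt ℝ B x.1 := differentiableAt_ambCosh _ x
  have hC' : ∀ i, DifferentiableAt ℝ (C i) x.1 := fun i => differentiableAt_ambCosh _ x
  have hι' : DifferentiableAt ℝ ι x.1 := by
    simp only [ι, div_eq_mul_inv]
    exact ((hB.const_mul 4).fun_sub (hA.const_mul 2)).mul_const _
  have hι0 : ι x.1 ≠ 0 := by
    rw [hι]
    have := height_pos (Φ.1 x)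
    positivity
  rw [differentiableAt_euclidean]
  intro i
  induction i using Fin.lastCases with
  | last =>
    simp only [Fin.snoc_last, div_eq_mul_inv]
    exact (differentiableAt_const _).fun_mul (hι'.fun_inv hι0)
  | cast i =>
    simp only [Fin.snoc_castSucc, div_eq_mul_inv]
    exact ((hA.fun_add (hι'.mul_const _)).fun_sub (hC' i)).fun_mul (hι'.fun_inv hι0)

/-- Preservation of distance says that $|\Phi z-\Phi x|^2$ equals $|z-x|^2$ times the ratio of the
products of heights. Letting $z\to x$ along a line gives the conformal factor. -/
theorem norm_fderiv_ambMap (Φ : isomGroup n) (x : HSpace n) (v : Amb n) :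
    ‖fderiv ℝ (ambMap Φ.1) x.1 v‖ = height (Φ.1 x) / height x * ‖v‖ := by
  have hx := height_pos x
  have hΦ := height_pos (Φ.1 x)
  have hd := (differentiableAt_ambMap Φ x).hasFDerivAt.hasLineDerivAt v
  have hslope := hasDerivAt_iff_tendsto_slope.1 hd
  have hc : Tendsto (fun t : ℝ => x.1 + t • v) (𝓝[≠] 0) (𝓝 x.1) := by
    have : Continuous fun t : ℝ => x.1 + t • v := by fun_prop
    have := this.tendsto 0
    simp only [zero_smul, add_zero] at this
    exact this.mono_left nhdsWithin_le_nhds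
  have hf : ambMap Φ.1 x.1 = (Φ.1 x).1 := by
    rw [ambMap, dif_pos x.2]
  have h1 : Tendsto (fun t : ℝ => ‖slope (fun t : ℝ => ambMap Φ.1 (x.1 + t • v)) 0 t‖ ^ 2)
      (𝓝[≠] 0) (𝓝 (‖fderiv ℝ (ambMap Φ.1) x.1 v‖ ^ 2)) := (hslope.norm).pow 2
  have h2 : Tendsto (fun t : ℝ => ‖v‖ ^ 2 * (height (Φ.1 x) / height x) *
      (ambMap Φ.1 (x.1 + t • v) (Fin.last n) / (x.1 + t • v) (Fin.last n))) (𝓝[≠] 0)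
      (𝓝 (‖v‖ ^ 2 * (height (Φ.1 x) / height x) * (height (Φ.1 x) / height x))) := by
    refine Tendsto.const_mul _ (Tendsto.div ?_ ?_ hx.ne')
    · have h3 : ContinuousAt (fun y => ambMap Φ.1 y (Fin.last n)) x.1 :=
        (differentiableAt_euclidean.1 (differentiableAt_ambMap Φ x) (Fin.last n)).continuousAt
      have := h3.tendsto.comp hc
      rw [hf] at this
      exact this
    · have h3 : Continuous fun y : Amb n => y (Fin.last n) := by fun_prop
      exact (h3.tendsto x.1).comp hc
  have heq : (fun t : ℝ => ‖slope (fun t : ℝ => ambMap Φ.1 (x.1 + t • v)) 0 t‖ ^ 2) =ᶠ[𝓝[≠] 0]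
      fun t : ℝ => ‖v‖ ^ 2 * (height (Φ.1 x) / height x) *
      (ambMap Φ.1 (x.1 + t • v) (Fin.last n) / (x.1 + t • v) (Fin.last n)) := by
    have hopen : IsOpen {y : Amb n | 0 < y (Fin.last n)} :=
      isOpen_lt continuous_const (by fun_prop)
    filter_upwards [hc.eventually (hopen.mem_nhds x.2), self_mem_nhdsWithin] with t ht ht0
    have ht0 : t ≠ 0 := ht0
    have hz : 0 < (x.1 + t • v) (Fin.last n) := ht
    set z : HSpace n := ⟨x.1 + t • v, hz⟩ with hzdef
    have hfz : ambMap Φ.1 (x.1 + t • v) = (Φ.1 z).1 := by rw [ambMap, dif_pos hz]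
    have hhz : (x.1 + t • v) (Fin.last n) = height z := rfl
    have hhz' : (Φ.1 z).1 (Fin.last n) = height (Φ.1 z) := rfl
    have hz' := height_pos z
    have hΦz := height_pos (Φ.1 z)
    have hcosh := congrArg Real.cosh (isom_hdist Φ z x)
    rw [cosh_hdist, cosh_hdist] at hcosh
    have hdz : dist z.1 x.1 = |t| * ‖v‖ := by
      simp [hzdef, norm_smul]
    rw [slope_def_module, sub_zero, zero_smul, add_zero, hf, hfz, hhz, hhz', norm_smul, ← dist_eq_norm,
      mul_pow, norm_inv, Real.norm_eq_abs]
    have h5 : dist (Φ.1 z).1 (Φ.1 x).1 ^ 2 = t ^ 2 * ‖v‖ ^ 2 * (height (Φ.1 z) * height (Φ.1 x)) /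
        (height z * height x) := by
      have h6 := add_left_cancel hcosh
      rw [hdz, mul_pow, sq_abs] at h6
      field_simp at h6
      field_simp
      linear_combination h6
    rw [h5, inv_pow, sq_abs]
    field_simp
  have h6 := tendsto_nhds_unique (h2.congr' heq.symm) h1
  have h7 : ‖fderiv ℝ (ambMap Φ.1) x.1 v‖ ^ 2 = (height (Φ.1 x) / height x * ‖v‖) ^ 2 := by
    rw [← h6]; ring
  exact (sq_eq_sq₀ (norm_nonneg _) (by positivity)).1 h7

/-- Every isometry taking the origin to the axis is of the form `Φ^{(h,R)}`. -/
theorem exists_isPhi (Φ : isomGroup n) (h : ℝ) (hh : 0 < h)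
    (ho : Φ.1 (origin n) = axisPoint n h hh) : ∃ R, IsPhi h hh R Φ := by
  set D := fderiv ℝ (ambMap Φ.1) (origin n).1 with hD
  have hnorm : ∀ v, ‖D v‖ = h * ‖v‖ := by
    intro v
    rw [hD, norm_fderiv_ambMap, ho]
    simp
  let li : Amb n →ₗᵢ[ℝ] Amb n :=
    { toLinearMap := h⁻¹ • (D : Amb n →ₗ[ℝ] Amb n)
      norm_map' := by
        intro v
        simp only [LinearMap.smul_apply, ContinuousLinearMap.coe_coe, norm_smul, hnorm, norm_inv,
          Real.norm_of_nonneg hh.le]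
        field_simp }
  refine ⟨li.toLinearIsometryEquiv rfl, ho, ?_⟩
  have : h • ((li.toLinearIsometryEquiv rfl).toContinuousLinearEquiv : Amb n →L[ℝ] Amb n) = D := by
    ext v i
    simp [li, hh.ne']
  rw [this]
  exact (differentiableAt_ambMap Φ (origin n)).hasFDerivAt

end Isometries

end HypPerc

namespace HypPerc

/-! ### The Klein model and convergence to points at infinity. -/

section Klein

open Filter Topology

variable {n : ℕ}

/-- The projective (Klein) model centred at the origin. -/
def klein (x : HSpace n) : Amb n :=
  WithLp.toLp 2 (Fin.snoc (fun i => 2 * lat x i / (nsq x + 1)) ((nsq x - 1) / (nsq x + 1)) :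
    Fin (n + 1) → ℝ)

theorem nsq_nonneg (x : HSpace n) : 0 ≤ nsq x :=
  add_nonneg (Finset.sum_nonneg fun _ _ => sq_nonneg _) (sq_nonneg _)

@[simp] theorem klein_castSucc (x : HSpace n) (i : Fin n) :
    klein x i.castSucc = 2 * lat x i / (nsq x + 1) := by simp [klein]

@[simp] theorem klein_last (x : HSpace n) :
    klein x (Fin.last n) = (nsq x - 1) / (nsq x + 1) := by simp [klein]

theorem cosh_hdist_origin (x : HSpace n) :
    Real.cosh (hdist (origin n) x) = (nsq x + 1) / (2 * height x) := by
  have := height_pos x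
  rw [hdist_comm, origin, lform_axisPoint]
  field_simp

theorem cosh_hdist_eq (x y : HSpace n) :
    Real.cosh (hdist x y) = (nsq x + nsq y - 2 * ∑ i, lat x i * lat y i) /
      (2 * height x * height y) := by
  have hx := height_pos x
  have hy := height_pos y
  have h2 : ∑ i, lat x i / height x * (lat y i / height y) =
      (∑ i, lat x i * lat y i) / (height x * height y) := by
    rw [Finset.sum_div]
    exact Finset.sum_congr rfl fun i _ => by field_simp
  rw [← lform_hyp]
  simp only [lform, hyp, h2]
  field_simp

/-- The right-hand side involves only the mutual distances of `x`, `y` and the origin, so isometries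
fixing the origin preserve it. -/
theorem dist_klein_sq (x y : HSpace n) :
    dist (klein x) (klein y) ^ 2 =
      2 * Real.cosh (hdist x y) /
        (Real.cosh (hdist (origin n) x) * Real.cosh (hdist (origin n) y)) -
      1 / Real.cosh (hdist (origin n) x) ^ 2 - 1 / Real.cosh (hdist (origin n) y) ^ 2 := by
  have hx := height_pos x
  have hy := height_pos y
  have hNx : 0 < nsq x + 1 := by linarith [nsq_nonneg x]
  have hNy : 0 < nsq y + 1 := by linarith [nsq_nonneg y]
  rw [cosh_hdist_origin, cosh_hdist_origin, cosh_hdist_eq, EuclideanSpace.dist_sq_eq,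
    Fin.sum_univ_castSucc]
  simp only [klein_castSucc, klein_last, Real.dist_eq, sq_abs]
  have h1 : ∑ i, (2 * lat x i / (nsq x + 1) - 2 * lat y i / (nsq y + 1)) ^ 2 =
      4 / (nsq x + 1) ^ 2 * ∑ i, lat x i ^ 2 + 4 / (nsq y + 1) ^ 2 * ∑ i, lat y i ^ 2 -
        8 / ((nsq x + 1) * (nsq y + 1)) * ∑ i, lat x i * lat y i := by
    rw [Finset.mul_sum, Finset.mul_sum, Finset.mul_sum, ← Finset.sum_add_distrib,
      ← Finset.sum_sub_distrib]
    refine Finset.sum_congr rfl fun i _ => ?_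
    field_simp
    ring
  have hX : ∑ i, lat x i ^ 2 = nsq x - height x ^ 2 := by simp [nsq]
  have hY : ∑ i, lat y i ^ 2 = nsq y - height y ^ 2 := by simp [nsq]
  rw [h1, hX, hY]
  field_simp
  ring

/-- Isometries fixing the origin are isometries of the Klein model. -/
theorem dist_klein_isom (Φ : isomGroup n) (ho : Φ.1 (origin n) = origin n) (x y : HSpace n) :
    dist (klein (Φ.1 x)) (klein (Φ.1 y)) = dist (klein x) (klein y) := by
  have h : ∀ z, hdist (origin n) (Φ.1 z) = hdist (origin n) z := by
    intro z
    have := isom_hdist Φ (origin n) z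
    rwa [ho] at this
  rw [← sq_eq_sq₀ dist_nonneg dist_nonneg, dist_klein_sq, dist_klein_sq, h, h, isom_hdist]

theorem norm_klein_sq (x : HSpace n) :
    ‖klein x‖ ^ 2 = 1 - 1 / Real.cosh (hdist (origin n) x) ^ 2 := by
  have hx := height_pos x
  have hNx : 0 < nsq x + 1 := by linarith [nsq_nonneg x]
  rw [cosh_hdist_origin, EuclideanSpace.norm_sq_eq, Fin.sum_univ_castSucc]
  simp only [klein_castSucc, klein_last, Real.norm_eq_abs, sq_abs]
  have h1 : ∑ i, (2 * lat x i / (nsq x + 1)) ^ 2 = 4 / (nsq x + 1) ^ 2 * ∑ i, lat x i ^ 2 := by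
    rw [Finset.mul_sum]
    refine Finset.sum_congr rfl fun i _ => ?_
    field_simp
    ring
  have hX : ∑ i, lat x i ^ 2 = nsq x - height x ^ 2 := by simp [nsq]
  rw [h1, hX]
  field_simp
  ring

/-- The image of `∞` in the Klein model. -/
def kleinTop (n : ℕ) : Amb n := EuclideanSpace.single (Fin.last n) 1

/-- Being horizontally far forces `nsq x ≥ ρ ^ 2`, and the squared distance is `4 / (nsq x + 1)`
minus a nonnegative term. -/
theorem dist_klein_top_sq_le {x : HSpace n} {ρ : ℝ} (hρ : 0 ≤ ρ)
    (h : ρ ≤ projDist (origin n) x) : dist (klein x) (kleinTop n) ^ 2 ≤ 4 / (ρ ^ 2 + 1) := by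
  have hNx : 0 < nsq x + 1 := by linarith [nsq_nonneg x]
  have h1 : ρ ^ 2 ≤ nsq x := by
    have h2 := projDist_sq_le (origin n) x
    simp only [lat_origin, zero_sub, neg_sq] at h2
    have h3 : ρ ^ 2 ≤ projDist (origin n) x ^ 2 := pow_le_pow_left₀ hρ h 2
    unfold nsq
    nlinarith [sq_nonneg (height x)]
  have h2 : dist (klein x) (kleinTop n) ^ 2 ≤ 4 / (nsq x + 1) := by
    rw [EuclideanSpace.dist_sq_eq, Fin.sum_univ_castSucc]
    have e : ∀ i : Fin n, kleinTop n i.castSucc = 0 := fun i => by simp [kleinTop]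
    have e' : kleinTop n (Fin.last n) = 1 := by simp [kleinTop]
    simp only [klein_castSucc, klein_last, e, e', Real.dist_eq, sq_abs, sub_zero]
    have h1 : ∑ i, (2 * lat x i / (nsq x + 1)) ^ 2 = 4 / (nsq x + 1) ^ 2 * ∑ i, lat x i ^ 2 := by
      rw [Finset.mul_sum]
      refine Finset.sum_congr rfl fun i _ => ?_
      field_simp
      ring
    have hX : ∑ i, lat x i ^ 2 = nsq x - height x ^ 2 := by simp [nsq]
    rw [h1, hX, show (nsq x - 1) / (nsq x + 1) - 1 = -2 / (nsq x + 1) by field_simp; ring]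
    have : 4 / (nsq x + 1) - (4 / (nsq x + 1) ^ 2 * (nsq x - height x ^ 2) +
        (-2 / (nsq x + 1)) ^ 2) = 4 * height x ^ 2 / (nsq x + 1) ^ 2 := by
      field_simp
      ring
    have h5 : 0 ≤ 4 * height x ^ 2 / (nsq x + 1) ^ 2 := by positivity
    linarith
  refine h2.trans ?_
  gcongr

/-- Points `a`, `b` whose images under an isometry fixing the origin are far away in the
direction of `∞` are close in the Klein model. -/
theorem dist_klein_le_of_far (Φ : isomGroup n) (ho : Φ.1 (origin n) = origin n) {x y : HSpace n}
    {ρ : ℝ} (hρ : 0 < ρ) (hx : ρ ≤ projDist (origin n) (Φ.1 x))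
    (hy : ρ ≤ projDist (origin n) (Φ.1 y)) : dist (klein x) (klein y) ≤ 4 / ρ := by
  rw [← dist_klein_isom Φ ho]
  have key : ∀ z : HSpace n, ρ ≤ projDist (origin n) z → dist (klein z) (kleinTop n) ≤ 2 / ρ := by
    intro z hz
    refine abs_le_of_sq_le_sq' ?_ (by positivity) |>.2
    refine (dist_klein_top_sq_le hρ.le hz).trans ?_
    rw [div_pow, show (2 : ℝ) ^ 2 = 4 by norm_num]
    gcongr
    linarith
  have h1 := dist_triangle_right (klein (Φ.1 x)) (klein (Φ.1 y)) (kleinTop n)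
  have h2 := key _ hx
  have h3 := key _ hy
  have : 4 / ρ = 2 / ρ + 2 / ρ := by ring
  linarith

theorem one_sub_norm_klein_sq_le {x : HSpace n} (Φ : isomGroup n)
    (ho : Φ.1 (origin n) = origin n) {ρ : ℝ} (hρ : 0 < ρ)
    (hx : ρ ≤ projDist (origin n) (Φ.1 x)) : 1 - 4 / ρ ^ 2 ≤ ‖klein x‖ ^ 2 := by
  rw [norm_klein_sq]
  have h1 := projDist_le_mul (origin n) (Φ.1 x)
  have h2 : hdist (origin n) (Φ.1 x) = hdist (origin n) x := by
    have := isom_hdist Φ (origin n) x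
    rwa [ho] at this
  rw [h2, height_origin, mul_one] at h1
  have h3 : ρ / 2 ≤ Real.cosh (hdist (origin n) x) := by linarith
  have h4 : 1 / Real.cosh (hdist (origin n) x) ^ 2 ≤ 1 / (ρ / 2) ^ 2 := by gcongr
  have h5 : 1 / (ρ / 2) ^ 2 = 4 / ρ ^ 2 := by field_simp; norm_num
  linarith

/-- The point at infinity with a given image in the Klein model. -/
def idealPoint (κ : Amb n) : HHat n :=
  open Classical in
  if κ (Fin.last n) = 1 then OnePoint.infty else
    ((⟨WithLp.toLp 2 (Fin.snoc (fun i => κ i.castSucc / (1 - κ (Fin.last n))) 0 :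
      Fin (n + 1) → ℝ), by simp⟩ : {x : Amb n // 0 ≤ x (Fin.last n)}) : HHat n)

theorem idealPoint_mem (κ : Amb n) : idealPoint κ ∈ idealBoundary n := by
  rintro ⟨x, hx⟩
  unfold idealPoint toHat at hx
  split_ifs at hx with h
  · exact OnePoint.coe_ne_infty _ hx
  · rw [OnePoint.coe_eq_coe] at hx
    have h1 := congrArg (fun z : {x : Amb n // 0 ≤ x (Fin.last n)} => z.1 (Fin.last n)) hx
    simp only [Fin.snoc_last] at h1
    exact x.2.ne' h1

/-- Inverting `klein` expresses `lat` and `nsq` as quotients by $1-\kappa_{\mathrm{last}}$. If this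
vanishes, `nsq` tends to infinity and the points leave every compact set; otherwise the coordinates
converge, with height tending to $0$ because $\|\kappa\|=1$. -/
theorem tendsto_idealPoint {κ : Amb n} (hκ : ‖κ‖ = 1) {x : ℕ → HSpace n}
    (hx : Tendsto (fun k => klein (x k)) atTop (𝓝 κ)) :
    Tendsto (fun k => toHat (x k)) atTop (𝓝 (idealPoint κ)) := by
  have hcoord : ∀ j, Tendsto (fun k => klein (x k) j) atTop (𝓝 (κ j)) := by
    intro j
    have : Continuous fun y : Amb n => y j := by fun_prop
    exact (this.tendsto κ).comp hx
  have hlast := hcoord (Fin.last n)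
  have hN : ∀ k, 0 < nsq (x k) + 1 := fun k => by linarith [nsq_nonneg (x k)]
  have hsub : ∀ k, 1 - klein (x k) (Fin.last n) = 2 / (nsq (x k) + 1) := by
    intro k
    have := (hN k).ne'
    rw [klein_last]
    field_simp
    ring
  unfold idealPoint
  split_ifs with h
  · have h0 : Tendsto (fun k => nsq (x k) + 1) atTop atTop := by
      have h1 : Tendsto (fun k => (nsq (x k) + 1)⁻¹) atTop (𝓝[>] 0) := by
        rw [tendsto_nhdsWithin_iff]
        refine ⟨?_, Eventually.of_forall fun k => inv_pos.2 (hN k)⟩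
        have h2 : Tendsto (fun k => (1 - klein (x k) (Fin.last n)) / 2) atTop (𝓝 ((1 - 1) / 2)) := by
          rw [h] at hlast
          exact (hlast.const_sub 1).div_const 2
        rw [sub_self, zero_div] at h2
        refine h2.congr fun k => ?_
        rw [hsub]
        have := (hN k).ne'
        field_simp
      have := h1.inv_tendsto_nhdsGT_zero
      refine this.congr fun k => ?_
      simp
    refine OnePoint.tendsto_coe_infty.comp ?_
    rw [coclosedCompact_eq_cocompact, Filter.hasBasis_cocompact.tendsto_right_iff]
    intro K hK
    obtain ⟨M, hM⟩ := (hK.image (continuous_subtype_val.norm.pow 2)).bddAbove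
    filter_upwards [h0.eventually_gt_atTop (M + 1)] with k hk hkK
    have h1 := hM ⟨_, hkK, rfl⟩
    have h2 : ‖(x k).1‖ ^ 2 = nsq (x k) := by
      rw [EuclideanSpace.norm_sq_eq, Fin.sum_univ_castSucc]
      simp [nsq, lat, height]
    simp only [Pi.pow_apply, h2] at h1
    linarith
  · have hne : 1 - κ (Fin.last n) ≠ 0 := fun h' => h (by linarith)
    refine ((OnePoint.continuous_coe.tendsto _).comp ?_)
    rw [tendsto_subtype_rng]
    have hlim := (hlast.const_sub 1)
    have hl : ∀ i, Tendsto (fun k => lat (x k) i) atTop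
        (𝓝 (κ i.castSucc / (1 - κ (Fin.last n)))) := by
      intro i
      refine ((hcoord i.castSucc).div hlim hne).congr fun k => ?_
      have := (hN k).ne'
      simp only [Pi.div_apply]
      rw [hsub, klein_castSucc]
      field_simp
    have hnsq : Tendsto (fun k => nsq (x k)) atTop
        (𝓝 ((1 + κ (Fin.last n)) / (1 - κ (Fin.last n)))) := by
      refine ((hlast.const_add 1).div hlim hne).congr fun k => ?_
      have := (hN k).ne'
      simp only [Pi.div_apply]
      rw [hsub, klein_last]
      field_simp
      ring
    have hh : Tendsto (fun k => height (x k)) atTop (𝓝 0) := by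
      have h1 : Tendsto (fun k => √(nsq (x k) - ∑ i, lat (x k) i ^ 2)) atTop
          (𝓝 √((1 + κ (Fin.last n)) / (1 - κ (Fin.last n)) -
            ∑ i : Fin n, (κ i.castSucc / (1 - κ (Fin.last n))) ^ 2)) :=
        (hnsq.sub (tendsto_finsetSum _ fun i _ => (hl i).pow 2)).sqrt
      have h2 : (1 + κ (Fin.last n)) / (1 - κ (Fin.last n)) -
            ∑ i : Fin n, (κ i.castSucc / (1 - κ (Fin.last n))) ^ 2 = 0 := by
        have h3 : ‖κ‖ ^ 2 = 1 := by rw [hκ, one_pow]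
        rw [EuclideanSpace.norm_sq_eq, Fin.sum_univ_castSucc] at h3
        simp only [Real.norm_eq_abs, sq_abs] at h3
        simp only [div_pow]
        rw [← Finset.sum_div]
        field_simp
        linear_combination (-1) * h3
      rw [h2, Real.sqrt_zero] at h1
      refine h1.congr fun k => ?_
      rw [nsq, add_sub_cancel_left, Real.sqrt_sq (height_pos _).le]
    refine (((PiLp.continuous_toLp 2 _).tendsto _).comp
      (f := fun k i => (x k).1 i) (tendsto_pi_nhds.2 fun i => ?_))
    induction i using Fin.lastCases with
    | last =>
      simp only [Fin.snoc_last]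
      exact hh
    | cast i =>
      simp only [Fin.snoc_castSucc]
      exact hl i

theorem idealPoint_mem_bdAtInfinity {κ : Amb n} (hκ : ‖κ‖ = 1) {C : Set (HSpace n)}
    (h : ∀ k : ℕ, ∃ v ∈ C, dist (klein v) κ < 1 / ((k : ℝ) + 1)) :
    idealPoint κ ∈ bdAtInfinity C := by
  choose x hxC hx using h
  refine ⟨?_, idealPoint_mem κ⟩
  refine mem_closure_of_tendsto (tendsto_idealPoint hκ (x := x) ?_)
    (Eventually.of_forall fun k => ⟨x k, hxC k, rfl⟩)
  rw [tendsto_iff_dist_tendsto_zero]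
  exact squeeze_zero (fun _ => dist_nonneg) (fun k => (hx k).le)
    tendsto_one_div_add_atTop_nhds_zero_nat

end Klein

end HypPerc

namespace HypPerc

/-! ### Uniform bounds for the graph; clusters as sets of points and of vertices. -/

section GraphFacts

open Filter Topology

variable {n : ℕ}

/-- This connects the hyperbolic metric to `LocFinite`, which is formulated topologically. Both the
Euclidean norm and the height must be controlled, since the half-space is open. -/
theorem isCompact_hball (c : ℝ) :
    IsCompact {z : HSpace n | Real.cosh (hdist (origin n) z) ≤ c} := by
  have hK : IsCompact ({z : Amb n | ‖z‖ ≤ 2 * |c| + 1} ∩ {z : Amb n | (2 * (|c| + 1))⁻¹ ≤ z (Fin.last n)}) := by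
    refine IsCompact.inter_right ?_ (isClosed_le continuous_const (by fun_prop))
    have : {z : Amb n | ‖z‖ ≤ 2 * |c| + 1} = Metric.closedBall 0 (2 * |c| + 1) := by
      ext z; simp
    rw [this]
    exact isCompact_closedBall _ _
  have hK' : IsCompact (Subtype.val ⁻¹' ({z : Amb n | ‖z‖ ≤ 2 * |c| + 1} ∩
      {z : Amb n | (2 * (|c| + 1))⁻¹ ≤ z (Fin.last n)}) : Set (HSpace n)) := by
    refine Topology.IsInducing.subtypeVal.isCompact_preimage' hK ?_
    rintro z ⟨-, hz⟩
    have hz' : (2 * (|c| + 1))⁻¹ ≤ z (Fin.last n) := hz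
    have : 0 < (2 * (|c| + 1))⁻¹ := by positivity
    exact ⟨⟨z, this.trans_le hz'⟩, rfl⟩
  refine hK'.of_isClosed_subset ?_ ?_
  · have h1 : {z : HSpace n | Real.cosh (hdist (origin n) z) ≤ c} =
        {z : HSpace n | ‖z.1‖ ^ 2 + 1 ≤ c * (2 * z.1 (Fin.last n))} := by
      ext z
      have hz := height_pos z
      have h2 : ‖z.1‖ ^ 2 = nsq z := by
        rw [EuclideanSpace.norm_sq_eq, Fin.sum_univ_castSucc]
        simp [nsq, lat, height]
      simp only [mem_ofPred_eq, h2, cosh_hdist_origin]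
      rw [div_le_iff₀ (by positivity)]
      rfl
    rw [h1]
    exact isClosed_le (by fun_prop) (by fun_prop)
  · intro z hz
    have hz' : Real.cosh (hdist (origin n) z) ≤ |c| := le_trans hz (le_abs_self c)
    have hc := Real.one_le_cosh (hdist (origin n) z)
    have h1 := height_le_mul (origin n) z
    have h2 := height_le_mul z (origin n)
    rw [hdist_comm] at h2
    rw [height_origin] at h1 h2
    have hzp := height_pos z
    have h4 : ‖z.1‖ ^ 2 = nsq z := by
      rw [EuclideanSpace.norm_sq_eq, Fin.sum_univ_castSucc]
      simp [nsq, lat, height]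
    have h5 := cosh_hdist_origin z
    rw [eq_div_iff (by positivity)] at h5
    refine ⟨?_, ?_⟩
    · change ‖z.1‖ ≤ _
      refine abs_le_of_sq_le_sq' ?_ (by positivity) |>.2
      rw [h4]
      nlinarith
    · change (2 * (|c| + 1))⁻¹ ≤ height z
      rw [inv_le_iff_one_le_mul₀ (by positivity)]
      nlinarith

namespace EmbGraph

variable {G : EmbGraph n}

theorem countable_verts (hfin : G.LocFinite) : Countable G.verts := by
  have h : G.verts = ⋃ k : ℕ, G.verts ∩ {z | Real.cosh (hdist (origin n) z) ≤ k} := by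
    rw [← inter_iUnion, eq_comm, inter_eq_left]
    intro z _
    obtain ⟨k, hk⟩ := exists_nat_ge (Real.cosh (hdist (origin n) z))
    exact mem_iUnion.2 ⟨k, hk⟩
  have : G.verts.Countable := by
    rw [h]
    exact countable_iUnion fun k => (hfin _ (isCompact_hball k)).1.countable
  exact this.to_subtype

/-- The graph automorphism induced by an isometry. -/
theorem exists_isom_aut (htrans : G.TransUnderIsom) (v w : G.verts) :
    ∃ (γ : isomGroup n) (a : G.graph ≃g G.graph), (∀ u : G.verts, (a u).1 = γ.1 u.1) ∧
      a v = w := by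
  obtain ⟨Γ, hΓ, haut, ht⟩ := htrans
  obtain ⟨γ, hγ, hγvw⟩ := ht v w
  obtain ⟨a, ha⟩ := haut γ hγ
  exact ⟨⟨γ, hΓ hγ⟩, a, ha, Subtype.ext ((ha v).trans hγvw)⟩

/-- Finitely many edges meet the compact set $\{o\}$, and transitivity by isometries carries their
length bound to every vertex. -/
theorem exists_cosh_edge_le (hfin : G.LocFinite) (htrans : G.TransUnderIsom)
    (ho : origin n ∈ G.verts) :
    ∃ c : ℝ, 1 ≤ c ∧ ∀ v w : G.verts, G.graph.Adj v w → Real.cosh (hdist v.1 w.1) ≤ c := by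
  set o : G.verts := ⟨origin n, ho⟩
  have h1 : {w : G.verts | G.graph.Adj o w}.Finite := by
    have h2 := (hfin {origin n} isCompact_singleton).2
    refine Set.Finite.of_finite_image (f := fun w => s(o, w)) (h2.subset ?_) ?_
    · rintro _ ⟨w, hw, rfl⟩
      exact ⟨hw, origin n, ⟨o, w, rfl, left_mem_geodSeg _ _⟩, rfl⟩
    · intro w _ w' _ h
      exact Sym2.congr_right.1 h
  obtain ⟨M, hM⟩ := (h1.image fun w => Real.cosh (hdist o.1 w.1)).bddAbove
  refine ⟨max 1 M, le_max_left _ _, fun v w hvw => ?_⟩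
  obtain ⟨γ, a, ha, hav⟩ := exists_isom_aut htrans v o
  have h3 : G.graph.Adj o (a w) := by rw [← hav]; exact a.map_adj_iff.2 hvw
  have h4 : hdist o.1 (a w).1 = hdist v.1 w.1 := by
    rw [← hav, ha, ha, isom_hdist]
  rw [← h4]
  exact (hM ⟨a w, h3, rfl⟩).trans (le_max_right _ _)

theorem exists_card_ball_le (hfin : G.LocFinite) (htrans : G.TransUnderIsom)
    (ho : origin n ∈ G.verts) (c : ℝ) :
    ∃ M : ℕ, ∀ v : G.verts, {w : G.verts | Real.cosh (hdist v.1 w.1) ≤ c}.encard ≤ M := by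
  set o : G.verts := ⟨origin n, ho⟩
  have h1 : {w : G.verts | Real.cosh (hdist o.1 w.1) ≤ c}.Finite := by
    refine Set.Finite.of_finite_image (f := Subtype.val)
      ((hfin _ (isCompact_hball (n := n) c)).1.subset ?_) Subtype.val_injective.injOn
    rintro _ ⟨w, hw, rfl⟩
    exact ⟨w.2, hw⟩
  refine ⟨h1.toFinset.card, fun v => ?_⟩
  rw [← Set.encard_coe_eq_coe_finsetCard, h1.coe_toFinset]
  obtain ⟨γ, a, ha, hav⟩ := exists_isom_aut htrans v o
  refine Set.encard_le_encard_of_injOn (f := a) ?_ a.injective.injOn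
  intro w hw
  have h4 : hdist o.1 (a w).1 = hdist v.1 w.1 := by
    rw [← hav, ha, ha, isom_hdist]
  change Real.cosh (hdist o.1 (a w).1) ≤ c
  rw [h4]
  exact hw

theorem perc_eq_bern (p : I) : G.perc p = bern G.graph.edgeSet p := rfl

instance (p : I) : IsProbabilityMeasure (G.perc p) := by
  rw [perc_eq_bern]
  infer_instance

theorem segOf_mk (v w : G.verts) : segOf s(v, w) = geodSeg v.1 w.1 := by
  ext z
  constructor
  · rintro ⟨v', w', h, hz⟩
    rw [Sym2.eq_iff] at h
    rcases h with ⟨rfl, rfl⟩ | ⟨rfl, rfl⟩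
    · exact hz
    · rwa [geodSeg_comm]
  · exact fun hz => ⟨v, w, rfl, hz⟩

theorem mem_segOf {u : G.verts} {e : Sym2 G.verts} (h : u ∈ e) : u.1 ∈ segOf e := by
  obtain ⟨w, rfl⟩ := h
  rw [segOf_mk]
  exact left_mem_geodSeg _ _

theorem OpenStep.symm {Φ : isomGroup n} {A : Set (HSpace n)} {ω : G.Config} {x y : HSpace n}
    (h : G.OpenStep Φ A ω x y) : G.OpenStep Φ A ω y x := by
  obtain ⟨e, he, hx, hy, hA⟩ := h
  exact ⟨e, he, hy, hx, by rwa [geodSeg_comm]⟩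

theorem cluster_symm {Φ : isomGroup n} {A : Set (HSpace n)} {ω : G.Config} {x y : HSpace n}
    (h : y ∈ G.cluster Φ A ω x) : x ∈ G.cluster Φ A ω y :=
  haveI : Std.Symm (G.OpenStep Φ A ω) := ⟨fun _ _ => OpenStep.symm⟩
  Relation.ReflTransGen.stdSymm.symm _ _ h

theorem cluster_trans {Φ : isomGroup n} {A : Set (HSpace n)} {ω : G.Config} {x y z : HSpace n}
    (h : y ∈ G.cluster Φ A ω x) (h' : z ∈ G.cluster Φ A ω y) : z ∈ G.cluster Φ A ω x :=
  Relation.ReflTransGen.trans h h'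

/-- Clusters are mapped to clusters by isometries. -/
theorem mem_cluster_mul (Ψ Φ : isomGroup n) {A A' : Set (HSpace n)} (hA : Ψ.1 '' A ⊆ A')
    {ω : G.Config} {x y : HSpace n} (h : y ∈ G.cluster Φ A ω x) :
    Ψ.1 y ∈ G.cluster (Ψ * Φ) A' ω (Ψ.1 x) := by
  refine Relation.ReflTransGen.lift Ψ.1 ?_ _ _ h
  rintro a b ⟨e, he, ⟨a', ha', rfl⟩, ⟨b', hb', rfl⟩, hab⟩
  refine ⟨e, he, ⟨a', ha', rfl⟩, ⟨b', hb', rfl⟩, ?_⟩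
  rw [← image_geodSeg]
  exact (image_mono hab).trans hA

/-- A graph automorphism induced by an isometry preserves the law of the clusters. -/
theorem perc_cluster_aut {γ : isomGroup n} {a : G.graph ≃g G.graph}
    (ha : ∀ u : G.verts, (a u).1 = γ.1 u.1) (p : I) (Φ : isomGroup n) (A : Set (HSpace n))
    (x : HSpace n) (𝒜 : Set (Set (HSpace n))) :
    G.perc p {ω | G.cluster Φ A ω x ∈ 𝒜} = G.perc p {ω | G.cluster (Φ * γ) A ω x ∈ 𝒜} := by
  rw [perc_eq_bern, ← bern_preimage_equiv p a.mapEdgeSet {ω | G.cluster (Φ * γ) A ω x ∈ 𝒜}]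
  have hseg : ∀ e : G.graph.edgeSet, segOf (a.mapEdgeSet e).1 = γ.1 '' segOf e.1 := by
    rintro ⟨e, he⟩
    induction e using Sym2.ind with
    | _ v w =>
      have : (a.mapEdgeSet ⟨s(v, w), he⟩).1 = s(a v, a w) := rfl
      rw [this, segOf_mk, segOf_mk, ha, ha, image_geodSeg]
  have himg : ∀ e : G.graph.edgeSet, (Φ * γ).1 '' segOf e.1 = Φ.1 '' segOf (a.mapEdgeSet e).1 := by
    intro e
    rw [hseg, ← image_comp]
    rfl
  have hstep : ∀ ω : G.Config, G.OpenStep Φ A ω = G.OpenStep (Φ * γ) A (a.mapEdgeSet ⁻¹' ω) := by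
    intro ω
    ext y z
    constructor
    · rintro ⟨e, he, hy, hz, hyz⟩
      obtain ⟨e, rfl⟩ := a.mapEdgeSet.surjective e
      exact ⟨e, he, by rwa [himg], by rwa [himg], hyz⟩
    · rintro ⟨e, he, hy, hz, hyz⟩
      rw [himg] at hy hz
      exact ⟨a.mapEdgeSet e, he, hy, hz, hyz⟩
  have : ∀ ω : G.Config, G.cluster Φ A ω x = G.cluster (Φ * γ) A (a.mapEdgeSet ⁻¹' ω) x := by
    intro ω
    simp only [cluster, hstep]
  simp only [this]
  rfl

/-- Every point of a cluster lies on an open edge one of whose endpoints belongs to the cluster and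
is reached through vertices. -/
theorem exists_vertex_of_mem_cluster {Φ : isomGroup n} {A : Set (HSpace n)} {ω : G.Config}
    {x : G.verts} (hx : Φ.1 x.1 ∈ A) {y : HSpace n} (hy : y ∈ G.cluster Φ A ω (Φ.1 x.1)) :
    ∃ u : G.verts, Conn ω {v | Φ.1 v.1 ∈ A} x u ∧ Φ.1 u.1 ∈ G.cluster Φ A ω (Φ.1 x.1) ∧
      (y = Φ.1 u.1 ∨ ∃ e ∈ ω, u ∈ e.1 ∧ y ∈ Φ.1 '' segOf e.1) := by
  induction hy with
  | refl => exact ⟨x, .refl, .refl, Or.inl rfl⟩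
  | @tail y z hxy hyz ih =>
    obtain ⟨e', he', ⟨y', hy', hyy'⟩, hz', hA⟩ := hyz
    obtain ⟨u, hu1, hu2, hu3⟩ := ih
    rcases hu3 with rfl | ⟨e, he, hue, y'', hy'', hyy''⟩
    · have : y' = u.1 := Φ.1.injective hyy'
      subst this
      exact ⟨u, hu1, hu2, Or.inr ⟨e', he', G.vert_mem_edge _ e'.2 u hy', hz'⟩⟩
    · have : y' = y'' := Φ.1.injective (hyy'.trans hyy''.symm)
      subst this
      -- Distinct edges meet only in vertices, so a path can change edges only at a vertex `w`; then
      -- either `w = u` or the edge just traversed joins `u` to `w`.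
      by_cases hee : e = e'
      · subst hee
        exact ⟨u, hu1, hu2, Or.inr ⟨e, he, hue, hz'⟩⟩
      · have hw : y' ∈ G.verts := G.edge_inter_edge e.1 e.2 e'.1 e'.2
          (fun h => hee (Subtype.ext h)) ⟨hy'', hy'⟩
        set w : G.verts := ⟨y', hw⟩
        have hwe := G.vert_mem_edge _ e.2 w hy''
        have hwe' := G.vert_mem_edge _ e'.2 w hy'
        have hwA : Φ.1 w.1 ∈ A := by
          change Φ.1 y' ∈ A
          rw [hyy']
          exact hA (left_mem_geodSeg _ _)
        refine ⟨w, ?_, ?_, Or.inr ⟨e', he', hwe', hz'⟩⟩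
        · by_cases huw : u = w
          · rwa [← huw]
          · have heq : e.1 = s(u, w) := (Sym2.mem_and_mem_iff huw).1 ⟨hue, hwe⟩
            exact hu1.tail ⟨Conn.mem hx hu1, hwA, e, he, heq⟩
        · change Φ.1 y' ∈ _
          rw [hyy']
          exact hxy

theorem hdist_le_of_mem_edge {e : G.graph.edgeSet} {u : G.verts} (hu : u ∈ e.1)
    {y : HSpace n} {Φ : isomGroup n} (hy : y ∈ Φ.1 '' segOf e.1) {c : ℝ}
    (hc : ∀ v w : G.verts, G.graph.Adj v w → Real.cosh (hdist v.1 w.1) ≤ c) :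
    Real.cosh (hdist (Φ.1 u.1) y) ≤ c := by
  obtain ⟨e, he⟩ := e
  obtain ⟨w, rfl⟩ := hu
  obtain ⟨z, hz, rfl⟩ := hy
  rw [segOf_mk] at hz
  have h1 : hdist u.1 z + hdist z w.1 = hdist u.1 w.1 := hz
  rw [isom_hdist]
  refine le_trans ?_ (hc u w he)
  rw [Real.cosh_le_cosh, abs_of_nonneg (hdist_nonneg _ _), abs_of_nonneg (hdist_nonneg _ _)]
  linarith [hdist_nonneg z w.1]

end EmbGraph

end GraphFacts

end HypPerc

namespace HypPerc

/-! ### Uniform decay below $p_0$. -/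

namespace EmbGraph

open Filter Topology

variable {n : ℕ} {G : EmbGraph n}

/-- Exponential decay of the clusters in the slab, uniformly in the position of the graph. -/
def UnifDecay (G : EmbGraph n) (p : I) : Prop :=
  ∃ A ψ : ℝ, 0 < A ∧ 0 < ψ ∧ ∀ (Φ : isomGroup n) (x : G.verts), height (Φ.1 x.1) ≤ 1 →
    ∀ ρ : ℝ, 0 < ρ →
      G.perc p {ω | ∃ y ∈ G.cluster Φ (slab n 1) ω (Φ.1 x.1), ρ ≤ projDist (Φ.1 x.1) y} ≤
        ENNReal.ofReal (A * Real.exp (-ψ * ρ))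

/-- A connection uses finitely many vertices. This gives measurability and lets estimates on finite
subgraphs pass to the whole slab. -/
theorem conn_exists_finset {V : Type*} {H : SimpleGraph V} {ω : Set H.edgeSet} {S : Set V}
    {a b : V} (ha : a ∈ S) (h : Conn ω S a b) :
    ∃ F : Finset V, (F : Set V) ⊆ S ∧ a ∈ F ∧ Conn ω (F : Set V) a b := by
  classical
  induction h with
  | refl => exact ⟨{a}, by simpa, by simp, .refl⟩
  | @tail b c hab hbc ih =>
    obtain ⟨F, hF, haF, h⟩ := ih
    refine ⟨insert c F, ?_, by simp [haF], ?_⟩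
    · intro v hv
      rw [Finset.coe_insert] at hv
      rcases hv with rfl | hv
      · exact hbc.2.1
      · exact hF hv
    · have hsub : (F : Set V) ⊆ (insert c F : Finset V) := by simp
      have hb : b ∈ (F : Set V) := Conn.mem (by exact_mod_cast haF) h
      exact (h.mono subset_rfl hsub).tail ⟨hsub hb, by simp, hbc.2.2⟩

theorem measurableSet_conn (hfin : G.LocFinite) (a b : G.verts) :
    MeasurableSet {ω : G.Config | Conn ω univ a b} := by
  have := countable_verts hfin
  have h : {ω : G.Config | Conn ω univ a b} =
      ⋃ F : Finset G.verts, {ω | Conn ω (F : Set G.verts) a b} := by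
    ext ω
    rw [mem_iUnion]
    constructor
    · intro h
      obtain ⟨F, -, -, hF⟩ := conn_exists_finset (mem_univ a) h
      exact ⟨F, hF⟩
    · rintro ⟨F, hF⟩
      exact Conn.mono subset_rfl (subset_univ _) hF
  rw [h]
  exact MeasurableSet.iUnion fun F => DetBy.measurableSet_inner (detBy_conn _ a b)

theorem mem_cluster_of_conn {ω : G.Config} {a b : G.verts} (h : Conn ω univ a b) :
    b.1 ∈ G.cluster 1 univ ω a.1 := by
  refine Relation.ReflTransGen.lift Subtype.val ?_ _ _ h
  rintro v w ⟨-, -, e, he, hvw⟩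
  refine ⟨e, he, ⟨v.1, ?_, rfl⟩, ⟨w.1, ?_, rfl⟩, subset_univ _⟩
  · exact mem_segOf (by simp [hvw])
  · exact mem_segOf (by simp [hvw])

/-- Far regions seen through isometries fixing the origin accumulate at a point at infinity. -/
theorem exists_klein_limit (Φ : ℕ → isomGroup n) (hΦ : ∀ k, (Φ k).1 (origin n) = origin n)
    (a : ℕ → HSpace n) (ha : ∀ k : ℕ, (k : ℝ) + 1 ≤ projDist (origin n) ((Φ k).1 (a k))) :
    ∃ κ : Amb n, ‖κ‖ = 1 ∧ ∀ j : ℕ, ∃ k : ℕ, ∀ x : HSpace n,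
      (k : ℝ) + 1 ≤ projDist (origin n) ((Φ k).1 x) → dist (klein x) κ < 1 / ((j : ℝ) + 1) := by
  have hpos : ∀ k : ℕ, (0 : ℝ) < k + 1 := fun k => by positivity
  have hnorm : ∀ k, ‖klein (a k)‖ ≤ 1 := by
    intro k
    have := norm_klein_sq (a k)
    have h3 : 0 < 1 / Real.cosh (hdist (origin n) (a k)) ^ 2 := by positivity
    nlinarith [norm_nonneg (klein (a k))]
  -- One far point per isometry suffices to find the limit, because all points seen far away by `Φ
  -- k` lie within `4 / (k + 1)` of `klein (a k)`.
  obtain ⟨κ, -, φ, hφ, hlim⟩ := (isCompact_closedBall (0 : Amb n) 1).tendsto_subseq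
    (x := fun k => klein (a k)) fun k => by simpa using hnorm k
  have hinv : Tendsto (fun k => 1 / ((φ k : ℝ) + 1)) atTop (𝓝 0) :=
    (tendsto_one_div_add_atTop_nhds_zero_nat (𝕜 := ℝ)).comp hφ.tendsto_atTop
  have hκ : ‖κ‖ = 1 := by
    have h4 : Tendsto (fun k => ‖klein (a (φ k))‖ ^ 2) atTop (𝓝 (‖κ‖ ^ 2)) := hlim.norm.pow 2
    have h5 : Tendsto (fun k => ‖klein (a (φ k))‖ ^ 2) atTop (𝓝 1) := by
      have h6 : Tendsto (fun k => 1 - 4 * (1 / ((φ k : ℝ) + 1)) ^ 2) atTop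
          (𝓝 (1 - 4 * 0 ^ 2)) := ((hinv.pow 2).const_mul 4).const_sub 1
      refine tendsto_of_tendsto_of_tendsto_of_le_of_le (by simpa using h6) tendsto_const_nhds ?_ ?_
      · intro k
        have := one_sub_norm_klein_sq_le (Φ (φ k)) (hΦ _) (hpos (φ k)) (ha (φ k))
        exact this
      · intro k
        exact pow_le_one₀ (norm_nonneg _) (hnorm (φ k))
    have h7 := tendsto_nhds_unique h4 h5
    nlinarith [norm_nonneg κ]
  refine ⟨κ, hκ, fun j => ?_⟩
  have hj : (0 : ℝ) < 1 / ((j : ℝ) + 1) := by positivity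
  have h4 : Tendsto (fun k => 4 * (1 / ((φ k : ℝ) + 1)) + dist (klein (a (φ k))) κ) atTop
      (𝓝 (4 * 0 + 0)) := (hinv.const_mul 4).add (tendsto_iff_dist_tendsto_zero.1 hlim)
  rw [mul_zero, add_zero] at h4
  obtain ⟨k, hk⟩ := (h4.eventually_lt_const hj).exists
  refine ⟨φ k, fun x hx => lt_of_le_of_lt ?_ hk⟩
  have h5 := dist_klein_le_of_far (Φ (φ k)) (hΦ _) (hpos (φ k)) hx (ha (φ k))
  rw [mul_one_div]
  exact (dist_triangle _ (klein (a (φ k))) _).trans (by gcongr)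

/-- If no point at infinity is in the boundary of the cluster of `o` with positive probability,
then the cluster of `o` is unlikely to come close to any point at infinity, uniformly. -/
theorem exists_far_small (hfin : G.LocFinite) (ho : origin n ∈ G.verts) {p : I}
    (hp : p ∈ G.nullSet) {η : ℝ≥0∞} (hη : 0 < η) :
    ∃ ρ : ℝ, 0 < ρ ∧ ∀ Φ : isomGroup n, Φ.1 (origin n) = origin n →
      G.perc p {ω | ∃ v : G.verts, Conn ω univ ⟨origin n, ho⟩ v ∧
        ρ ≤ projDist (origin n) (Φ.1 v.1)} ≤ η := by
  have := countable_verts hfin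
  set o : G.verts := ⟨origin n, ho⟩
  by_contra hcon
  push Not at hcon
  have h1 : ∀ k : ℕ, ∃ Φ : isomGroup n, Φ.1 (origin n) = origin n ∧
      η < G.perc p {ω | ∃ v : G.verts, Conn ω univ o v ∧
        (k : ℝ) + 1 ≤ projDist (origin n) (Φ.1 v.1)} :=
    fun k => hcon (k + 1) (by positivity)
  choose Φ hΦ hbig using h1
  have h2 : ∀ k : ℕ, ∃ v : G.verts, (k : ℝ) + 1 ≤ projDist (origin n) ((Φ k).1 v.1) := by
    intro k
    by_contra hno
    push Not at hno
    have : {ω : G.Config | ∃ v : G.verts, Conn ω univ o v ∧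
        (k : ℝ) + 1 ≤ projDist (origin n) ((Φ k).1 v.1)} = ∅ := by
      rw [eq_empty_iff_forall_notMem]
      rintro ω ⟨v, -, hv⟩
      exact absurd hv (not_le.2 (hno v))
    have h3 := hbig k
    rw [this, measure_empty] at h3
    exact not_lt_zero h3
  choose a ha using h2
  obtain ⟨κ, hκ, hlim⟩ := exists_klein_limit Φ hΦ (fun k => (a k).1) ha
  -- These events decrease and each has probability at least `η`, whereas on their intersection the
  -- ideal point of `κ` lies in $\partial C(o)$, a null event.
  let E : ℕ → Set G.Config := fun j =>
    {ω | ∃ v : G.verts, Conn ω univ o v ∧ dist (klein v.1) κ < 1 / ((j : ℝ) + 1)}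
  have hE : ∀ j, η ≤ G.perc p (E j) := by
    intro j
    obtain ⟨k, hk⟩ := hlim j
    refine (hbig k).le.trans (measure_mono ?_)
    rintro ω ⟨v, hv, hfar⟩
    exact ⟨v, hv, hk _ hfar⟩
  have hEm : ∀ j, MeasurableSet (E j) := by
    intro j
    have : E j = ⋃ v : G.verts, ⋃ _ : dist (klein v.1) κ < 1 / ((j : ℝ) + 1),
        {ω : G.Config | Conn ω univ o v} := by
      ext ω
      simp only [E, mem_ofPred_eq, mem_iUnion, exists_prop]
      exact exists_congr fun v => and_comm
    rw [this]
    exact MeasurableSet.iUnion fun v => MeasurableSet.iUnion fun _ => measurableSet_conn hfin o v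
  have hanti : Antitone E := by
    rintro i j hij ω ⟨v, hv, hd⟩
    refine ⟨v, hv, hd.trans_le ?_⟩
    gcongr
  have h8 := tendsto_measure_iInter_atTop (μ := G.perc p)
    (fun j => (hEm j).nullMeasurableSet) hanti ⟨0, measure_ne_top _ _⟩
  have h9 : G.perc p (⋂ j, E j) = 0 := by
    refine measure_mono_null ?_ (hp (idealPoint κ) (idealPoint_mem κ))
    intro ω hω
    refine idealPoint_mem_bdAtInfinity hκ fun k => ?_
    obtain ⟨v, hv, hd⟩ := mem_iInter.1 hω k
    exact ⟨v.1, mem_cluster_of_conn hv, hd⟩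
  rw [h9] at h8
  exact absurd (ge_of_tendsto' h8 hE) (not_le.2 hη)

/-- The similarity moving a given point to the origin. -/
theorem exists_simil_origin (x : HSpace n) : ∃ b : Fin n → ℝ,
    (simil (height x)⁻¹ (inv_pos.2 (height_pos x)) b).1 x = origin n := by
  refine ⟨fun i => -((height x)⁻¹ * lat x i), HSpace.ext' (fun i => ?_) ?_⟩
  · simp
  · simp [(height_pos x).ne']

/-- An automorphism takes `o` to `x`, and a similarity takes $\Phi(x)$ back to the origin. Since the
height of $\Phi(x)$ is at most $1$, the similarity does not shrink horizontal distances, and the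
case of isometries fixing the origin applies. -/
theorem perc_conn_far_le (hfin : G.LocFinite) (htrans : G.TransUnderIsom)
    (ho : origin n ∈ G.verts) {p : I} (hp : p ∈ G.nullSet) {η : ℝ≥0∞} (hη : 0 < η) :
    ∃ ρ : ℝ, 0 < ρ ∧ ∀ (Φ : isomGroup n) (x : G.verts), height (Φ.1 x.1) ≤ 1 →
      G.perc p {ω | ∃ v : G.verts, Conn ω univ x v ∧ ρ ≤ projDist (Φ.1 x.1) (Φ.1 v.1)} ≤ η := by
  obtain ⟨ρ, hρ, hsmall⟩ := exists_far_small hfin ho hp hη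
  refine ⟨ρ, hρ, fun Φ x hx => ?_⟩
  set o : G.verts := ⟨origin n, ho⟩
  obtain ⟨γ, a, ha, hao⟩ := exists_isom_aut htrans o x
  obtain ⟨b, hb⟩ := exists_simil_origin (Φ.1 x.1)
  have hh := height_pos (Φ.1 x.1)
  set Ψ := simil (height (Φ.1 x.1))⁻¹ (inv_pos.2 hh) b
  have hγo : γ.1 (origin n) = x.1 := by
    rw [← hao, ha]
  have hfix : (Ψ * Φ * γ).1 (origin n) = origin n := by
    change Ψ.1 (Φ.1 (γ.1 (origin n))) = _
    rw [hγo]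
    exact hb
  refine le_trans ?_ (hsmall (Ψ * Φ * γ) hfix)
  rw [perc_eq_bern, ← bern_preimage_equiv p a.mapEdgeSet {ω | ∃ v : G.verts, Conn ω univ o v ∧
    ρ ≤ projDist (origin n) ((Ψ * Φ * γ).1 v.1)}]
  refine measure_mono ?_
  rintro ω ⟨v, hv, hfar⟩
  refine ⟨a.symm v, ?_, ?_⟩
  · have h1 : o = a.symm x := by rw [← hao, a.symm_apply_apply]
    rw [h1]
    refine Relation.ReflTransGen.lift a.symm ?_ _ _ hv
    rintro u w ⟨-, -, e, he, huw⟩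
    obtain ⟨e', rfl⟩ := a.mapEdgeSet.surjective e
    refine ⟨mem_univ _, mem_univ _, e', he, ?_⟩
    obtain ⟨e', he'⟩ := e'
    induction e' using Sym2.ind with
    | _ s t =>
      have h2 : s(a s, a t) = s(u, w) := huw
      rw [Sym2.eq_iff] at h2
      rcases h2 with ⟨rfl, rfl⟩ | ⟨rfl, rfl⟩
      · simp
      · simp [Sym2.eq_swap]
  · have h3 : (Ψ * Φ * γ).1 (a.symm v).1 = Ψ.1 (Φ.1 v.1) := by
      change Ψ.1 (Φ.1 (γ.1 (a.symm v).1)) = _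
      rw [← ha, a.apply_symm_apply]
    have h4 : projDist (origin n) ((Ψ * Φ * γ).1 (a.symm v).1) =
        (height (Φ.1 x.1))⁻¹ * projDist (Φ.1 x.1) (Φ.1 v.1) := by
      rw [h3, ← projDist_simil _ (inv_pos.2 hh) b]
      rw [hb]
    rw [h4]
    have h5 : 1 ≤ (height (Φ.1 x.1))⁻¹ := (one_le_inv₀ hh).2 hx
    nlinarith [projDist_nonneg (Φ.1 x.1) (Φ.1 v.1)]

/-- Exponential decay in the finite subgraphs of the slab. -/
theorem exists_joined_le_pow (hfin : G.LocFinite) (htrans : G.TransUnderIsom)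
    (ho : origin n ∈ G.verts) {p p' : I} (hpp : p < p') (hp' : p' ∈ G.nullSet) :
    ∃ D : ℝ, 0 < D ∧ ∀ (k : ℕ) (Φ : isomGroup n) (F : Finset G.verts),
      (∀ v ∈ F, height (Φ.1 v.1) ≤ 1) → ∀ x ∈ F,
      (G.perc p).real {ω | Joined ω (F : Set G.verts)
        {v | k * D ≤ projDist (Φ.1 x.1) (Φ.1 v.1)} x} ≤ (1 / 2) ^ k := by
  have hexp : 0 < 1 - Real.exp (-(1 / 2) * ((p' : ℝ) - p)) := by
    have : (0 : ℝ) < p' - p := sub_pos.2 hpp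
    have : Real.exp (-(1 / 2) * ((p' : ℝ) - p)) < 1 := Real.exp_lt_one_iff.2 (by linarith)
    linarith
  obtain ⟨c, hc1, hc⟩ := exists_cosh_edge_le hfin htrans ho
  obtain ⟨ρ₀, hρ₀, hsmall⟩ := perc_conn_far_le hfin htrans ho hp'
    -- Half the lower bound of `joined_real_ge` for $\kappa=1/2$, so that the two contradict each
    -- other strictly.
    (η := ENNReal.ofReal ((1 - Real.exp (-(1 / 2) * ((p' : ℝ) - p))) / 2))
    (by rw [ENNReal.ofReal_pos]; linarith)
  -- `S` will have horizontal radius less than `ρ₀` about `x`, and an edge leaving it inside the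
  -- slab adds at most `2 * c`. Thus a path that must go `(k + 1) * D` from `x` still has `k * D` to
  -- go after leaving `S`.
  refine ⟨ρ₀ + 2 * c, by linarith, fun k => ?_⟩
  set D := ρ₀ + 2 * c
  induction k with
  | zero =>
    intro Φ F hF x hx
    simp
  | succ k ih =>
    intro Φ F hF x hx
    set T₀ : Set G.verts := {v | ρ₀ ≤ projDist (Φ.1 x.1) (Φ.1 v.1)}
    set T : Set G.verts := {v | ((k + 1 : ℕ) : ℝ) * D ≤ projDist (Φ.1 x.1) (Φ.1 v.1)}
    have hTT : T ⊆ T₀ := by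
      intro v hv
      change ρ₀ ≤ _
      refine le_trans ?_ (show ((k + 1 : ℕ) : ℝ) * D ≤ _ from hv)
      have : (0 : ℝ) ≤ k * D := by positivity
      push_cast
      linarith
    have hlt : (bern G.graph.edgeSet p').real {ω | Joined ω (F : Set G.verts) T₀ x} <
        1 - Real.exp (-(1 / 2) * ((p' : ℝ) - p)) := by
      have h1 : G.perc p' {ω | Joined ω (F : Set G.verts) T₀ x} ≤
          ENNReal.ofReal ((1 - Real.exp (-(1 / 2) * ((p' : ℝ) - p))) / 2) := by
        refine le_trans (measure_mono ?_) (hsmall Φ x (hF x hx))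
        rintro ω ⟨v, hv, h⟩
        exact ⟨v, Conn.mono subset_rfl (subset_univ _) h, hv⟩
      have h2 : (bern G.graph.edgeSet p').real {ω | Joined ω (F : Set G.verts) T₀ x} ≤
          (1 - Real.exp (-(1 / 2) * ((p' : ℝ) - p))) / 2 :=
        ENNReal.toReal_le_of_le_ofReal (by linarith) h1
      linarith
    obtain ⟨S, hSF, hxS, hST, hsum⟩ : ∃ S ⊆ F, x ∈ S ∧ Disjoint (S : Set G.verts) T₀ ∧
        ∑ e ∈ innerFinset G.graph F,
          (bern G.graph.edgeSet p).real (exitEvent (S : Set G.verts) x e) < 1 / 2 := by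
      by_contra hcon
      push Not at hcon
      exact absurd (joined_real_ge F T₀ hx hpp.le hcon) (not_le.2 hlt)
    have hM : ∀ y ∈ S, ∀ z ∈ F, G.graph.Adj y z →
        (bern G.graph.edgeSet p).real {ω | Joined ω (F : Set G.verts) T z} ≤ (1 / 2) ^ k := by
      intro y hy z hz hyz
      refine le_trans (measureReal_mono ?_) (ih Φ F hF z hz)
      rintro ω ⟨v, hv, h⟩
      refine ⟨v, ?_, h⟩
      change (k : ℝ) * D ≤ _
      have h1 : projDist (Φ.1 x.1) (Φ.1 y.1) < ρ₀ :=
        not_le.1 fun h => Set.disjoint_left.1 hST (Finset.mem_coe.2 hy) h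
      have h2 : projDist (Φ.1 y.1) (Φ.1 z.1) ≤ 2 * c := by
        have h3 := projDist_le_mul (Φ.1 y.1) (Φ.1 z.1)
        rw [isom_hdist] at h3
        have h4 := hc y z hyz
        have h5 := hF y (hSF hy)
        have h6 := height_pos (Φ.1 y.1)
        have h7 := Real.one_le_cosh (hdist y.1 z.1)
        nlinarith
      have h3 : ((k + 1 : ℕ) : ℝ) * D ≤ projDist (Φ.1 x.1) (Φ.1 v.1) := hv
      push_cast at h3
      have h4 := projDist_triangle (Φ.1 x.1) (Φ.1 y.1) (Φ.1 v.1)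
      have h5 := projDist_triangle (Φ.1 y.1) (Φ.1 z.1) (Φ.1 v.1)
      linarith
    have hfinal := joined_real_le F T hSF hxS (hST.mono_right hTT) p hM
    refine hfinal.trans ?_
    rw [pow_succ']
    gcongr

theorem unifDecay_of_nullSet (hfin : G.LocFinite) (htrans : G.TransUnderIsom)
    (ho : origin n ∈ G.verts) {p p' : I} (hpp : p < p') (hp' : p' ∈ G.nullSet) :
    G.UnifDecay p := by
  have := countable_verts hfin
  obtain ⟨c, hc1, hc⟩ := exists_cosh_edge_le hfin htrans ho
  obtain ⟨D, hD, hpow⟩ := exists_joined_le_pow hfin htrans ho hpp hp'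
  -- The factor `2` pays for the rounding in `k`, the exponential for the distance `2 * c` from a
  -- cluster point to a vertex.
  refine ⟨2 * Real.exp (Real.log 2 * (2 * c) / D), Real.log 2 / D, by positivity,
    div_pos (Real.log_pos one_lt_two) hD, fun Φ x hx ρ hρ => ?_⟩
  set k := ⌊(ρ - 2 * c) / D⌋₊ with hk
  set U : Set G.verts := {v | Φ.1 v.1 ∈ slab n 1}
  have hinf : G.perc p {ω | ∃ u : G.verts, Conn ω U x u ∧
      k * D ≤ projDist (Φ.1 x.1) (Φ.1 u.1)} ≤ ENNReal.ofReal ((1 / 2) ^ k) := by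
    let ι := {F : Finset G.verts // (F : Set G.verts) ⊆ U ∧ x ∈ F}
    have h1 : {ω | ∃ u : G.verts, Conn ω U x u ∧ k * D ≤ projDist (Φ.1 x.1) (Φ.1 u.1)} =
        ⋃ F : ι, {ω : G.Config | Joined ω (F.1 : Set G.verts)
          {v | k * D ≤ projDist (Φ.1 x.1) (Φ.1 v.1)} x} := by
      ext ω
      rw [mem_iUnion]
      constructor
      · rintro ⟨u, hu, hd⟩
        obtain ⟨F, hF, hxF, h⟩ := conn_exists_finset (show x ∈ U from hx) hu
        exact ⟨⟨F, hF, hxF⟩, u, hd, h⟩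
      · rintro ⟨F, u, hd, h⟩
        exact ⟨u, Conn.mono subset_rfl F.2.1 h, hd⟩
    classical
    rw [h1, Directed.measure_iUnion]
    · refine iSup_le fun F => ?_
      rw [← ofReal_measureReal]
      exact ENNReal.ofReal_le_ofReal (hpow k Φ F.1 (fun v hv => F.2.1 hv) x F.2.2)
    · intro F F'
      refine ⟨⟨F.1 ∪ F'.1, ?_, Finset.mem_union_left _ F.2.2⟩, ?_, ?_⟩
      · rw [Finset.coe_union]
        exact union_subset F.2.1 F'.2.1
      · intro ω h
        exact Joined.mono subset_rfl (by simp) h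
      · intro ω h
        exact Joined.mono subset_rfl (by simp) h
  have hle : G.perc p {ω | ∃ y ∈ G.cluster Φ (slab n 1) ω (Φ.1 x.1), ρ ≤ projDist (Φ.1 x.1) y} ≤
      ENNReal.ofReal ((1 / 2) ^ k) := by
    -- This includes $\rho<2c$, where the natural-number floor is $0$; the bound is then $1$.
    by_cases hk0 : k = 0
    · rw [hk0, pow_zero, ENNReal.ofReal_one]
      exact prob_le_one
    refine le_trans (measure_mono ?_) hinf
    rintro ω ⟨y, hy, hρy⟩
    obtain ⟨u, hu, -, hyu⟩ := exists_vertex_of_mem_cluster (x := x) hx hy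
    refine ⟨u, hu, ?_⟩
    have h1 : (k : ℝ) ≤ (ρ - 2 * c) / D := by
      refine Nat.floor_le ?_
      by_contra hneg
      exact hk0 (Nat.floor_of_nonpos (not_le.1 hneg).le)
    rw [le_div_iff₀ hD] at h1
    have h2 : projDist (Φ.1 u.1) y ≤ 2 * c := by
      have hhu : height (Φ.1 u.1) ≤ 1 := Conn.mem (S := U) hx hu
      rcases hyu with rfl | ⟨e, -, hue, hye⟩
      · rw [projDist_self]; linarith
      · have h3 := projDist_le_mul (Φ.1 u.1) y
        have h4 := hdist_le_of_mem_edge hue hye hc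
        have h6 := height_pos (Φ.1 u.1)
        have h7 := Real.one_le_cosh (hdist (Φ.1 u.1) y)
        nlinarith
    have h3 := projDist_triangle (Φ.1 x.1) (Φ.1 u.1) y
    linarith
  refine hle.trans (ENNReal.ofReal_le_ofReal ?_)
  have h1 : (ρ - 2 * c) / D < k + 1 := Nat.lt_floor_add_one _
  have h2 : ((1 : ℝ) / 2) ^ k = 2 * Real.exp (-Real.log 2 * (k + 1)) := by
    rw [show -Real.log 2 * ((k : ℝ) + 1) = -(((k + 1 : ℕ) : ℝ) * Real.log 2) by push_cast; ring,
      Real.exp_neg, Real.exp_nat_mul, Real.exp_log two_pos]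
    rw [pow_succ, one_div, inv_pow]
    field_simp
  rw [h2, mul_assoc, ← Real.exp_add]
  have h3 : Real.log 2 * ((ρ - 2 * c) / D) ≤ Real.log 2 * (k + 1) :=
    mul_le_mul_of_nonneg_left h1.le (Real.log_pos one_lt_two).le
  have h4 : Real.log 2 * (2 * c) / D + -(Real.log 2 / D) * ρ =
      -(Real.log 2 * ((ρ - 2 * c) / D)) := by
    field_simp
    ring
  rw [h4]
  gcongr
  linarith

theorem unifDecay_of_lt_p0 (hfin : G.LocFinite) (htrans : G.TransUnderIsom)
    (ho : origin n ∈ G.verts) {p : I} (hp : (p : ℝ) < G.p0) : G.UnifDecay p := by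
  -- The real supremum of the empty set is $0\le p$, so $p<p_0$ forces `nullSet` to be nonempty.
  have hne : ((fun p : I => (p : ℝ)) '' G.nullSet).Nonempty := by
    by_contra hempty
    rw [not_nonempty_iff_eq_empty] at hempty
    rw [p0, hempty, Real.sSup_empty] at hp
    exact absurd p.2.1 (not_le.2 hp)
  obtain ⟨_, ⟨p', hp', rfl⟩, hlt⟩ := exists_lt_of_lt_csSup hne hp
  exact unifDecay_of_nullSet hfin htrans ho hlt hp'

end EmbGraph

end HypPerc

namespace HypPerc

/-! ### Uniform decay from decay of $g_p$. -/

namespace EmbGraph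

variable {n : ℕ} {G : EmbGraph n}

theorem geodSeg_subset_image_segOf {Φ : isomGroup n} {e : G.graph.edgeSet} {x y : HSpace n}
    (hx : x ∈ Φ.1 '' segOf e.1) (hy : y ∈ Φ.1 '' segOf e.1) :
    geodSeg x y ⊆ Φ.1 '' segOf e.1 := by
  obtain ⟨e, he⟩ := e
  induction e using Sym2.ind with
  | _ v w =>
    simp only [segOf_mk, image_geodSeg] at hx hy ⊢
    exact geodSeg_subset hx hy

/-- The points of the piece of an open edge traversed by a step inside `A`. -/
theorem OpenStep.of_mem_geodSeg {Φ : isomGroup n} {A : Set (HSpace n)} {ω : G.Config}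
    {x y z : HSpace n} (h : G.OpenStep Φ A ω x y) (hz : z ∈ geodSeg x y) :
    G.OpenStep Φ A ω x z := by
  obtain ⟨e, he, hx, hy, hA⟩ := h
  exact ⟨e, he, hx, geodSeg_subset_image_segOf hx hy hz,
    (geodSeg_subset (left_mem_geodSeg x y) hz).trans hA⟩

theorem inter_frontier_nonempty {X : Type*} [TopologicalSpace X] {s B : Set X}
    (hs : IsPreconnected s) (h1 : (s ∩ B).Nonempty) (h2 : (s ∩ Bᶜ).Nonempty) :
    (s ∩ frontier B).Nonempty := by
  by_contra hcon
  rw [not_nonempty_iff_eq_empty] at hcon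
  have hnot : ∀ x ∈ s, x ∉ frontier B := fun x hx hf => by
    have : x ∈ s ∩ frontier B := ⟨hx, hf⟩
    rw [hcon] at this
    exact this
  have hint : ∀ x ∈ s, x ∈ closure B → x ∈ interior B := fun x hx hc => by
    by_contra hi
    exact hnot x hx ⟨hc, hi⟩
  obtain ⟨x, hx, hxB⟩ := h1
  obtain ⟨y, hy, hyB⟩ := h2
  obtain ⟨z, hz, hz1, hz2⟩ := hs (interior B) (closure B)ᶜ isOpen_interior
    isClosed_closure.isOpen_compl
    (fun z hz => (em (z ∈ closure B)).imp (hint z hz) id)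
    ⟨x, hx, hint x hx (subset_closure hxB)⟩
    ⟨y, hy, fun hc => hyB (interior_subset (hint y hy hc))⟩
  exact hz2 (interior_subset_closure hz1)

/-- Each step traverses a connected segment that stays in the cluster, so the step leaving `B`
crosses its frontier. -/
theorem cluster_inter_frontier_nonempty {Φ : isomGroup n} {A B : Set (HSpace n)} {ω : G.Config}
    {x y : HSpace n} (hx : x ∈ B) (hy : y ∈ G.cluster Φ A ω x) (hyB : y ∉ B) :
    (G.cluster Φ A ω x ∩ frontier B).Nonempty := by
  have key : (G.cluster Φ A ω x ∩ frontier B).Nonempty ∨ y ∈ B := by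
    induction hy with
    | refl => exact Or.inr hx
    | @tail y z hxy hyz ih =>
      by_cases hyB' : y ∈ B
      · by_cases hzB : z ∈ B
        · exact Or.inr hzB
        · obtain ⟨w, hw, hwB⟩ := inter_frontier_nonempty (isPreconnected_geodSeg y z)
            ⟨y, left_mem_geodSeg y z, hyB'⟩ ⟨z, right_mem_geodSeg y z, hzB⟩
          exact Or.inl ⟨w, hxy.tail (hyz.of_mem_geodSeg hw), hwB⟩
      · exact Or.inl ((ih hyB').resolve_right hyB')
  exact key.resolve_right hyB

theorem unifDecay_of_expDecay (htrans : G.TransUnderIsom) (ho : origin n ∈ G.verts) {p : I}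
    (hp : G.ExpDecay p) : G.UnifDecay p := by
  obtain ⟨ψ, hψ, hdecay⟩ := hp
  -- The sphere of radius `ρ / 2` is used because a point at distance at least `ρ` lies strictly
  -- outside its ball; this halves the rate.
  refine ⟨1, ψ / 2, one_pos, by positivity, fun Φ x hx ρ hρ => ?_⟩
  obtain ⟨γ, a, ha, hao⟩ := exists_isom_aut htrans ⟨origin n, ho⟩ x
  have hγo : γ.1 (origin n) = x.1 := by
    rw [← hao, ha]
  have hh := height_pos (Φ.1 x.1)
  set h := height (Φ.1 x.1)
  set b : Fin n → ℝ := fun i => -lat (Φ.1 x.1) i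
  set Ψ := simil 1 one_pos b
  have hΨx : Ψ.1 (Φ.1 x.1) = axisPoint n h hh :=
    HSpace.ext' (fun i => by simp [Ψ, b]) (by simp [Ψ, h])
  have hΨo : (Ψ * (Φ * γ)).1 (origin n) = axisPoint n h hh := by
    change Ψ.1 (Φ.1 (γ.1 (origin n))) = _
    rw [hγo, hΨx]
  obtain ⟨R, hR⟩ := exists_isPhi (Ψ * (Φ * γ)) h hh hΨo
  have haxis : ∀ z, projDist (origin n) z = projDist (axisPoint n h hh) z := by
    intro z
    rw [projDist_eq, projDist_eq]
    simp
  rw [one_mul, show -(ψ / 2) * ρ = -ψ * (ρ / 2) by ring]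
  refine le_trans ?_ (hdecay (ρ / 2) (by linarith))
  have hsup : G.perc p {ω | (G.cluster (Ψ * (Φ * γ)) (slab n 1) ω ((Ψ * (Φ * γ)).1 (origin n)) ∩
      projSphere (ρ / 2) (origin n)).Nonempty} ≤ G.g p (ρ / 2) :=
    le_iSup_of_le h <| le_iSup_of_le hh <| le_iSup_of_le hx <| le_iSup_of_le R <|
      le_iSup_of_le (Ψ * (Φ * γ)) <| le_iSup_of_le hR le_rfl
  refine le_trans ?_ hsup
  have haut := perc_cluster_aut ha p Φ (slab n 1) (Φ.1 x.1)
    {C | ∃ y ∈ C, ρ ≤ projDist (Φ.1 x.1) y}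
  refine le_trans (le_of_eq haut) (measure_mono ?_)
  rintro ω ⟨y, hy, hρy⟩
  have hslab : Ψ.1 '' slab n 1 ⊆ slab n 1 := by
    rintro _ ⟨z, hz, rfl⟩
    change height _ ≤ 1
    rw [height_simil, one_mul]
    exact hz
  have hy' := mem_cluster_mul Ψ (Φ * γ) hslab hy
  rw [hΨx] at hy'
  change (G.cluster (Ψ * (Φ * γ)) (slab n 1) ω ((Ψ * (Φ * γ)).1 (origin n)) ∩
      projSphere (ρ / 2) (origin n)).Nonempty
  rw [hΨo]
  refine cluster_inter_frontier_nonempty ?_ hy' ?_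
  · change projDist _ _ ≤ _
    rw [haxis, projDist_self]
    linarith
  · change ¬ (projDist _ _ ≤ _)
    rw [haxis, ← hΨx, projDist_simil, one_mul]
    linarith

end EmbGraph

end HypPerc

/-! ### From one vertex to all vertices over a ball: summation over dyadic scales. -/

namespace HypPerc

theorem tsum_pi_prod_eq_pow (f : ℤ → ℝ≥0∞) (n : ℕ) :
    ∑' j : Fin n → ℤ, ∏ i, f (j i) = (∑' m, f m) ^ n := by
  induction n with
  | zero => simp [tsum_fintype]
  | succ n ih =>
    rw [← (Fin.consEquiv fun _ : Fin (n + 1) => ℤ).tsum_eq, ENNReal.tsum_prod', pow_succ', ← ih,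
      ← ENNReal.tsum_mul_right]
    refine tsum_congr fun m => ?_
    rw [← ENNReal.tsum_mul_left]
    refine tsum_congr fun j => ?_
    simp [Fin.prod_univ_succ, Fin.consEquiv]

theorem tsum_exp_abs_ne_top {θ : ℝ} (hθ : 0 < θ) :
    ∑' m : ℤ, ENNReal.ofReal (Real.exp (-θ * |(m : ℝ)|)) ≠ ⊤ := by
  have hnat : Summable fun k : ℕ => Real.exp (-θ * k) := by
    have h1 : Summable fun k : ℕ => Real.exp (-θ) ^ k :=
      summable_geometric_of_lt_one (Real.exp_pos _).le (Real.exp_lt_one_iff.2 (by linarith))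
    refine h1.congr fun k => ?_
    rw [← Real.exp_nat_mul, mul_comm]
  have h : Summable fun m : ℤ => Real.exp (-θ * |(m : ℝ)|) := by
    refine Summable.of_nat_of_neg ?_ ?_
    · simpa using hnat
    · simpa using hnat
  exact h.tsum_ofReal_ne_top

namespace EmbGraph

variable {n : ℕ} {G : EmbGraph n}

/-- The event that the cluster of `Φ(w)` in the slab of height `s` reaches distance `ℓ`. -/
def reachEvent (G : EmbGraph n) (Φ : isomGroup n) (s : ℝ) (w : G.verts) (ℓ : ℝ) : Set G.Config :=
  {ω | ∃ y ∈ G.cluster Φ (slab n s) ω (Φ.1 w.1), ℓ ≤ projDist (Φ.1 w.1) y}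

/-- Scaling by $1/s$ carries the slab of height $s$ to $L$ and multiplies horizontal distances by
$1/s$. -/
theorem UnifDecay.reachEvent_le {p : I} (h : G.UnifDecay p) :
    ∃ A ψ : ℝ, 0 < A ∧ 0 < ψ ∧ ∀ (Φ : isomGroup n) (s : ℝ) (w : G.verts) (ℓ : ℝ), 0 < s →
      height (Φ.1 w.1) ≤ s →
      G.perc p (G.reachEvent Φ s w ℓ) ≤ ENNReal.ofReal (A * Real.exp (-ψ * (ℓ / s))) := by
  obtain ⟨A, ψ, hA, hψ, hdec⟩ := h
  -- A constant of at least `1` makes the bound trivial for `ℓ ≤ 0`.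
  refine ⟨max A 1, ψ, by positivity, hψ, fun Φ s w ℓ hs hw => ?_⟩
  rcases le_or_gt ℓ 0 with hℓ | hℓ
  · refine prob_le_one.trans ?_
    rw [← ENNReal.ofReal_one]
    refine ENNReal.ofReal_le_ofReal ?_
    have h1 : 0 ≤ -ψ * (ℓ / s) :=
      mul_nonneg_of_nonpos_of_nonpos (by linarith) (div_nonpos_of_nonpos_of_nonneg hℓ hs.le)
    have h2 := Real.one_le_exp h1
    have h3 := le_max_right A 1
    nlinarith
  · set Ψ := simil (n := n) s⁻¹ (inv_pos.2 hs) 0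
    have h1 : height ((Ψ * Φ).1 w.1) ≤ 1 := by
      change height (Ψ.1 (Φ.1 w.1)) ≤ 1
      rw [height_simil, inv_mul_le_iff₀ hs]
      linarith
    refine le_trans (measure_mono ?_) ((hdec (Ψ * Φ) w h1 (ℓ / s) (by positivity)).trans ?_)
    · rintro ω ⟨y, hy, hd⟩
      refine ⟨Ψ.1 y, mem_cluster_mul Ψ Φ ?_ hy, ?_⟩
      · rintro _ ⟨z, hz, rfl⟩
        have hz' : height z ≤ s := hz
        change height _ ≤ 1
        rw [height_simil, inv_mul_le_iff₀ hs]
        linarith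
      · change ℓ / s ≤ projDist (Ψ.1 (Φ.1 w.1)) (Ψ.1 y)
        rw [projDist_simil, div_eq_inv_mul]
        gcongr
    · gcongr
      exact le_max_left _ _

/-- The vertices in the layer `(s/(4c), s]` over a cube of side `s`. -/
def boxVerts (G : EmbGraph n) (Φ : isomGroup n) (c s : ℝ) (j : Fin n → ℤ) : Set G.verts :=
  {w | height (Φ.1 w.1) ≤ s ∧ s ≤ 4 * c * height (Φ.1 w.1) ∧
    ∀ i, ⌊lat (Φ.1 w.1) i / s⌋ = j i}

/-- Up to scaling, all these boxes lie in a region of bounded hyperbolic diameter. For heights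
$a,b\ge s/(4c)$, $\cosh$ of the distance is at most $1+(n+1)s^2/(2ab)\le 1+8c^2(n+1)$. -/
theorem exists_encard_boxVerts_le (hfin : G.LocFinite) (htrans : G.TransUnderIsom)
    (ho : origin n ∈ G.verts) {c : ℝ} (hc : 1 ≤ c) :
    ∃ M : ℕ, ∀ (Φ : isomGroup n) (s : ℝ) (j : Fin n → ℤ), 0 < s →
      (G.boxVerts Φ c s j).encard ≤ M := by
  obtain ⟨M, hM⟩ := exists_card_ball_le hfin htrans ho (1 + 8 * c ^ 2 * (n + 1))
  refine ⟨M, fun Φ s j hs => ?_⟩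
  rcases (G.boxVerts Φ c s j).eq_empty_or_nonempty with h | ⟨v, hv⟩
  · simp [h]
  refine (Set.encard_le_encard ?_).trans (hM v)
  intro w hw
  change Real.cosh (hdist v.1 w.1) ≤ _
  rw [← isom_hdist Φ, cosh_hdist, dist_sq]
  obtain ⟨hv1, hv2, hv3⟩ := hv
  obtain ⟨hw1, hw2, hw3⟩ := hw
  have hvp := height_pos (Φ.1 v.1)
  have hwp := height_pos (Φ.1 w.1)
  set a := height (Φ.1 v.1)
  set b := height (Φ.1 w.1)
  have h1 : ∀ i, (lat (Φ.1 v.1) i - lat (Φ.1 w.1) i) ^ 2 ≤ s ^ 2 := by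
    intro i
    have h2 := Int.abs_sub_lt_one_of_floor_eq_floor ((hv3 i).trans (hw3 i).symm)
    rw [← sub_div, abs_div, abs_of_pos hs, div_lt_one hs] at h2
    exact sq_le_sq' (abs_lt.1 h2).1.le (abs_lt.1 h2).2.le
  have h2 : ∑ i, (lat (Φ.1 v.1) i - lat (Φ.1 w.1) i) ^ 2 ≤ n * s ^ 2 := by
    refine (Finset.sum_le_sum fun i _ => h1 i).trans ?_
    simp
  have h3 : (a - b) ^ 2 ≤ s ^ 2 := sq_le_sq' (by linarith) (by linarith)
  gcongr
  rw [div_le_iff₀ (by positivity)]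
  have h4 : s ^ 2 ≤ (4 * c * a) * (4 * c * b) := by
    rw [sq]
    exact mul_le_mul hv2 hw2 hs.le (by positivity)
  have h5 : (0 : ℝ) ≤ n + 1 := by positivity
  nlinarith

/-- Decomposition of a path according to the highest dyadic layer it visits. -/
theorem exists_high_vertex {c : ℝ} (hc1 : 1 ≤ c)
    (hc : ∀ v w : G.verts, G.graph.Adj v w → Real.cosh (hdist v.1 w.1) ≤ c)
    {Φ : isomGroup n} {ω : G.Config} {v : G.verts} {y : HSpace n} (hne : y ≠ Φ.1 v.1)
    (hy : y ∈ G.cluster Φ (slab n 1) ω (Φ.1 v.1)) :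
    ∃ (k : ℕ) (w : G.verts), height (Φ.1 w.1) ≤ (1 / 2) ^ k ∧
      (1 / 2) ^ k ≤ 4 * c * height (Φ.1 w.1) ∧
      Φ.1 v.1 ∈ G.cluster Φ (slab n ((1 / 2) ^ k)) ω (Φ.1 w.1) ∧
      y ∈ G.cluster Φ (slab n ((1 / 2) ^ k)) ω (Φ.1 w.1) := by
  classical
  -- A cluster contains its base point even when that point is outside the slab, so `y ≠ Φ.1 v.1` is
  -- needed here.
  have hv : ∀ s : ℝ, y ∈ G.cluster Φ (slab n s) ω (Φ.1 v.1) → height (Φ.1 v.1) ≤ s := by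
    intro s h
    rcases Relation.ReflTransGen.cases_head h with h | ⟨z, ⟨e, -, -, -, hA⟩, -⟩
    · exact absurd h.symm hne
    · exact hA (left_mem_geodSeg _ _)
  have hex : ∃ k : ℕ, y ∉ G.cluster Φ (slab n ((1 / 2) ^ k)) ω (Φ.1 v.1) := by
    obtain ⟨k, hk⟩ := exists_pow_lt_of_lt_one (height_pos (Φ.1 v.1))
      (show (1 / 2 : ℝ) < 1 by norm_num)
    exact ⟨k, fun h => absurd (hv _ h) (not_le.2 hk)⟩
  have hspec := Nat.find_spec hex
  have hmin := fun m => Nat.find_min hex (m := m)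
  obtain ⟨k, hk⟩ : ∃ k, Nat.find hex = k + 1 := by
    refine Nat.exists_eq_succ_of_ne_zero fun h0 => ?_
    rw [h0, pow_zero] at hspec
    exact hspec hy
  rw [hk] at hspec hmin
  have hyk := not_not.1 (hmin k (Nat.lt_succ_self k))
  set s : ℝ := (1 / 2) ^ k with hs
  have hspos : 0 < s := by positivity
  rw [pow_succ] at hspec
  have hvs := hv s hyk
  -- If the path does not stay below `s / 2`, some point `q` on it is higher. A cluster vertex on
  -- the edge of `q` has height at least `height q / (2 * c)`, whence the factor `4 * c`.
  have key : y ∈ G.cluster Φ (slab n (s * (1 / 2))) ω (Φ.1 v.1) ∨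
      ∃ w : G.verts, height (Φ.1 w.1) ≤ s ∧ s ≤ 4 * c * height (Φ.1 w.1) ∧
        Φ.1 w.1 ∈ G.cluster Φ (slab n s) ω (Φ.1 v.1) := by
    have hyk' := hyk
    clear hspec hmin hk hex hyk hv hne hy
    induction hyk' with
    | refl => exact Or.inl .refl
    | @tail z z' hz hstep ih =>
      rcases ih with ih | ih
      swap
      · exact Or.inr ih
      by_cases hsub : geodSeg z z' ⊆ slab n (s * (1 / 2))
      · obtain ⟨e, he, h1, h2, -⟩ := hstep
        exact Or.inl (ih.tail ⟨e, he, h1, h2, hsub⟩)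
      · obtain ⟨q, hq, hqs⟩ := not_subset.1 hsub
        have hqs' : s * (1 / 2) < height q := not_le.1 hqs
        have hqC : q ∈ G.cluster Φ (slab n s) ω (Φ.1 v.1) := hz.tail (hstep.of_mem_geodSeg hq)
        obtain ⟨u, hu1, hu2, hu3⟩ := exists_vertex_of_mem_cluster (A := slab n s) hvs hqC
        have hus : height (Φ.1 u.1) ≤ s := Conn.mem (S := {v : G.verts | Φ.1 v.1 ∈ slab n s}) hvs hu1
        have hup := height_pos (Φ.1 u.1)
        refine Or.inr ⟨u, hus, ?_, hu2⟩
        have hcosh : Real.cosh (hdist (Φ.1 u.1) q) ≤ c := by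
          rcases hu3 with rfl | ⟨e, -, hue, hqe⟩
          · rwa [hdist_self, Real.cosh_zero]
          · exact hdist_le_of_mem_edge hue hqe hc
        have h4 := height_le_mul (Φ.1 u.1) q
        have h5 : 2 * Real.cosh (hdist (Φ.1 u.1) q) * height (Φ.1 u.1) ≤
            2 * c * height (Φ.1 u.1) := by gcongr
        linarith
  obtain ⟨w, hw1, hw2, hw3⟩ := key.resolve_left hspec
  exact ⟨k, w, hw1, hw2, cluster_symm hw3, cluster_trans (cluster_symm hw3) hyk⟩

/-- The event in the theorem is covered by events of long connections from high vertices. -/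
theorem size_event_subset {c : ℝ} (hc1 : 1 ≤ c)
    (hc : ∀ v w : G.verts, G.graph.Adj v w → Real.cosh (hdist v.1 w.1) ≤ c)
    (Φ : isomGroup n) {r₀ r : ℝ} (hr₀ : 0 < r₀) (hr : r₀ + 1 ≤ r) :
    {ω | ENNReal.ofReal r ≤ size (⋃ v ∈ G.thickOrigin r₀ Φ, G.cluster Φ (slab n 1) ω v)} ⊆
      ⋃ (k : ℕ) (j : Fin n → ℤ) (w ∈ G.boxVerts Φ c ((1 / 2) ^ k) j),
        G.reachEvent Φ ((1 / 2) ^ k) w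
          (projDist (origin n) (Φ.1 w.1) / 2 + (r / 4 - (r₀ + 1))) := by
  intro ω hω
  -- The supremum defining the size need not be attained, so a point beyond `r - 1` is chosen.
  have h1 : ENNReal.ofReal (r - 1) <
      size (⋃ v ∈ G.thickOrigin r₀ Φ, G.cluster Φ (slab n 1) ω v) := by
    refine lt_of_lt_of_le ?_ hω
    rw [ENNReal.ofReal_lt_ofReal_iff (by linarith)]
    linarith
  rw [size, lt_iSup_iff] at h1
  obtain ⟨y, h1⟩ := h1
  rw [lt_iSup_iff] at h1
  obtain ⟨hyC, hyd⟩ := h1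
  have hyd' : r - 1 < projDist (origin n) y := (ENNReal.ofReal_lt_ofReal_iff'.1 hyd).1
  simp only [mem_iUnion] at hyC
  obtain ⟨_, ⟨⟨hv1, -⟩, v, hv, rfl⟩, hyC⟩ := hyC
  have hv1' : projDist (origin n) (Φ.1 v) ≤ r₀ := hv1
  have hne : y ≠ Φ.1 v := by
    rintro rfl
    linarith
  obtain ⟨k, w, hw1, hw2, hvw, hyw⟩ := exists_high_vertex hc1 hc (v := ⟨v, hv⟩) hne hyC
  simp only [mem_iUnion]
  refine ⟨k, fun i => ⌊lat (Φ.1 w.1) i / (1 / 2) ^ k⌋, w, ⟨hw1, hw2, fun _ => rfl⟩, ?_⟩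
  have t1 := projDist_triangle (origin n) (Φ.1 v) y
  have t2 := projDist_triangle (Φ.1 v) (Φ.1 w.1) y
  have t3 := projDist_triangle (origin n) (Φ.1 v) (Φ.1 w.1)
  rw [projDist_comm (Φ.1 v) (Φ.1 w.1)] at t2 t3
  -- Let $m$ be the larger of the distances from $w$ to $v$ and $y$. Then $r-1<r_0+2m$ and
  -- $d_\partial(o,w)\le r_0+m$; averaging the two lower bounds for $m$ gives the required distance.
  rcases le_total (projDist (Φ.1 w.1) (Φ.1 v)) (projDist (Φ.1 w.1) y) with hle | hle
  · exact ⟨y, hyw, by linarith⟩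
  · exact ⟨Φ.1 v, hvw, by linarith⟩

/-- In box $j$, $d_\partial(o,w)/s\ge\max_i|j_i|-1\ge\frac1n\sum_i|j_i|-1$. The half of
$d_\partial(o,w)$ in the exponent thus yields a product over coordinates with rate $\psi/(2n)$, at
the cost of $e^{\psi/2}$. -/
theorem perc_box_le {p : I} {A ψ : ℝ} (hA : 0 < A) (hψ : 0 < ψ) (hn : 1 ≤ n)
    (hdec : ∀ (Φ : isomGroup n) (s : ℝ) (w : G.verts) (ℓ : ℝ), 0 < s → height (Φ.1 w.1) ≤ s →
      G.perc p (G.reachEvent Φ s w ℓ) ≤ ENNReal.ofReal (A * Real.exp (-ψ * (ℓ / s))))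
    {c : ℝ} {M : ℕ} (hM : ∀ (Φ : isomGroup n) (s : ℝ) (j : Fin n → ℤ), 0 < s →
      (G.boxVerts Φ c s j).encard ≤ M) (Φ : isomGroup n) {s t : ℝ} (hs : 0 < s)
    (j : Fin n → ℤ) :
    G.perc p (⋃ w ∈ G.boxVerts Φ c s j, G.reachEvent Φ s w
      (projDist (origin n) (Φ.1 w.1) / 2 + t)) ≤
      M * ENNReal.ofReal (A * Real.exp (ψ / 2)) * ENNReal.ofReal (Real.exp (-ψ * (t / s))) *
        ∏ i, ENNReal.ofReal (Real.exp (-(ψ / (2 * n)) * |(j i : ℝ)|)) := by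
  have hfin : (G.boxVerts Φ c s j).Finite :=
    Set.finite_of_encard_le_coe (hM Φ s j hs)
  have hcard : (hfin.toFinset.card : ℝ≥0∞) ≤ M := by
    have := hM Φ s j hs
    rw [hfin.encard_eq_coe_toFinset_card] at this
    exact_mod_cast this
  set β := ENNReal.ofReal (A * Real.exp (ψ / 2)) * ENNReal.ofReal (Real.exp (-ψ * (t / s))) *
        ∏ i, ENNReal.ofReal (Real.exp (-(ψ / (2 * n)) * |(j i : ℝ)|))
  have hβ : ∀ w ∈ G.boxVerts Φ c s j, G.perc p (G.reachEvent Φ s w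
      (projDist (origin n) (Φ.1 w.1) / 2 + t)) ≤ β := by
    intro w hw
    refine (hdec Φ s w _ hs hw.1).trans ?_
    have hn0 : (0 : ℝ) < n := by exact_mod_cast hn
    have h1 : ∀ i, |(j i : ℝ)| - 1 ≤ projDist (origin n) (Φ.1 w.1) / s := by
      intro i
      have h2 := abs_lat_sub_le (origin n) (Φ.1 w.1) i
      rw [lat_origin, zero_sub, abs_neg] at h2
      have h3 : |lat (Φ.1 w.1) i / s| ≤ projDist (origin n) (Φ.1 w.1) / s := by
        rw [abs_div, abs_of_pos hs]
        gcongr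
      have h4 : |(j i : ℝ) - lat (Φ.1 w.1) i / s| ≤ 1 := by
        rw [← hw.2.2 i, abs_le]
        constructor
        · linarith [Int.lt_floor_add_one (lat (Φ.1 w.1) i / s)]
        · linarith [Int.floor_le (lat (Φ.1 w.1) i / s)]
      have h5 := abs_sub_abs_le_abs_sub (j i : ℝ) (lat (Φ.1 w.1) i / s)
      linarith
    have h2 : ∑ i, |(j i : ℝ)| ≤ n * (projDist (origin n) (Φ.1 w.1) / s + 1) := by
      refine (Finset.sum_le_sum fun i _ =>
        (show |(j i : ℝ)| ≤ projDist (origin n) (Φ.1 w.1) / s + 1 by linarith [h1 i])).trans ?_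
      simp [mul_add]
    simp only [β]
    rw [← ENNReal.ofReal_prod_of_nonneg fun i _ => (Real.exp_pos _).le,
      ← ENNReal.ofReal_mul (by positivity), ← ENNReal.ofReal_mul (by positivity),
      ← Real.exp_sum, mul_assoc, mul_assoc, ← Real.exp_add, ← Real.exp_add]
    refine ENNReal.ofReal_le_ofReal (mul_le_mul_of_nonneg_left (Real.exp_le_exp.2 ?_) hA.le)
    rw [← Finset.mul_sum]
    have h3 : ψ / (2 * n) * ∑ i, |(j i : ℝ)| ≤
        ψ / (2 * n) * (n * (projDist (origin n) (Φ.1 w.1) / s + 1)) := by gcongr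
    have h4 : ψ / (2 * n) * (n * (projDist (origin n) (Φ.1 w.1) / s + 1)) =
        ψ / 2 * (projDist (origin n) (Φ.1 w.1) / s) + ψ / 2 := by
      field_simp
    have h5 : -ψ * ((projDist (origin n) (Φ.1 w.1) / 2 + t) / s) =
        -(ψ / 2 * (projDist (origin n) (Φ.1 w.1) / s)) + -ψ * (t / s) := by
      field_simp
      ring
    rw [h5]
    linarith
  calc G.perc p (⋃ w ∈ G.boxVerts Φ c s j, G.reachEvent Φ s w
        (projDist (origin n) (Φ.1 w.1) / 2 + t))
      = G.perc p (⋃ w ∈ hfin.toFinset, G.reachEvent Φ s w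
        (projDist (origin n) (Φ.1 w.1) / 2 + t)) := by simp
    _ ≤ ∑ w ∈ hfin.toFinset, G.perc p (G.reachEvent Φ s w
        (projDist (origin n) (Φ.1 w.1) / 2 + t)) := measure_biUnion_finset_le _ _
    _ ≤ ∑ w ∈ hfin.toFinset, β := Finset.sum_le_sum fun w hw => hβ w (hfin.mem_toFinset.1 hw)
    _ = hfin.toFinset.card * β := by rw [Finset.sum_const, nsmul_eq_mul]
    _ ≤ M * β := by gcongr
    _ = _ := by simp only [β, mul_assoc]

/-- For $t\ge1$ one has $2^kt\ge t+k$, so the small scales contribute only a geometric series. -/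
theorem tsum_exp_dyadic_le {ψ t : ℝ} (hψ : 0 < ψ) (ht : 1 ≤ t) :
    ∑' k : ℕ, ENNReal.ofReal (Real.exp (-ψ * (t / (1 / 2) ^ k))) ≤
      (∑' k : ℕ, ENNReal.ofReal (Real.exp (-ψ * k))) * ENNReal.ofReal (Real.exp (-ψ * t)) := by
  rw [← ENNReal.tsum_mul_right]
  refine ENNReal.tsum_le_tsum fun k => ?_
  rw [← ENNReal.ofReal_mul (Real.exp_pos _).le, ← Real.exp_add]
  refine ENNReal.ofReal_le_ofReal (Real.exp_le_exp.2 ?_)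
  have h1 : t / (1 / 2) ^ k = t * 2 ^ k := by
    rw [one_div, inv_pow, div_inv_eq_mul]
  have h2 : (k : ℝ) + 1 ≤ 2 ^ k := by
    have := Nat.lt_two_pow_self (n := k)
    exact_mod_cast this
  have hk : (0 : ℝ) ≤ k := Nat.cast_nonneg k
  have h3 : (k : ℝ) + t ≤ t * 2 ^ k := by nlinarith
  rw [h1]
  nlinarith

theorem exists_size_decay (hn : 1 ≤ n) (hfin : G.LocFinite) (htrans : G.TransUnderIsom)
    (ho : origin n ∈ G.verts) {p : I} (hp : G.UnifDecay p) {r₀ : ℝ} (hr₀ : 0 < r₀) :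
    ∃ α φ : ℝ, 0 < α ∧ 0 < φ ∧ ∀ r : ℝ, 0 ≤ r →
      (⨆ Φ : isomGroup n, G.perc p {ω | ENNReal.ofReal r ≤
        size (⋃ v ∈ G.thickOrigin r₀ Φ, G.cluster Φ (slab n 1) ω v)}) ≤
      ENNReal.ofReal (α * Real.exp (-φ * r)) := by
  obtain ⟨c, hc1, hc⟩ := exists_cosh_edge_le hfin htrans ho
  obtain ⟨M, hM⟩ := exists_encard_boxVerts_le hfin htrans ho hc1
  obtain ⟨A, ψ, hA, hψ, hdec⟩ := hp.reachEvent_le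
  have hn0 : (0 : ℝ) < n := by exact_mod_cast hn
  set Z := ∑' m : ℤ, ENNReal.ofReal (Real.exp (-(ψ / (2 * n)) * |(m : ℝ)|)) with hZ
  have hZtop : Z ≠ ⊤ := tsum_exp_abs_ne_top (by positivity)
  set Y := ∑' k : ℕ, ENNReal.ofReal (Real.exp (-ψ * k)) with hY
  have hYtop : Y ≠ ⊤ := by
    have h1 : Summable fun k : ℕ => Real.exp (-ψ) ^ k :=
      summable_geometric_of_lt_one (Real.exp_pos _).le (Real.exp_lt_one_iff.2 (by linarith))
    have h2 : Summable fun k : ℕ => Real.exp (-ψ * k) := by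
      refine h1.congr fun k => ?_
      rw [← Real.exp_nat_mul, mul_comm]
    exact h2.tsum_ofReal_ne_top
  set K : ℝ≥0∞ := M * ENNReal.ofReal (A * Real.exp (ψ / 2)) * Z ^ n * Y with hK
  have hKtop : K ≠ ⊤ :=
    ENNReal.mul_ne_top (ENNReal.mul_ne_top (ENNReal.mul_ne_top (ENNReal.natCast_ne_top M)
      ENNReal.ofReal_ne_top) (ENNReal.pow_ne_top hZtop)) hYtop
  have hmain : ∀ (Φ : isomGroup n) (r : ℝ), 4 * (r₀ + 2) ≤ r →
      G.perc p {ω | ENNReal.ofReal r ≤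
        size (⋃ v ∈ G.thickOrigin r₀ Φ, G.cluster Φ (slab n 1) ω v)} ≤
      K * ENNReal.ofReal (Real.exp (-ψ * (r / 4 - (r₀ + 1)))) := by
    intro Φ r hr
    set t := r / 4 - (r₀ + 1) with ht
    have ht1 : 1 ≤ t := by linarith
    refine (measure_mono (size_event_subset hc1 hc Φ hr₀ (by linarith))).trans ?_
    calc _ ≤ ∑' k : ℕ, ∑' j : Fin n → ℤ,
          M * ENNReal.ofReal (A * Real.exp (ψ / 2)) *
            ENNReal.ofReal (Real.exp (-ψ * (t / (1 / 2) ^ k))) *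
            ∏ i, ENNReal.ofReal (Real.exp (-(ψ / (2 * n)) * |(j i : ℝ)|)) := by
          refine (measure_iUnion_le _).trans (ENNReal.tsum_le_tsum fun k => ?_)
          refine (measure_iUnion_le _).trans (ENNReal.tsum_le_tsum fun j => ?_)
          exact perc_box_le hA hψ hn hdec hM Φ (by positivity) j
      _ = M * ENNReal.ofReal (A * Real.exp (ψ / 2)) * Z ^ n *
            ∑' k : ℕ, ENNReal.ofReal (Real.exp (-ψ * (t / (1 / 2) ^ k))) := by
          rw [← ENNReal.tsum_mul_left]
          refine tsum_congr fun k => ?_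
          rw [ENNReal.tsum_mul_left, tsum_pi_prod_eq_pow
            (fun m : ℤ => ENNReal.ofReal (Real.exp (-(ψ / (2 * n)) * |(m : ℝ)|)))]
          rw [← hZ]
          ring
      _ ≤ M * ENNReal.ofReal (A * Real.exp (ψ / 2)) * Z ^ n *
            (Y * ENNReal.ofReal (Real.exp (-ψ * t))) := by
          gcongr
          exact tsum_exp_dyadic_le hψ ht1
      _ = _ := by rw [hK]; ring
  -- The first summand serves $r\ge4(r_0+2)$, where $t\ge1$; the second makes the bound at least $1$
  -- for smaller $r$.
  refine ⟨K.toReal * Real.exp (ψ * (r₀ + 1)) + Real.exp (ψ / 4 * (4 * (r₀ + 2))), ψ / 4,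
    by positivity, by positivity, fun r hr => iSup_le fun Φ => ?_⟩
  rcases le_or_gt (4 * (r₀ + 2)) r with h | h
  · refine (hmain Φ r h).trans ?_
    rw [← ENNReal.ofReal_toReal hKtop, ← ENNReal.ofReal_mul ENNReal.toReal_nonneg]
    refine ENNReal.ofReal_le_ofReal ?_
    have h1 : Real.exp (-ψ * (r / 4 - (r₀ + 1))) =
        Real.exp (ψ * (r₀ + 1)) * Real.exp (-(ψ / 4) * r) := by
      rw [← Real.exp_add]
      congr 1
      ring
    rw [h1, ← mul_assoc, ENNReal.toReal_ofReal ENNReal.toReal_nonneg]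
    gcongr
    have := Real.exp_pos (ψ / 4 * (4 * (r₀ + 2)))
    linarith
  · refine prob_le_one.trans ?_
    rw [← ENNReal.ofReal_one]
    refine ENNReal.ofReal_le_ofReal ?_
    have h1 : 1 ≤ Real.exp (ψ / 4 * (4 * (r₀ + 2))) * Real.exp (-(ψ / 4) * r) := by
      rw [← Real.exp_add]
      refine Real.one_le_exp ?_
      nlinarith
    refine h1.trans ?_
    gcongr
    have : 0 ≤ K.toReal * Real.exp (ψ * (r₀ + 1)) := by positivity
    linarith

end EmbGraph

end HypPerc

end

theorem mainTheorem3 (n : ℕ) (hn : 1 ≤ n) (G : HypPerc.EmbGraph n)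
    (hconn : G.graph.Connected) (hfin : G.LocFinite) (htrans : G.TransUnderIsom)
    (ho : HypPerc.origin n ∈ G.verts)
    (p : unitInterval) (hp : G.ExpDecay p ∨ (p : ℝ) < G.p0) (r₀ : ℝ) (hr₀ : 0 < r₀) :
    ∃ α φ : ℝ, 0 < α ∧ 0 < φ ∧ ∀ r : ℝ, 0 ≤ r →
      (⨆ Φ : HypPerc.isomGroup n,
        G.perc p {ω | ENNReal.ofReal r ≤ HypPerc.size
          (⋃ v ∈ G.thickOrigin r₀ Φ, G.cluster Φ (HypPerc.slab n 1) ω v)})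
      ≤ ENNReal.ofReal (α * Real.exp (-φ * r)) := by
  have h : G.UnifDecay p := hp.elim (HypPerc.EmbGraph.unifDecay_of_expDecay htrans ho)
    (HypPerc.EmbGraph.unifDecay_of_lt_p0 hfin htrans ho)
  exact HypPerc.EmbGraph.exists_size_decay hn hfin htrans ho h hr₀
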